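/- **Setting.** Let $\mathcal A$ be a unital nuclear Fréchet algebra over $\mathbb C$ (complete, metrizable, topologized by submultiplicative seminorms) with an involution $*$, such that every self-adjoint $h\in\mathcal A$ has bounded spectrum and, for every continuous seminorm $p$, $p(e^{ish})$ grows at most polynomially in $s\in\mathbb R$, locally uniformly in self-adjoint $h$ (for example $\mathcal A=C^\infty(\mathbb T^m_\theta)$). Let $\varphi_0:\mathcal A\to\mathbb C$ be a continuous trace, and let $\delta:\mathcal A\to\mathcal A$ be a derivation of the form $\delta(a)=\frac{d}{dt}\big|_{t=0}\alpha_t(a)$ for all $a\in\mathcal A$, where $(\alpha_t)_{t\in\mathbb R}$ is a one-parameter group of automorphisms of $\mathcal A$; assume $\varphi_0\circ\delta=0$. For $h=h^*\in\mathcal A$ let $\mathbf x=[\,\cdot\,,h]$, so that $e^{z\mathbf x}(\rho)=e^{-zh}\rho\, e^{zh}$, and let $\mathbf x_l$ denote $\mathbf x$ acting on the $l$-th factor of a product. For $f:\mathbb R^n\to\mathbb C$ the functional calculus is $$f(\mathbf x_1,\dots,\mathbf x_n)(\rho_1\cdots\rho_n)=\int_{\mathbb R^n}\hat g(\xi)\,e^{2\pi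 i\xi_1\mathbf x}(\rho_1)\cdots e^{2\pi i\xi_n\mathbf x}(\rho_n)\,d\xi ,\qquad \hat g(\xi)=\int_{\mathbb R^n} g(x)e^{-2\pi i\langle x,\xi\rangle}dx,$$ where $g$ is any Schwartz function equal to $f$ on $U^n$, and $U\subset\mathbb R$ is any bounded open set containing the spectrum of $1\otimes h-h\otimes 1$, i.e. all differences of spectral values of $h$; the integral is taken in the weak sense. The class $C(\mathbb R^n)$ consists of the $f$ for which, for every $h=h^*$ and all $\rho_1,\dots,\rho_n\in\mathcal A$, this is well defined, i.e. there is exactly one element of $\mathcal A$ that is the value of the integral for all choices of $U$ and $g$. For $j\in\mathbb R$ put $$\tau_j(f)(x)=e^{jx}f(-x),\qquad \tau_j(f)(x_1,x_2)=e^{j(x_1+x_2)}f(-x_1-x_2,x_1),\qquad \blacktriangle^+(f)(x_1,x_2)=f[x_1,x_1+x_2],$$ where $f[x,y]=\frac{f(x)-f(y)}{x-y}$ for $x\ne y$ and $f[x,x]=f'(x)$. **Theorem.** Let $j\in\mathbb R$, let $f:\mathbb R\to\mathbb C$ be smooth, and for $h=h^*\in\mathcal A$ let $$F(h)=\varphi_0\big(e^{jh}f(\mathbf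 x)(\delta h)\cdot\delta h\big).$$ Put $$K_f=-(1+\tau_j)(f),\qquad H_f=\big((1+\tau_j-\tau_j^2)\cdot\blacktriangle^+\big)(K_f).$$ Then $f,K_f\in C(\mathbb R)$, $H_f\in C(\mathbb R^2)$, and for every $h=h^*\in\mathcal A$ the element $$\operatorname{grad}_hF=e^{jh}\Big(K_f(\mathbf x)(\delta^2h)+H_f(\mathbf x_1,\mathbf x_2)(\delta h\,\delta h)\Big)$$ is a gradient of $F$ at $h$, that is, $$\frac{d}{d\varepsilon}\Big|_{\varepsilon=0}F(h+\varepsilon a)=\varphi_0\big(a\,\operatorname{grad}_hF\big)\qquad\text{for all }a=a^*\in\mathcal A ,$$ the derivative being part of the claim. If the pairing $(a,b)\mapsto\varphi_0(ab)$ is nondegenerate, it is the only element of $\mathcal A$ with this property. -/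

import Mathlib

open Filter Topology MeasureTheory
open scoped SchwartzMap FourierTransform ContDiff

noncomputable section

namespace ModularVariation

/-! ### Nuclear Fréchet algebras -/

section Algebra

variable (A : Type*) [Ring A] [Algebra ℂ A]

/-- A locally convex space `E` is nuclear: for every continuous seminorm `p` there is a continuous
seminorm `q` such that the canonical map `E_q → E_p` is nuclear, i.e. has a representation
`x ↦ ∑ cₙ ℓₙ(x) yₙ` with `∑ cₙ < ∞`, `|ℓₙ| ≤ q` and `p(yₙ) ≤ 1`, convergent with respect to `p`. -/
def IsNuclearSpace (E : Type*) [AddCommGroup E] [Module ℂ E] [TopologicalSpace E] : Prop :=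
  ∀ p : Seminorm ℂ E, Continuous p → ∃ q : Seminorm ℂ E, Continuous q ∧
    ∃ (c : ℕ → ℝ) (l : ℕ → E →ₗ[ℂ] ℂ) (y : ℕ → E),
      (∀ n, 0 ≤ c n) ∧ Summable c ∧ (∀ n x, ‖l n x‖ ≤ q x) ∧ (∀ n, p (y n) ≤ 1) ∧
      ∀ x, Tendsto (fun N : ℕ => p (x - ∑ n ∈ Finset.range N, ((c n : ℂ) * l n x) • y n))
        atTop (𝓝 0)

/-- The topology of the algebra is defined by its continuous submultiplicative seminorms. -/
def IsMultiplicativelyConvex [TopologicalSpace A] : Prop :=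
  ∀ V ∈ 𝓝 (0 : A), ∃ p : Seminorm ℂ A, Continuous p ∧ (∀ a b, p (a * b) ≤ p a * p b) ∧
    {a | p a < 1} ⊆ V

/-- A nuclear Fréchet algebra: the topology is Hausdorff, metrizable, complete, defined by
submultiplicative seminorms, and nuclear. -/
structure IsNuclearFrechetAlgebra [UniformSpace A] : Prop where
  t2 : T2Space A
  firstCountable : FirstCountableTopology A
  complete : CompleteSpace A
  multiplicativelyConvex : IsMultiplicativelyConvex A
  nuclear : IsNuclearSpace A

/-- The condition under which the Fourier integrals of the smooth functional calculus make sense: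
self-adjoint elements have bounded spectrum, and their unitary groups `exp (i s h)` grow at most
polynomially in `s` with respect to every continuous seminorm, locally uniformly in `h`. -/
structure HasTemperedSelfAdjoints [TopologicalSpace A] [IsTopologicalRing A] [StarRing A] :
    Prop where
  bounded : ∀ h : A, IsSelfAdjoint h → Bornology.IsBounded (spectrum ℂ h)
  tempered : ∀ h : A, IsSelfAdjoint h → ∀ p : Seminorm ℂ A, Continuous p →
    ∃ V ∈ 𝓝 h, ∃ (C : ℝ) (N : ℕ), ∀ h' ∈ V, IsSelfAdjoint h' → ∀ s : ℝ,
      p (NormedSpace.exp ((Complex.I * (s : ℂ)) • h')) ≤ C * (1 + |s|) ^ N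

end Algebra

/-! ### Smooth functional calculus of the modular derivation -/

section Calculus

variable {A : Type*} [Ring A] [Algebra ℂ A] [TopologicalSpace A] [IsTopologicalRing A]

/-- `v` is the (weak) integral of the vector-valued function `F`. -/
def IsWeakIntegral {X : Type*} [MeasurableSpace X] (μ : Measure X) (F : X → A) (v : A) : Prop :=
  ∀ l : A →L[ℂ] ℂ, Integrable (fun x => l (F x)) μ ∧ ∫ x, l (F x) ∂μ = l v

/-- `exp (z 𝐱)` applied to `ρ`, where `𝐱 = [·, h]` is the modular derivation:
`exp (z 𝐱)(ρ) = exp (-z h) ρ exp (z h)`. -/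
def modularFlow (h : A) (z : ℂ) (ρ : A) : A :=
  NormedSpace.exp (-(z • h)) * ρ * NormedSpace.exp (z • h)

/-- `exp (∑ zₗ 𝐱ₗ)` applied to the product `ρ₁ ⋯ ρₙ`, the partial modular derivation `𝐱ₗ` acting on
the `l`-th factor. -/
def partialModularFlow (h : A) {n : ℕ} (z : Fin n → ℂ) (ρ : Fin n → A) : A :=
  (List.ofFn fun l => modularFlow h (z l) (ρ l)).prod

/-- `U` is a bounded open subset of the real line which contains the spectrum of
`𝐱 = 1 ⊗ h - h ⊗ 1`, that is, all the differences of spectral values of `h`. -/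
def IsSpectralNhd (h : A) (U : Set ℝ) : Prop :=
  IsOpen U ∧ Bornology.IsBounded U ∧
    ∀ z ∈ spectrum ℂ h, ∀ w ∈ spectrum ℂ h, ∃ u ∈ U, (u : ℂ) = w - z

/-- `v = f(𝐱₁, …, 𝐱ₙ)(ρ₁ ⋯ ρₙ)`: for every bounded open set `U` around the spectrum of `𝐱` and every
Schwartz function `g` which agrees with `f` on `Uⁿ`,
`v = ∫ ĝ(ξ) exp (2πi (ξ₁ 𝐱₁ + ⋯ + ξₙ 𝐱ₙ))(ρ₁ ⋯ ρₙ) dξ`,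
where `ĝ(ξ) = ∫ g(x) exp (-2πi ⟨x, ξ⟩) dx`. -/
def HasModularCalculus (h : A) {n : ℕ} (f : (Fin n → ℝ) → ℂ) (ρ : Fin n → A) (v : A) : Prop :=
  ∀ (U : Set ℝ) (g : 𝓢(EuclideanSpace ℝ (Fin n), ℂ)), IsSpectralNhd h U →
    (∀ x : EuclideanSpace ℝ (Fin n), (∀ l, x l ∈ U) → g x = f fun l => x l) →
    IsWeakIntegral volume
      (fun ξ : EuclideanSpace ℝ (Fin n) => (𝓕 g) ξ •
        partialModularFlow h (fun l => 2 * (Real.pi : ℂ) * Complex.I * (ξ l : ℂ)) ρ) v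

open Classical in
/-- The element `f(𝐱₁, …, 𝐱ₙ)(ρ₁ ⋯ ρₙ)` of the algebra. -/
def modularCalculus (h : A) {n : ℕ} (f : (Fin n → ℝ) → ℂ) (ρ : Fin n → A) : A :=
  if H : ∃ v, HasModularCalculus h f ρ v then H.choose else 0

variable (A) in
/-- The class `C(ℝⁿ)` of spectral functions: those for which the functional calculus is
well defined, for every self-adjoint `h`. -/
def IsSpectralFunction [StarRing A] {n : ℕ} (f : (Fin n → ℝ) → ℂ) : Prop :=
  ∀ h : A, IsSelfAdjoint h → ∀ ρ : Fin n → A, ∃! v, HasModularCalculus h f ρ v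

end Calculus

/-! ### Transformations of spectral functions -/

/-- The cyclic transformation `(x₁, …, xₙ) ↦ (-x₁ - ⋯ - xₙ, x₁, …, xₙ₋₁)`, for `n ≥ 1`. -/
def cyc {n : ℕ} (x : Fin (n + 1) → ℝ) : Fin (n + 1) → ℝ :=
  Fin.cons (-∑ i, x i) (Fin.init x)

/-- The cyclic operator `τⱼ`: apply `cyc` to the arguments of `exp (-j x₁) f(x₁, …, xₙ)`. -/
def tau (j : ℝ) {n : ℕ} (f : (Fin (n + 1) → ℝ) → ℂ) : (Fin (n + 1) → ℝ) → ℂ :=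
  fun x => Complex.exp (-(j : ℂ) * (cyc x 0 : ℂ)) * f (cyc x)

/-- The operator `▲⁺(f)(x₁, x₂) = f[x₁, x₁ + x₂]`, a (confluent) divided difference. -/
def triangle (f : (Fin 1 → ℝ) → ℂ) : (Fin 2 → ℝ) → ℂ :=
  fun x => dslope (fun t : ℝ => f ![t]) (x 0) (x 0 + x 1)

/-- `K_f = -(1 + τⱼ)(f)`. -/
def spectralK (j : ℝ) (f : (Fin 1 → ℝ) → ℂ) : (Fin 1 → ℝ) → ℂ :=
  -(f + tau j f)

/-- `((1 + τⱼ - τⱼ²) · ▲⁺)(K)`. -/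
def connesMoscovici (j : ℝ) (K : (Fin 1 → ℝ) → ℂ) : (Fin 2 → ℝ) → ℂ :=
  triangle K + tau j (triangle K) - tau j (tau j (triangle K))

/-! ### Derivations, the functional and its gradient -/

section Gradient

variable {A : Type*} [Ring A] [Algebra ℂ A] [TopologicalSpace A]

/-- `δ` is the infinitesimal generator of a one-parameter group of automorphisms of the algebra:
`δ(a) = d/dt αₜ(a)` at `t = 0`, for every `a`. -/
def IsInfinitesimalDerivation (δ : A → A) : Prop :=
  ∃ α : ℝ → (A ≃A[ℂ] A), (∀ s t a, α (s + t) a = α s (α t a)) ∧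
    ∀ a, Tendsto (fun t : ℝ => ((t : ℂ)⁻¹) • (α t a - a)) (𝓝[≠] 0) (𝓝 (δ a))

/-- `F(h) = φ₀(exp (j h) f(𝐱)(δ h) · δ h)`. -/
def functionalF [IsTopologicalRing A] (φ₀ : A →L[ℂ] ℂ) (δ : A → A) (j : ℝ)
    (f : (Fin 1 → ℝ) → ℂ) (h : A) : ℂ :=
  φ₀ (NormedSpace.exp ((j : ℂ) • h) * modularCalculus h f ![δ h] * δ h)

/-- `G` is a gradient of `F` at `h` with respect to the pairing given by `φ₀`:
`d/dε F(h + ε a) = φ₀(a G)` at `ε = 0`, for every self-adjoint `a`. -/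
def IsGradientAt [StarRing A] (φ₀ : A →L[ℂ] ℂ) (F : A → ℂ) (h G : A) : Prop :=
  ∀ a : A, IsSelfAdjoint a →
    HasDerivAt (fun ε : ℝ => F (h + (ε : ℂ) • a)) (φ₀ (a * G)) 0

end Gradient

end ModularVariation

end

/-!
The gradient is computed by Fourier analysis in Banach algebras, where everything reduces to an
identity between functions of three spectral variables.

A continuous submultiplicative seminorm `q` on `A` gives a Banach algebra `q.Local`, and these Banach
algebras determine the points, the weak integrals and the continuous functionals of `A`. In `q.Local`
the group `E(s) = exp (2 π i s h)` of a self-adjoint `h` grows polynomially, so that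
`g(h) = ∫ ĝ(s) E(s) ds` is defined for Schwartz functions `g`. It depends only on `g` near the
spectrum: by Gelfand theory in the double commutant of `h`, a function without zeros on the spectrum
gives an invertible element (`IsTempered.isUnit_opCalc`), hence a cutoff function which is `1` near
the spectrum gives `1` (`IsTempered.opCalc_eq_one`), and a function which is `exp (j x)` near the
spectrum gives `exp (j h)` (`IsTempered.opCalc_eq_exp`). Inserting such a cutoff next to each
exponential shows that an absolutely convergent superposition of the products
`E(y₀) ρ₁ E(y₁) ρ₂ E(y₂)` is determined by its symbol, the corresponding superposition of the
characters `exp (2 π i (y₀ λ₀ + y₁ λ₁ + y₂ λ₂))`, near the spectrum and up to null sets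
(`IsTempered.integral_tripleFlow_congr`).

The symbol of `f(𝐱₁, …, 𝐱ₙ)(ρ₁ ⋯ ρₙ)` is `f(λ₁ - λ₀, …, λₙ - λₙ₋₁)`. The preceding principle
therefore yields the independence of the choices, and every smooth `f` has a well-defined calculus
(`TriplePresentation.existsUnique`). The spectrum of `h` is real and bounded, so that suitable
neighbourhoods exist (`HasTemperedSelfAdjoints.exists_isSpectralNhd`).

For the gradient, `F(h + ε a)` is an integral of `φ₀ (δh E(p) δh E(r))`, with `h + ε a` in the place
of `h`, against a rapidly decreasing density which is the same for all small `ε`. The derivative is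
taken under the integral sign by means of Duhamel's formula (`hasDerivAt_integral_flow`). The trace
property moves a varied exponential to the front, and `φ₀ ∘ δ = 0` removes `δ a` by an integration by
parts (`variationIntegrand_eq`). What is left is `φ₀ (a G)`, with `G` a superposition of `E(y₀) δ²h E(y₁)`
and `E(y₀) δh E(y₁) δh E(y₂)`, and it remains to compare symbols
(`integral_variationIntegrand_eq`). With `θ(λ, μ) = exp (j λ) f(μ - λ)`, the first symbol is
`-(θ(λ₀, λ₁) + θ(λ₁, λ₀)) = exp (j λ₀) K(λ₁ - λ₀)` (`twistedSymbol_spectralK`). Duhamel's formula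
turns symbols into divided differences, and the second symbol is an alternating sum of divided
differences of the first over the cyclic rotations of `(λ₀, λ₁, λ₂)` (`sum_six_symbol`). Since `τⱼ`
is the rotation of such triples, twisted by an exponential, this is
`exp (j λ₀) H(λ₁ - λ₀, λ₂ - λ₁)` (`exp_mul_connesMoscovici`).

Uniqueness holds since every element is a combination of two self-adjoint ones
(`IsGradientAt.eq`).
-/

noncomputable section

namespace ModularVariation

/-! ### The Banach algebras of a multiplicatively convex algebra -/

/-- A continuous submultiplicative seminorm on a topological algebra. -/
structure SubmultSeminorm (A : Type*) [Ring A] [Algebra ℂ A] [TopologicalSpace A] where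
  /-- The underlying seminorm. -/
  toSeminorm : Seminorm ℂ A
  continuous_toSeminorm : Continuous toSeminorm
  map_mul_le : ∀ a b, toSeminorm (a * b) ≤ toSeminorm a * toSeminorm b

namespace SubmultSeminorm

variable {A : Type*} [Ring A] [Algebra ℂ A] [TopologicalSpace A]

/-- The algebra `A` seen as a seminormed algebra, the seminorm being `q`. -/
def Pre (_ : SubmultSeminorm A) : Type _ := A

variable (q : SubmultSeminorm A)

instance instRingPre : Ring q.Pre := inferInstanceAs (Ring A)
instance instAlgebraPre : Algebra ℂ q.Pre := inferInstanceAs (Algebra ℂ A)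

instance instSeminormedAddCommGroupPre : SeminormedAddCommGroup q.Pre :=
  AddGroupSeminorm.toSeminormedAddCommGroup (E := q.Pre) q.toSeminorm.toAddGroupSeminorm

instance instSeminormedRingPre : SeminormedRing q.Pre :=
  { instRingPre q, instSeminormedAddCommGroupPre q with
    norm_mul_le := fun a b => q.map_mul_le a b }

instance instNormedAlgebraPre : NormedAlgebra ℂ q.Pre :=
  { instAlgebraPre q with
    norm_smul_le := fun c a => (map_smul_eq_mul q.toSeminorm c a).le }

/-- The Banach algebra obtained by completing `A` with respect to `q`. -/
abbrev Local : Type _ := UniformSpace.Completion q.Pre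

instance instNormedAlgebraLocal : NormedAlgebra ℂ q.Local :=
  { (inferInstance : Algebra ℂ (UniformSpace.Completion q.Pre)) with
    norm_smul_le := norm_smul_le }

/-- The canonical homomorphism from `A` to its completion with respect to `q`. -/
def toLocal : A →ₐ[ℂ] q.Local where
  toFun a := ((show q.Pre from a : q.Pre) : q.Local)
  map_one' := UniformSpace.Completion.coe_one _
  map_mul' a b := UniformSpace.Completion.coe_mul (α := q.Pre) a b
  map_zero' := UniformSpace.Completion.coe_zero
  map_add' a b := UniformSpace.Completion.coe_add (α := q.Pre) a b
  commutes' _ := rfl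

lemma norm_toLocal (a : A) : ‖q.toLocal a‖ = q.toSeminorm a :=
  UniformSpace.Completion.norm_coe (E := q.Pre) a

lemma denseRange_toLocal : DenseRange q.toLocal :=
  UniformSpace.Completion.denseRange_coe (α := q.Pre)

lemma continuous_toLocal [IsTopologicalAddGroup A] : Continuous q.toLocal := by
  refine continuous_of_continuousAt_zero q.toLocal ?_
  rw [ContinuousAt, map_zero, tendsto_zero_iff_norm_tendsto_zero]
  simp only [norm_toLocal]
  simpa using q.continuous_toSeminorm.tendsto 0

/-- A linear map dominated by `q` extends to the completion with respect to `q`. -/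
lemma exists_extension {E : Type*} [NormedAddCommGroup E] [NormedSpace ℂ E] [CompleteSpace E]
    (L : A →ₗ[ℂ] E) (C : ℝ) (hL : ∀ a, ‖L a‖ ≤ C * q.toSeminorm a) :
    ∃ T : q.Local →L[ℂ] E, ∀ a, T (q.toLocal a) = L a := by
  let L' : q.Pre →L[ℂ] E := LinearMap.mkContinuous
    { toFun := L, map_add' := L.map_add, map_smul' := L.map_smul } C hL
  exact ⟨L'.fromCompletion, fun a => L'.fromCompletion_apply_coe a⟩

/-- The maximum of two continuous submultiplicative seminorms. -/
def sup (q r : SubmultSeminorm A) : SubmultSeminorm A where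
  toSeminorm := q.toSeminorm ⊔ r.toSeminorm
  continuous_toSeminorm := by
    have : (⇑(q.toSeminorm ⊔ r.toSeminorm) : A → ℝ) = fun a => q.toSeminorm a ⊔ r.toSeminorm a := rfl
    rw [this]
    exact q.continuous_toSeminorm.sup r.continuous_toSeminorm
  map_mul_le a b := by
    simp only [Seminorm.sup_apply]
    refine max_le ((q.map_mul_le a b).trans ?_) ((r.map_mul_le a b).trans ?_) <;> gcongr <;> simp

/-- The completion with respect to a larger seminorm maps to the one with respect to a smaller
seminorm. -/
lemma exists_transition {q r : SubmultSeminorm A} (h : ∀ a, q.toSeminorm a ≤ r.toSeminorm a) :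
    ∃ T : r.Local →L[ℂ] q.Local, ∀ a, T (r.toLocal a) = q.toLocal a :=
  r.exists_extension q.toLocal.toLinearMap 1 fun a => by simpa [norm_toLocal] using h a

end SubmultSeminorm

/-! ### Integrals of functions with values in the algebra -/

section WeakIntegral

variable {A : Type*} [Ring A] [Algebra ℂ A]

lemma exists_submultSeminorm [TopologicalSpace A] (hA : IsMultiplicativelyConvex A)
    {V : Set A} (hV : V ∈ 𝓝 (0 : A)) :
    ∃ q : SubmultSeminorm A, {a | q.toSeminorm a < 1} ⊆ V := by
  obtain ⟨p, hp, hmul, hsub⟩ := hA V hV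
  exact ⟨⟨p, hp, hmul⟩, hsub⟩

/-- A continuous functional on `A` factors through one of the Banach algebras `q.Local`. -/
lemma exists_factor [TopologicalSpace A] (hA : IsMultiplicativelyConvex A) (l : A →L[ℂ] ℂ) :
    ∃ (q : SubmultSeminorm A) (l' : q.Local →L[ℂ] ℂ), ∀ a, l' (q.toLocal a) = l a := by
  have hV : {a : A | ‖l a‖ < 1} ∈ 𝓝 (0 : A) :=
    (isOpen_lt l.continuous.norm continuous_const).mem_nhds (by simp)
  obtain ⟨q, hq⟩ := exists_submultSeminorm hA hV
  refine ⟨q, q.exists_extension l.toLinearMap 1 fun a => ?_⟩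
  have hq' : ∀ a, q.toSeminorm a < 1 → ‖l a‖ < 1 := fun a ha => hq ha
  rw [one_mul]
  refine le_of_forall_gt fun c hc => ?_
  have hc0 : 0 < c := (apply_nonneg q.toSeminorm a).trans_lt hc
  have := hq' ((c⁻¹ : ℂ) • a) (by
    rw [map_smul_eq_mul]
    simp only [norm_inv, Complex.norm_real, Real.norm_eq_abs, abs_of_pos hc0]
    rwa [inv_mul_lt_iff₀ hc0, mul_one])
  rw [map_smul, norm_smul] at this
  simp only [norm_inv, Complex.norm_real, Real.norm_eq_abs, abs_of_pos hc0] at this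
  rw [inv_mul_lt_iff₀ hc0, mul_one] at this
  exact this

/-- The homomorphisms to the Banach algebras `q.Local` separate the points of `A`. -/
lemma eq_of_forall_toLocal_eq [TopologicalSpace A] [T1Space A] (hA : IsMultiplicativelyConvex A)
    {a b : A} (h : ∀ q : SubmultSeminorm A, q.toLocal a = q.toLocal b) : a = b := by
  by_contra hab
  have hV : ({a - b}ᶜ : Set A) ∈ 𝓝 (0 : A) :=
    isOpen_compl_singleton.mem_nhds (by simpa [eq_comm, sub_eq_zero] using hab)
  obtain ⟨q, hq⟩ := exists_submultSeminorm hA hV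
  refine hq (a := a - b) ?_ rfl
  rw [Set.mem_ofPred_eq, ← q.norm_toLocal, map_sub, h q]
  simp

/-- The continuous functionals on `A` separate its points. -/
lemma eq_of_forall_functional_eq [TopologicalSpace A] [IsTopologicalAddGroup A]
    [T1Space A] (hA : IsMultiplicativelyConvex A) {a b : A}
    (h : ∀ l : A →L[ℂ] ℂ, l a = l b) : a = b := by
  refine eq_of_forall_toLocal_eq hA fun q => ?_
  by_contra hne
  obtain ⟨g, hg⟩ := SeparatingDual.exists_separating_of_ne (R := ℂ) hne
  exact hg <| h ⟨g.toLinearMap ∘ₗ q.toLocal.toLinearMap, g.continuous.comp q.continuous_toLocal⟩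

/-- A function with values in `A` has an integral if it is Bochner integrable in each of the Banach
algebras `q.Local`: the Bochner integrals are limits of one and the same Cauchy filter on `A`. -/
lemma exists_toLocal_eq_integral [UniformSpace A] [IsUniformAddGroup A] [T2Space A] [CompleteSpace A]
    (hA : IsMultiplicativelyConvex A) {X : Type*} [MeasurableSpace X] {μ : Measure X} {F : X → A}
    (hF : ∀ q : SubmultSeminorm A, Integrable (fun x => q.toLocal (F x)) μ) :
    ∃ v : A, ∀ q : SubmultSeminorm A, q.toLocal v = ∫ x, q.toLocal (F x) ∂μ := by
  -- the points of `A` which are `q`-close to the integral in `q.Local`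
  let G : SubmultSeminorm A → Filter A := fun q => comap q.toLocal (𝓝 (∫ x, q.toLocal (F x) ∂μ))
  -- the transition maps carry integrals to integrals, so that the filters `G q` are directed
  have hmono : ∀ q r : SubmultSeminorm A, (∀ a, q.toSeminorm a ≤ r.toSeminorm a) → G r ≤ G q := by
    intro q r h
    obtain ⟨T, hT⟩ := SubmultSeminorm.exists_transition h
    have hTi : T (∫ x, r.toLocal (F x) ∂μ) = ∫ x, q.toLocal (F x) ∂μ := by
      rw [← T.integral_comp_comm (hF r)]
      simp only [hT]
    have hTq : (⇑q.toLocal : A → q.Local) = T ∘ r.toLocal := funext fun a => (hT a).symm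
    simp only [G]
    rw [hTq, ← comap_comap]
    refine comap_mono ?_
    rw [← tendsto_iff_comap]
    have := T.continuous.tendsto (∫ x, r.toLocal (F x) ∂μ)
    rw [hTi] at this
    simpa only [Function.comp_apply, hT] using this
  obtain ⟨q₀, -⟩ := exists_submultSeminorm hA (univ_mem : (Set.univ : Set A) ∈ 𝓝 0)
  have : Nonempty (SubmultSeminorm A) := ⟨q₀⟩
  have hne : NeBot (⨅ q, G q) := by
    refine iInf_neBot_of_directed (fun q r => ⟨q.sup r, ?_, ?_⟩) fun q => ?_
    · exact hmono _ _ fun a => le_max_left _ _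
    · exact hmono _ _ fun a => le_max_right _ _
    · refine comap_neBot_iff_frequently.2 (frequently_iff.2 fun {U} hU => ?_)
      obtain ⟨a, ha⟩ := q.denseRange_toLocal.exists_mem_open isOpen_interior
        ⟨_, mem_interior_iff_mem_nhds.2 hU⟩
      exact ⟨_, interior_subset ha, a, rfl⟩
  have hC : Cauchy (⨅ q, G q) := by
    refine ⟨hne, ?_⟩
    rw [uniformity_eq_comap_nhds_zero, ← tendsto_iff_comap]
    intro V hV
    obtain ⟨q, hq⟩ := exists_submultSeminorm hA hV
    have hball : {a : A | ‖q.toLocal a - ∫ x, q.toLocal (F x) ∂μ‖ < 1 / 2} ∈ ⨅ q, G q := by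
      refine mem_iInf_of_mem q ?_
      refine ⟨Metric.ball (∫ x, q.toLocal (F x) ∂μ) (1 / 2), Metric.ball_mem_nhds _ (by norm_num), ?_⟩
      intro a ha
      simpa [dist_eq_norm] using ha
    rw [mem_map]
    refine mem_of_superset (prod_mem_prod hball hball) ?_
    rintro ⟨a, b⟩ ⟨ha, hb⟩
    refine hq ?_
    simp only [Set.mem_ofPred_eq] at ha hb ⊢
    rw [← q.norm_toLocal, map_sub]
    calc _ = ‖(q.toLocal b - ∫ x, q.toLocal (F x) ∂μ) - (q.toLocal a - ∫ x, q.toLocal (F x) ∂μ)‖ := by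
            congr 1; abel
      _ ≤ _ := norm_sub_le _ _
      _ < 1 := by linarith
  obtain ⟨v, hv⟩ := CompleteSpace.complete hC
  refine ⟨v, fun q => ?_⟩
  have h1 : Tendsto q.toLocal (⨅ q, G q) (𝓝 (q.toLocal v)) :=
    (q.continuous_toLocal.tendsto v).mono_left hv
  have h2 : Tendsto q.toLocal (⨅ q, G q) (𝓝 (∫ x, q.toLocal (F x) ∂μ)) :=
    tendsto_comap.mono_left (iInf_le G q)
  exact tendsto_nhds_unique h1 h2

lemma isWeakIntegral_of_toLocal_eq [TopologicalSpace A] [IsTopologicalRing A]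
    (hA : IsMultiplicativelyConvex A) {X : Type*} [MeasurableSpace X] {μ : Measure X} {F : X → A}
    (hF : ∀ q : SubmultSeminorm A, Integrable (fun x => q.toLocal (F x)) μ) {v : A}
    (hv : ∀ q : SubmultSeminorm A, q.toLocal v = ∫ x, q.toLocal (F x) ∂μ) :
    IsWeakIntegral μ F v := by
  intro l
  obtain ⟨q, l', hl⟩ := exists_factor hA l
  simp only [← hl]
  refine ⟨l'.integrable_comp (hF q), ?_⟩
  rw [l'.integral_comp_comm (hF q), hv q]

end WeakIntegral

/-! ### The exponential -/

section Exponential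

variable {A : Type*} [Ring A] [Algebra ℂ A] [UniformSpace A] [IsUniformAddGroup A]
  [IsTopologicalRing A]

lemma hasSum_exp [T2Space A] [CompleteSpace A] (hA : IsMultiplicativelyConvex A) (x : A) :
    HasSum (fun n : ℕ => ((n.factorial : ℂ)⁻¹) • x ^ n) (NormedSpace.exp x) := by
  rw [NormedSpace.exp_eq_tsum ℂ]
  refine Summable.hasSum ?_
  rw [summable_iff_vanishing]
  intro V hV
  obtain ⟨q, hq⟩ := exists_submultSeminorm hA hV
  have hs := NormedSpace.norm_expSeries_summable' (𝕂 := ℂ) (q.toLocal x)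
  obtain ⟨s, hs⟩ := summable_iff_vanishing_norm.1 hs 1 one_pos
  refine ⟨s, fun t ht => hq ?_⟩
  have := hs t ht
  rw [Set.mem_ofPred_eq, ← q.norm_toLocal, map_sum]
  refine (norm_sum_le _ _).trans_lt ?_
  simp only [map_smul, map_pow]
  exact (le_abs_self _).trans_lt this

lemma toLocal_exp [T2Space A] [CompleteSpace A] (hA : IsMultiplicativelyConvex A)
    (q : SubmultSeminorm A) (x : A) :
    q.toLocal (NormedSpace.exp x) = NormedSpace.exp (q.toLocal x) := by
  have h := (hasSum_exp hA x).map q.toLocal q.continuous_toLocal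
  have h2 := NormedSpace.exp_series_hasSum_exp' (𝕂 := ℂ) (q.toLocal x)
  refine h.unique ?_
  convert h2 using 2 with n
  simp

lemma map_exp_of_continuous [T2Space A] [CompleteSpace A] (hA : IsMultiplicativelyConvex A)
    (α : A ≃A[ℂ] A) (x : A) : α (NormedSpace.exp x) = NormedSpace.exp (α x) := by
  have h := (hasSum_exp hA x).map α α.continuous
  refine h.unique ?_
  convert hasSum_exp hA (α x) using 2 with n
  simp

end Exponential

/-! ### Schwartz functions -/

section Cutoff

variable {E : Type*} [NormedAddCommGroup E] [NormedSpace ℝ E] [FiniteDimensional ℝ E]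

/-- A compactly supported cutoff function which is `1` near `K` and `0` outside `V`. -/
lemma exists_schwartz_cutoff {K V : Set E} (hK : IsCompact K) (hV : IsOpen V) (hKV : K ⊆ V) :
    ∃ χ : 𝓢(E, ℂ), HasCompactSupport χ ∧ (∃ W : Set E, IsOpen W ∧ K ⊆ W ∧ ∀ x ∈ W, χ x = 1) ∧
      ∀ x ∉ V, χ x = 0 := by
  obtain ⟨L, hL, hKL, hLV⟩ := exists_compact_between hK hV hKV
  obtain ⟨f, h1, h0, -⟩ := exists_contMDiffMap_one_nhds_of_subset_interior (n := ⊤)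
    (modelWithCornersSelf ℝ E) hK.isClosed hKL
  have hsm : ContDiff ℝ ∞ (fun x => (f x : ℂ)) :=
    Complex.ofRealCLM.contDiff.comp f.contMDiff.contDiff
  have hcs : HasCompactSupport (fun x => (f x : ℂ)) :=
    HasCompactSupport.intro hL fun x hx => by simp [h0 x hx]
  refine ⟨hcs.toSchwartzMap hsm, hcs, ?_, fun x hx => ?_⟩
  · obtain ⟨W, hW, hKW, hW1⟩ := eventually_nhdsSet_iff_exists.1 h1
    exact ⟨W, hW, hKW, fun x hx => by simp [hW1 x hx]⟩
  · have : f x = 0 := h0 x fun h => hx (hLV h)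
    simp [this]

lemma exists_schwartz_eq_on {f : E → ℂ} (hf : ContDiff ℝ ∞ f) {K : Set E} (hK : IsCompact K) :
    ∃ g : 𝓢(E, ℂ), ∀ x ∈ K, g x = f x := by
  obtain ⟨χ, hχ, ⟨W, -, hKW, hW⟩, -⟩ := exists_schwartz_cutoff hK isOpen_univ (Set.subset_univ K)
  exact ⟨(hχ.mul_right (f' := f)).toSchwartzMap ((χ.smooth ⊤).mul hf), fun x hx => by
    simp [hW x (hKW hx)]⟩

lemma integrable_schwartz_mul_pow [MeasurableSpace E] [BorelSpace E] (μ : Measure E)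
    [μ.HasTemperateGrowth] (g : 𝓢(E, ℂ)) (N : ℕ) :
    Integrable (fun x => ‖g x‖ * (1 + ‖x‖) ^ N) μ := by
  have h := ((g.integrable_pow_mul μ 0).add (g.integrable_pow_mul μ N)).const_mul ((2 : ℝ) ^ N)
  refine h.mono' (by fun_prop) (Eventually.of_forall fun x => ?_)
  rw [Real.norm_of_nonneg (by positivity)]
  have : (1 + ‖x‖) ^ N ≤ 2 ^ N * (1 + ‖x‖ ^ N) := by
    rcases le_total ‖x‖ 1 with h | h
    · calc (1 + ‖x‖) ^ N ≤ 2 ^ N := by gcongr; linarith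
        _ ≤ _ := le_mul_of_one_le_right (by positivity) (by simp)
    · calc (1 + ‖x‖) ^ N ≤ (2 * ‖x‖) ^ N := by gcongr; linarith
        _ = 2 ^ N * ‖x‖ ^ N := mul_pow _ _ _
        _ ≤ _ := by gcongr; simp
  calc _ ≤ ‖g x‖ * (2 ^ N * (1 + ‖x‖ ^ N)) := by gcongr
    _ = _ := by simp only [Pi.add_apply, pow_zero]; ring

end Cutoff

lemma fourier_fourier_apply (g : 𝓢(ℝ, ℂ)) (x : ℝ) : (𝓕 (𝓕 g)) x = g (-x) := by
  have h : 𝓕⁻ (𝓕 g) (-x) = g (-x) := by simp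
  rw [← h, SchwartzMap.fourierInv_coe, Real.fourierInv_eq_fourier_neg, neg_neg,
    ← SchwartzMap.fourier_coe]

/-- The Fourier transform of a product is the convolution of the Fourier transforms. -/
lemma fourier_mul_apply (f g h : 𝓢(ℝ, ℂ)) (hh : ∀ x, h x = f x * g x) (u : ℝ) :
    (𝓕 h) u = ∫ s, (𝓕 f) s * (𝓕 g) (u - s) := by
  have key : SchwartzMap.convolution (ContinuousLinearMap.mul ℂ ℂ) (𝓕 f) (𝓕 g) = 𝓕 h := by
    have : 𝓕 (SchwartzMap.convolution (ContinuousLinearMap.mul ℂ ℂ) (𝓕 f) (𝓕 g)) = 𝓕 (𝓕 h) := by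
      ext x
      rw [SchwartzMap.fourier_convolution, fourier_fourier_apply, hh]
      simp [fourier_fourier_apply]
    simpa using congrArg (fun k => 𝓕⁻ k) this
  rw [← key, SchwartzMap.convolution_apply]
  rfl

lemma integral_fourier_mul_exp (g : 𝓢(ℝ, ℂ)) (x : ℝ) :
    ∫ s : ℝ, (𝓕 g) s * Complex.exp (2 * Real.pi * Complex.I * s * x) = g x := by
  have h : 𝓕⁻ (𝓕 g) x = g x := by simp
  rw [← h, SchwartzMap.fourierInv_coe, Real.fourierInv_eq']
  refine integral_congr_ae (Eventually.of_forall fun s => ?_)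
  simp only [smul_eq_mul]
  rw [mul_comm]
  congr 2
  simp
  ring

/-! ### Smooth functional calculus of a tempered element of a Banach algebra -/

section BanachAlgebra

variable {B : Type*} [NormedRing B] [NormedAlgebra ℂ B]

/-- The one-parameter group `s ↦ exp (2 π i s b)`. -/
def expI (b : B) (s : ℝ) : B := NormedSpace.exp ((2 * (Real.pi : ℂ) * Complex.I * (s : ℂ)) • b)

/-- The one-parameter group `s ↦ exp (2 π i s b)` is of polynomial growth, with constant `C` and
exponent `N`. -/
def IsTempered (b : B) (C : ℝ) (N : ℕ) : Prop := ∀ s : ℝ, ‖expI b s‖ ≤ C * (1 + |s|) ^ N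

@[simp] lemma expI_zero (b : B) : expI b 0 = 1 := by simp [expI]

lemma expI_commute {b y : B} (h : Commute y b) (s : ℝ) : Commute y (expI b s) := by
  let +nondep : NormedAlgebra ℚ B := .restrictScalars ℚ ℂ B
  exact (h.smul_right _).exp_right

lemma IsTempered.nonneg {b : B} {C : ℝ} {N : ℕ} (hb : IsTempered b C N) : 0 ≤ C := by
  have := (norm_nonneg _).trans (hb 0)
  simpa using this

variable [CompleteSpace B]

lemma exp_add_smul (b : B) (z w : ℂ) :
    NormedSpace.exp ((z + w) • b) = NormedSpace.exp (z • b) * NormedSpace.exp (w • b) := by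
  let +nondep : NormedAlgebra ℚ B := .restrictScalars ℚ ℂ B
  rw [add_smul, NormedSpace.exp_add_of_commute]
  exact ((Commute.refl b).smul_left z).smul_right w

lemma continuous_normed_exp : Continuous (NormedSpace.exp : B → B) := by
  let +nondep : NormedAlgebra ℚ B := .restrictScalars ℚ ℂ B
  exact NormedSpace.exp_continuous

lemma expI_add (b : B) (s t : ℝ) : expI b (s + t) = expI b s * expI b t := by
  rw [expI, expI, expI, ← exp_add_smul]
  congr 2
  push_cast
  ring

@[fun_prop]
lemma continuous_expI (b : B) : Continuous (expI b) := by
  unfold expI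
  have := continuous_normed_exp (B := B)
  fun_prop

lemma map_normed_exp {B' : Type*} [NormedRing B'] [NormedAlgebra ℂ B'] [CompleteSpace B']
    (f : B →ₐ[ℂ] B') (hf : Continuous f) (x : B) :
    f (NormedSpace.exp x) = NormedSpace.exp (f x) := by
  let +nondep : NormedAlgebra ℚ B := .restrictScalars ℚ ℂ B
  let +nondep : NormedAlgebra ℚ B' := .restrictScalars ℚ ℂ B'
  exact NormedSpace.map_exp f hf x

lemma map_expI {B' : Type*} [NormedRing B'] [NormedAlgebra ℂ B'] [CompleteSpace B']
    (f : B →ₐ[ℂ] B') (hf : Continuous f) (b : B) (s : ℝ) : f (expI b s) = expI (f b) s := by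
  rw [expI, map_normed_exp f hf, map_smul, expI]

/-- The element `g(b) = ∫ ĝ(s) exp (2 π i s b) ds`, for a tempered element `b`. -/
def opCalc (b : B) (g : 𝓢(ℝ, ℂ)) : B := ∫ s, (𝓕 g) s • expI b s

variable {b : B} {C : ℝ} {N : ℕ}

lemma IsTempered.integrable (hb : IsTempered b C N) (g : 𝓢(ℝ, ℂ)) :
    Integrable (fun s => (𝓕 g) s • expI b s) := by
  refine ((integrable_schwartz_mul_pow volume (𝓕 g) N).const_mul C).mono' ?_ ?_
  · exact ((𝓕 g).continuous.smul (continuous_expI b)).aestronglyMeasurable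
  · refine Eventually.of_forall fun s => ?_
    rw [norm_smul]
    calc _ ≤ ‖(𝓕 g) s‖ * (C * (1 + |s|) ^ N) := by gcongr; exact hb s
      _ = _ := by rw [Real.norm_eq_abs]; ring

/-- The spectrum of a tempered element is real, since `|exp (2 π i s z)|` would otherwise grow
exponentially for a spectral value `z`. -/
lemma IsTempered.im_eq_zero (hb : IsTempered b C N) {z : ℂ} (hz : z ∈ spectrum ℂ b) :
    z.im = 0 := by
  have hbound : ∀ s : ℝ, Real.exp (-(2 * Real.pi * s * z.im)) ≤ C * (1 + |s|) ^ N * ‖(1 : B)‖ := by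
    intro s
    rcases eq_or_ne (2 * (Real.pi : ℂ) * Complex.I * (s : ℂ)) 0 with h0 | h0
    · have hs : s = 0 := by simpa [Real.pi_ne_zero] using h0
      subst hs
      have h1 : ‖(1 : B)‖ ≤ C := by simpa using hb 0
      have h2 : (1 : ℝ) ≤ ‖(1 : B)‖ := by
        have : Nontrivial B := by
          by_contra h
          rw [not_nontrivial_iff_subsingleton] at h
          simp [spectrum.of_subsingleton] at hz
        have := norm_mul_le (1 : B) 1
        rw [mul_one] at this
        exact le_of_mul_le_mul_right (by rwa [one_mul]) (norm_pos_iff.2 one_ne_zero)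
      simp only [mul_zero, zero_mul, neg_zero, Real.exp_zero, abs_zero, add_zero, one_pow, mul_one]
      nlinarith
    · have hmem : (2 * (Real.pi : ℂ) * Complex.I * (s : ℂ)) • z ∈
          spectrum ℂ ((2 * (Real.pi : ℂ) * Complex.I * (s : ℂ)) • b) :=
        spectrum.smul_mem_smul_iff (r := Units.mk0 _ h0).2 hz
      have := spectrum.norm_le_norm_mul_of_mem (spectrum.exp_mem_exp _ hmem)
      rw [← Complex.exp_eq_exp_ℂ, Complex.norm_exp] at this
      refine le_trans (le_of_eq ?_) (this.trans ?_)
      · congr 1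
        simp
      · gcongr
        exact hb s
  by_contra hne
  -- for `s` of the appropriate sign the left-hand side of `hbound` is `exp (2 π |Im z| |s|)`
  have hlit := isLittleO_pow_exp_pos_mul_atTop (k := N) (abs_pos.2 hne)
  have hlit2 : ∀ᶠ t : ℝ in atTop, C * ‖(1 : B)‖ * (2 * t) ^ N < Real.exp (|z.im| * t) := by
    have h3 := (hlit.const_mul_left (C * ‖(1 : B)‖ * 2 ^ N)).def (c := 1 / 2) (by norm_num)
    filter_upwards [h3, eventually_ge_atTop 0] with t ht ht0
    rw [Real.norm_of_nonneg (by have := hb.nonneg; positivity), Real.norm_of_nonneg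
      (Real.exp_pos _).le] at ht
    have := Real.exp_pos (|z.im| * t)
    rw [mul_pow]
    linarith
  obtain ⟨t, ht, ht1⟩ := (hlit2.and (eventually_ge_atTop 1)).exists
  obtain ⟨σ, hσ, hσ'⟩ : ∃ σ : ℝ, |σ| = 1 ∧ σ * z.im = -|z.im| := by
    rcases abs_choice z.im with h | h
    · exact ⟨-1, by simp, by rw [h]; ring⟩
    · exact ⟨1, by simp, by rw [h]; ring⟩
  have h4 := hbound (σ * t)
  rw [abs_mul, hσ, one_mul, abs_of_nonneg (by linarith)] at h4
  have h5 : Real.exp (|z.im| * t) ≤ Real.exp (-(2 * Real.pi * (σ * t) * z.im)) := by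
    gcongr
    have : -(2 * Real.pi * (σ * t) * z.im) = 2 * Real.pi * (|z.im| * t) := by
      linear_combination (-2 * Real.pi * t) * hσ'
    rw [this]
    have := Real.pi_gt_three
    have : 0 ≤ |z.im| * t := by positivity
    nlinarith
  have h6 : C * (1 + t) ^ N * ‖(1 : B)‖ ≤ C * ‖(1 : B)‖ * (2 * t) ^ N := by
    have := hb.nonneg
    rw [mul_right_comm]
    gcongr
    linarith
  linarith

/-- The smooth functional calculus is multiplicative. -/
lemma IsTempered.opCalc_mul (hb : IsTempered b C N) {f g h : 𝓢(ℝ, ℂ)}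
    (hh : ∀ x, h x = f x * g x) : opCalc b h = opCalc b f * opCalc b g := by
  have hint : Integrable (fun p : ℝ × ℝ =>
      (((𝓕 f) p.2 * (𝓕 g) (p.1 - p.2)) • expI b p.1)) (volume.prod volume) := by
    have hf := integrable_schwartz_mul_pow volume (𝓕 f) N
    have hg := integrable_schwartz_mul_pow volume (𝓕 g) N
    have hconv := (hf.convolution_integrand (ContinuousLinearMap.mul ℝ ℝ) hg).const_mul C
    refine hconv.mono' ?_ (Eventually.of_forall fun p => ?_)
    · have := (𝓕 f).continuous
      have := (𝓕 g).continuous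
      exact Continuous.aestronglyMeasurable (by fun_prop)
    · rw [norm_smul, norm_mul]
      simp only [ContinuousLinearMap.mul_apply', Real.norm_eq_abs]
      have h1 : ‖expI b p.1‖ ≤ C * ((1 + |p.2|) ^ N * (1 + |p.1 - p.2|) ^ N) := by
        refine (hb p.1).trans ?_
        have := hb.nonneg
        rw [← mul_pow]
        gcongr
        have : |p.1| ≤ |p.2| + |p.1 - p.2| := by
          calc |p.1| = |p.2 + (p.1 - p.2)| := by congr 1; ring
            _ ≤ _ := abs_add_le _ _
        nlinarith [abs_nonneg p.2, abs_nonneg (p.1 - p.2)]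
      calc _ ≤ ‖(𝓕 f) p.2‖ * ‖(𝓕 g) (p.1 - p.2)‖ *
            (C * ((1 + |p.2|) ^ N * (1 + |p.1 - p.2|) ^ N)) := by gcongr
        _ = _ := by ring
  calc opCalc b h = ∫ u, ∫ s, ((𝓕 f) s * (𝓕 g) (u - s)) • expI b u := by
        refine integral_congr_ae (Eventually.of_forall fun u => ?_)
        simp only
        rw [fourier_mul_apply f g h hh, integral_smul_const]
    _ = ∫ s, ∫ u, ((𝓕 f) s * (𝓕 g) (u - s)) • expI b u := integral_integral_swap hint
    _ = ∫ s, ((𝓕 f) s • expI b s) * opCalc b g := by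
        refine integral_congr_ae (Eventually.of_forall fun s => ?_)
        simp only
        rw [opCalc, ← integral_const_mul_of_integrable (hb.integrable g),
          ← integral_add_right_eq_self _ s]
        refine integral_congr_ae (Eventually.of_forall fun u => ?_)
        simp only [add_sub_cancel_right]
        rw [add_comm u s, expI_add, smul_mul_smul_comm]
    _ = _ := by
        rw [integral_mul_const_of_integrable (hb.integrable f), ← opCalc]

end BanachAlgebra

/-! ### Dependence of the calculus on values near the spectrum -/

section Gelfand

variable {B : Type*} [NormedRing B] [NormedAlgebra ℂ B]

/-- The double commutant of an element. -/
def doubleCommutant (b : B) : Subalgebra ℂ B :=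
  Subalgebra.centralizer ℂ (Subalgebra.centralizer ℂ {b} : Set B)

lemma mem_doubleCommutant {b x : B} : x ∈ doubleCommutant b ↔ ∀ y, Commute y b → Commute y x := by
  simp only [doubleCommutant, Subalgebra.mem_centralizer_iff, Set.mem_singleton_iff, forall_eq,
    SetLike.mem_coe, Commute, SemiconjBy]
  exact forall_congr' fun y => imp_congr_left eq_comm

lemma self_mem_doubleCommutant (b : B) : b ∈ doubleCommutant b :=
  mem_doubleCommutant.2 fun _ h => h

lemma isClosed_doubleCommutant (b : B) : IsClosed (doubleCommutant b : Set B) := by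
  have : (doubleCommutant b : Set B) = ⋂ y : B, ⋂ _ : Commute y b, {x | y * x = x * y} := by
    ext x
    simp [mem_doubleCommutant, Commute, SemiconjBy]
  rw [this]
  exact isClosed_iInter fun y => isClosed_iInter fun _ =>
    isClosed_eq (by fun_prop) (by fun_prop)

/-- Passing to the double commutant does not enlarge the spectrum, since the double commutant is
closed under inverses. -/
lemma spectrum_doubleCommutant (b : B) (x : doubleCommutant b) :
    spectrum ℂ x ⊆ spectrum ℂ (x : B) := by
  intro z hz hu
  refine hz ?_
  obtain ⟨u, hu⟩ := hu
  have hmem : (↑u : B) ∈ doubleCommutant b := by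
    rw [hu]
    exact (algebraMap ℂ (doubleCommutant b) z - x).2
  have hinv : (↑u⁻¹ : B) ∈ doubleCommutant b :=
    mem_doubleCommutant.2 fun y hy => (mem_doubleCommutant.1 hmem y hy).units_inv_right
  refine ⟨⟨algebraMap ℂ _ z - x, ⟨_, hinv⟩, ?_, ?_⟩, rfl⟩
  · exact Subtype.ext (by
      change ((algebraMap ℂ (doubleCommutant b) z - x : doubleCommutant b) : B) * ↑u⁻¹ = 1
      change ↑u = ((algebraMap ℂ (doubleCommutant b) z - x : doubleCommutant b) : B) at hu
      rw [← hu, u.mul_inv])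
  · exact Subtype.ext (by
      change ↑u⁻¹ * ((algebraMap ℂ (doubleCommutant b) z - x : doubleCommutant b) : B) = 1
      change ↑u = ((algebraMap ℂ (doubleCommutant b) z - x : doubleCommutant b) : B) at hu
      rw [← hu, u.inv_mul])

variable [CompleteSpace B] {b : B} {C : ℝ} {N : ℕ}

instance (b : B) : NormedCommRing (doubleCommutant b) :=
  { (inferInstance : NormedRing (doubleCommutant b)) with
    mul_comm := fun x y => Subtype.ext <|
      (mem_doubleCommutant.1 y.2 x (mem_doubleCommutant.1 x.2 b (Commute.refl b)).symm) }

instance (b : B) : CompleteSpace (doubleCommutant b) :=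
  (isClosed_doubleCommutant b).completeSpace_coe

/-- If `g` does not vanish on the spectrum of `b` then `g(b)` is invertible: a character `ψ` of the
double commutant of `b` takes the value `g (ψ b)` at `g(b)`. -/
lemma IsTempered.isUnit_opCalc (hb : IsTempered b C N) {g : 𝓢(ℝ, ℂ)}
    (hg : ∀ x : ℝ, (x : ℂ) ∈ spectrum ℂ b → g x ≠ 0) : IsUnit (opCalc b g) := by
  -- the calculus of `b` takes place in the commutative Banach algebra `doubleCommutant b`
  let b' : doubleCommutant b := ⟨b, self_mem_doubleCommutant b⟩
  have hcoe : ∀ s, ((expI b' s : doubleCommutant b) : B) = expI b s := fun s =>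
    map_expI (doubleCommutant b).val continuous_subtype_val b' s
  have hb' : IsTempered b' C N := fun s => by
    have := hb s
    rwa [← hcoe] at this
  have hx : ((opCalc b' g : doubleCommutant b) : B) = opCalc b g := by
    let L : doubleCommutant b →L[ℂ] B :=
      ⟨(doubleCommutant b).val.toLinearMap, continuous_subtype_val⟩
    have h := L.integral_comp_comm (hb'.integrable g)
    refine h.symm.trans (integral_congr_ae (Eventually.of_forall fun s => ?_))
    change (𝓕 g) s • ((expI b' s : doubleCommutant b) : B) = (𝓕 g) s • expI b s
    rw [hcoe s]
  suffices h : IsUnit (opCalc b' g) by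
    rw [← hx]
    exact h.map (doubleCommutant b).val
  by_contra hne
  obtain ⟨ψ, hψ⟩ := WeakDual.CharacterSpace.exists_apply_eq_zero hne
  have hspec : ψ b' ∈ spectrum ℂ b :=
    spectrum_doubleCommutant b b' (AlgHom.apply_mem_spectrum ψ b')
  obtain ⟨x, hx⟩ : ∃ x : ℝ, (x : ℂ) = ψ b' :=
    ⟨(ψ b').re, Complex.ext (by simp) (by simp [hb.im_eq_zero hspec])⟩
  refine hg x (hx ▸ hspec) ?_
  rw [← integral_fourier_mul_exp g x, ← hψ]
  have h := (WeakDual.CharacterSpace.toCLM ψ).integral_comp_comm (hb'.integrable g)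
  refine Eq.trans (integral_congr_ae (Eventually.of_forall fun s => ?_)) h
  simp only [map_smul, smul_eq_mul, WeakDual.CharacterSpace.coe_toCLM]
  congr 1
  have h2 := map_normed_exp (WeakDual.CharacterSpace.toAlgHom ψ) (map_continuous ψ)
    ((2 * (Real.pi : ℂ) * Complex.I * (s : ℂ)) • b')
  rw [map_smul] at h2
  rw [Complex.exp_eq_exp_ℂ]
  refine Eq.trans ?_ h2.symm
  congr 1
  change _ = _ * ψ b'
  rw [hx]

/-- The set of the real points of the spectrum. For a tempered element this is the whole
spectrum. -/
def realSpectrum (b : B) : Set ℝ := {x : ℝ | (x : ℂ) ∈ spectrum ℂ b}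

lemma isCompact_realSpectrum (b : B) : IsCompact (realSpectrum b) :=
  Complex.isometry_ofReal.isClosedEmbedding.isCompact_preimage (spectrum.isCompact b)

/-- A cutoff function which is `1` near the spectrum acts as the identity. -/
lemma IsTempered.opCalc_eq_one (hb : IsTempered b C N) {χ : 𝓢(ℝ, ℂ)} {V : Set ℝ} (hV : IsOpen V)
    (hbV : realSpectrum b ⊆ V) (hχ : ∀ x ∈ V, χ x = 1) : opCalc b χ = 1 := by
  obtain ⟨χ₁, -, ⟨W, -, hKW, hW⟩, h0⟩ :=
    exists_schwartz_cutoff (isCompact_realSpectrum b) hV hbV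
  -- `χ χ₁ = χ₁`, and `χ₁(b)` is invertible
  have hu : IsUnit (opCalc b χ₁) :=
    hb.isUnit_opCalc fun x hx => by rw [hW x (hKW hx)]; exact one_ne_zero
  have hmul : opCalc b χ₁ = opCalc b χ * opCalc b χ₁ := by
    refine hb.opCalc_mul fun x => ?_
    by_cases hx : x ∈ V
    · rw [hχ x hx, one_mul]
    · rw [h0 x hx, mul_zero]
  exact hu.mul_right_cancel (by rw [← hmul, one_mul])

/-- The calculus is multiplicative for functions which satisfy `f g = k` only near the spectrum: insert
a cutoff function `χ` with `χ(b) = 1`. -/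
lemma IsTempered.opCalc_mul_eq (hb : IsTempered b C N) {f g k : 𝓢(ℝ, ℂ)} {V : Set ℝ}
    (hV : IsOpen V) (hbV : realSpectrum b ⊆ V) (h : ∀ x ∈ V, f x * g x = k x) :
    opCalc b f * opCalc b g = opCalc b k := by
  obtain ⟨χ, hχ, ⟨W, hW, hKW, hW1⟩, h0⟩ :=
    exists_schwartz_cutoff (isCompact_realSpectrum b) hV hbV
  have h1 : opCalc b χ = 1 := hb.opCalc_eq_one hW hKW hW1
  let χf : 𝓢(ℝ, ℂ) := (hχ.mul_right (f' := f)).toSchwartzMap ((χ.smooth ⊤).mul (f.smooth ⊤))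
  let m : 𝓢(ℝ, ℂ) := (hχ.mul_right (f' := k)).toSchwartzMap ((χ.smooth ⊤).mul (k.smooth ⊤))
  have e1 : opCalc b χf = opCalc b f := by
    rw [hb.opCalc_mul (f := χ) (g := f) (fun x => rfl), h1, one_mul]
  have e2 : opCalc b m = opCalc b k := by
    rw [hb.opCalc_mul (f := χ) (g := k) (fun x => rfl), h1, one_mul]
  rw [← e1, ← e2]
  refine (hb.opCalc_mul fun x => ?_).symm
  change χ x * k x = χ x * f x * g x
  by_cases hx : x ∈ V
  · rw [← h x hx, mul_assoc]
  · rw [h0 x hx]; ring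

end Gelfand

/-! ### The exponential in the smooth functional calculus -/

section Gaussian

lemma exists_pow_mul_eval_mul_gaussian_le (P : Polynomial ℝ) (k : ℕ) :
    ∃ D : ℝ, ∀ x : ℝ, |x| ^ k * |P.eval x| * Real.exp (-(x ^ 2 / 2)) ≤ D := by
  induction P using Polynomial.induction_on' with
  | add p q hp hq =>
    obtain ⟨D, hD⟩ := hp
    obtain ⟨D', hD'⟩ := hq
    refine ⟨D + D', fun x => ?_⟩
    calc _ ≤ |x| ^ k * (|p.eval x| + |q.eval x|) * Real.exp (-(x ^ 2 / 2)) := by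
          rw [Polynomial.eval_add]
          gcongr
          exact abs_add_le _ _
      _ = |x| ^ k * |p.eval x| * Real.exp (-(x ^ 2 / 2)) +
          |x| ^ k * |q.eval x| * Real.exp (-(x ^ 2 / 2)) := by ring
      _ ≤ _ := add_le_add (hD x) (hD' x)
  | monomial n a =>
    refine ⟨|a| * (k + n).factorial * Real.exp (1 / 2), fun x => ?_⟩
    have h1 : |x| ^ (k + n) ≤ (k + n).factorial * Real.exp |x| := by
      have := Real.pow_div_factorial_le_exp |x| (abs_nonneg x) (k + n)
      rwa [div_le_iff₀' (by positivity)] at this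
    have h2 : Real.exp |x| * Real.exp (-(x ^ 2 / 2)) ≤ Real.exp (1 / 2) := by
      rw [← Real.exp_add]
      gcongr
      nlinarith [sq_nonneg (|x| - 1), sq_abs x]
    calc _ = |a| * |x| ^ (k + n) * Real.exp (-(x ^ 2 / 2)) := by
          rw [Polynomial.eval_monomial, abs_mul, abs_pow, pow_add]
          ring
      _ ≤ |a| * ((k + n).factorial * Real.exp |x|) * Real.exp (-(x ^ 2 / 2)) := by gcongr
      _ = |a| * (k + n).factorial * (Real.exp |x| * Real.exp (-(x ^ 2 / 2))) := by ring
      _ ≤ _ := by gcongr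

/-- The Gaussian `exp (-x²/2)` as a Schwartz function. -/
def gaussianSchwartz : 𝓢(ℝ, ℝ) where
  toFun x := Real.exp (-(x ^ 2 / 2))
  smooth' := by fun_prop
  decay' k n := by
    obtain ⟨D, hD⟩ := exists_pow_mul_eval_mul_gaussian_le
      ((Polynomial.hermite n).map (Int.castRingHom ℝ)) k
    refine ⟨D, fun x => ?_⟩
    rw [norm_iteratedFDeriv_eq_norm_iteratedDeriv, iteratedDeriv_eq_iterate,
      Polynomial.deriv_gaussian_eq_hermite_mul_gaussian]
    refine le_trans (le_of_eq ?_) (hD x)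
    rw [Real.norm_eq_abs, Real.norm_eq_abs, abs_mul, abs_mul, abs_pow, abs_neg, abs_one, one_pow,
      one_mul, abs_of_pos (Real.exp_pos _), Polynomial.eval_map, Polynomial.aeval_def, mul_assoc]
    rfl

lemma exists_schwartz_gaussian (j : ℝ) :
    ∃ γ : 𝓢(ℝ, ℂ), ∀ x : ℝ, γ x = Complex.exp (-((x : ℂ) ^ 2 / 2) + j * x) := by
  refine ⟨(Real.exp (j ^ 2 / 2)) •
    ((gaussianSchwartz.compSubConstCLM ℝ j).postcompCLM Complex.ofRealCLM), fun x => ?_⟩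
  have : -((x : ℂ) ^ 2 / 2) + j * x = ((j ^ 2 / 2 + -((x - j) ^ 2 / 2) : ℝ) : ℂ) := by
    push_cast
    ring
  have hg : ∀ y, gaussianSchwartz y = Real.exp (-(y ^ 2 / 2)) := fun _ => rfl
  rw [this, ← Complex.ofReal_exp, Real.exp_add]
  simp [hg]

/-- The Fourier transform of a modulated Gaussian. -/
lemma fourier_gaussian_modulated {γ : 𝓢(ℝ, ℂ)} {j : ℝ}
    (hγ : ∀ x : ℝ, γ x = Complex.exp (-((x : ℂ) ^ 2 / 2) + j * x)) (s : ℝ) :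
    (𝓕 γ) s = 1 / (1 / (2 * Real.pi) : ℂ) ^ (1 / 2 : ℂ) * (Complex.exp (j ^ 2 / 2) *
      Complex.exp (-2 * Real.pi ^ 2 * s ^ 2 - 2 * Real.pi * Complex.I * j * s)) := by
  have hpi : (Real.pi : ℂ) ≠ 0 := by simp [Real.pi_ne_zero]
  have hb : 0 < (1 / (2 * Real.pi) : ℂ).re := by
    have : (1 / (2 * Real.pi) : ℂ) = ((1 / (2 * Real.pi) : ℝ) : ℂ) := by push_cast; rfl
    rw [this, Complex.ofReal_re]
    have := Real.pi_pos
    positivity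
  have h := fourier_gaussian_pi' hb (j / (2 * Real.pi))
  have hfun : (γ : ℝ → ℂ) = fun x : ℝ => Complex.exp (-Real.pi * (1 / (2 * Real.pi)) * x ^ 2 +
      2 * Real.pi * (j / (2 * Real.pi)) * x) := by
    funext x
    rw [hγ]
    congr 1
    field_simp
  rw [SchwartzMap.fourier_coe, hfun, h]
  simp only
  rw [← Complex.exp_add]
  congr 2
  field_simp
  ring_nf
  simp only [Complex.I_sq]
  ring

variable {B : Type*} [NormedRing B] [NormedAlgebra ℂ B] [CompleteSpace B]
  {b : B} {C : ℝ} {N : ℕ}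

lemma hasDerivAt_exp_smul (b : B) (z : ℂ) :
    HasDerivAt (fun w : ℂ => NormedSpace.exp (w • b)) (b * NormedSpace.exp (z • b)) z := by
  exact hasDerivAt_exp_smul_const' b z

lemma hasDerivAt_expI (b : B) (s : ℝ) :
    HasDerivAt (expI b) ((2 * (Real.pi : ℂ) * Complex.I) • (b * expI b s)) s := by
  have h1 : HasDerivAt (fun s : ℝ => 2 * (Real.pi : ℂ) * Complex.I * (s : ℂ))
      (2 * (Real.pi : ℂ) * Complex.I) s := by
    simpa using (Complex.ofRealCLM.hasDerivAt (x := s)).const_mul (2 * (Real.pi : ℂ) * Complex.I)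
  exact (hasDerivAt_exp_smul b _).scomp s h1

/-- Multiplying the symbol of a Gaussian by `exp (j x)` amounts to multiplying its value at `b` by
`exp (j b)`: both sides solve the differential equation `w' = b w` in `j`. -/
lemma IsTempered.opCalc_gaussian (hb : IsTempered b C N) {γ₀ γ : 𝓢(ℝ, ℂ)} {j : ℝ}
    (hγ₀ : ∀ x : ℝ, γ₀ x = Complex.exp (-((x : ℂ) ^ 2 / 2)))
    (hγ : ∀ x : ℝ, γ x = Complex.exp (-((x : ℂ) ^ 2 / 2) + j * x)) :
    opCalc b γ = NormedSpace.exp ((j : ℂ) • b) * opCalc b γ₀ := by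
  set G : 𝓢(ℝ, ℂ) := 𝓕 γ₀ with hG
  have hγ₀' : ∀ x : ℝ, γ₀ x = Complex.exp (-((x : ℂ) ^ 2 / 2) + (0 : ℝ) * x) := fun x => by
    rw [hγ₀]; simp
  have hGs : ∀ s : ℝ, G s = 1 / (1 / (2 * Real.pi) : ℂ) ^ (1 / 2 : ℂ) *
      Complex.exp (-2 * Real.pi ^ 2 * s ^ 2) := fun s => by
    rw [hG, fourier_gaussian_modulated hγ₀']; simp
  have hGd : ∀ s : ℝ, HasDerivAt (fun s : ℝ => G s) (-4 * Real.pi ^ 2 * s * G s) s := by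
    intro s
    have h1 : HasDerivAt (fun w : ℂ => 1 / (1 / (2 * Real.pi) : ℂ) ^ (1 / 2 : ℂ) *
      Complex.exp (-2 * Real.pi ^ 2 * w ^ 2)) (1 / (1 / (2 * Real.pi) : ℂ) ^ (1 / 2 : ℂ) *
      (Complex.exp (-2 * Real.pi ^ 2 * s ^ 2) * (-2 * Real.pi ^ 2 * (2 * s)))) (s : ℂ) := by
      have := ((((hasDerivAt_id (s : ℂ)).pow 2).const_mul (-2 * (Real.pi : ℂ) ^ 2)).cexp).const_mul
        (1 / (1 / (2 * Real.pi) : ℂ) ^ (1 / 2 : ℂ))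
      simpa using this
    have h2 := h1.comp_ofReal
    have h3 : (fun s : ℝ => G s) = fun s : ℝ => 1 / (1 / (2 * Real.pi) : ℂ) ^ (1 / 2 : ℂ) *
      Complex.exp (-2 * Real.pi ^ 2 * s ^ 2) := funext hGs
    rw [h3]
    convert h2 using 1
    rw [hGs]
    ring
  have hed : ∀ (j s : ℝ), HasDerivAt (fun s : ℝ => Complex.exp (-2 * Real.pi * Complex.I * j * s))
      (Complex.exp (-2 * Real.pi * Complex.I * j * s) * (-2 * Real.pi * Complex.I * j)) s := by
    intro j s
    have := (((hasDerivAt_id (s : ℂ)).const_mul (-2 * (Real.pi : ℂ) * Complex.I * j)).cexp).comp_ofReal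
    simpa using this
  have hejd : ∀ (s j : ℝ), HasDerivAt (fun j : ℝ => Complex.exp (-2 * Real.pi * Complex.I * j * s))
      (Complex.exp (-2 * Real.pi * Complex.I * j * s) * (-2 * Real.pi * Complex.I * s)) j := by
    intro s j
    have := ((((hasDerivAt_id (j : ℂ)).const_mul (-2 * (Real.pi : ℂ) * Complex.I)).mul_const
      (s : ℂ)).cexp).comp_ofReal
    simpa using this
  have hen : ∀ j s : ℝ, ‖Complex.exp (-2 * Real.pi * Complex.I * j * s)‖ = 1 := by
    intro j s
    rw [Complex.norm_exp]
    simp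
  have hC := hb.nonneg
  have hGc := G.continuous
  have hbd1 : ∀ (c : ℂ) (s : ℝ), ‖c‖ = 1 → ‖(c * G s) • expI b s‖ ≤ C * (‖G s‖ * (1 + ‖s‖) ^ N) := by
    intro c s hc
    rw [norm_smul, norm_mul, hc, one_mul, Real.norm_eq_abs]
    calc _ ≤ ‖G s‖ * (C * (1 + |s|) ^ N) := by gcongr; exact hb s
      _ = _ := by ring
  have hbd2 : ∀ (c : ℂ) (s : ℝ), ‖c‖ = 1 →
      ‖(c * s * G s) • expI b s‖ ≤ C * (‖G s‖ * (1 + ‖s‖) ^ (N + 1)) := by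
    intro c s hc
    rw [norm_smul, norm_mul, norm_mul, hc, one_mul, Complex.norm_real, Real.norm_eq_abs]
    calc _ ≤ ((1 + |s|) * ‖G s‖) * (C * (1 + |s|) ^ N) := by
          gcongr
          · linarith [abs_nonneg s]
          · exact hb s
      _ = _ := by ring
  have hi1 : ∀ j : ℝ, Integrable (fun s : ℝ =>
      (Complex.exp (-2 * Real.pi * Complex.I * j * s) * G s) • expI b s) := fun j =>
    ((integrable_schwartz_mul_pow volume G N).const_mul C).mono'
      (Continuous.aestronglyMeasurable (by fun_prop))
      (Eventually.of_forall fun s => hbd1 _ s (hen j s))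
  have hi2 : ∀ j : ℝ, Integrable (fun s : ℝ =>
      (Complex.exp (-2 * Real.pi * Complex.I * j * s) * s * G s) • expI b s) := fun j =>
    ((integrable_schwartz_mul_pow volume G (N + 1)).const_mul C).mono'
      (Continuous.aestronglyMeasurable (by fun_prop))
      (Eventually.of_forall fun s => hbd2 _ s (hen j s))
  -- `u j` is the value at `b` of the Gaussian modulated by `exp (j ·)`, up to the factor
  -- `exp (j² / 2)`, and `m j` is, up to a constant, its derivative in `j`
  let u : ℝ → B := fun j => ∫ s : ℝ,
    (Complex.exp (-2 * Real.pi * Complex.I * j * s) * G s) • expI b s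
  let m : ℝ → B := fun j => ∫ s : ℝ,
    (Complex.exp (-2 * Real.pi * Complex.I * j * s) * s * G s) • expI b s
  have hu : ∀ j : ℝ, HasDerivAt u ((-2 * (Real.pi : ℂ) * Complex.I) • m j) j := by
    intro j
    have h := hasDerivAt_integral_of_dominated_loc_of_deriv_le (μ := volume) (x₀ := j)
      (s := Set.univ) (F := fun (j : ℝ) (s : ℝ) =>
        (Complex.exp (-2 * Real.pi * Complex.I * j * s) * G s) • expI b s)
      (F' := fun (j : ℝ) (s : ℝ) => (-2 * (Real.pi : ℂ) * Complex.I) •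
        ((Complex.exp (-2 * Real.pi * Complex.I * j * s) * s * G s) • expI b s))
      (bound := fun s => ‖-2 * (Real.pi : ℂ) * Complex.I‖ * (C * (‖G s‖ * (1 + ‖s‖) ^ (N + 1))))
      univ_mem (Eventually.of_forall fun j => (hi1 j).aestronglyMeasurable) (hi1 j)
      ((hi2 j).smul (-2 * (Real.pi : ℂ) * Complex.I)).aestronglyMeasurable
      (Eventually.of_forall fun s j _ => by
        rw [norm_smul]
        gcongr
        exact hbd2 _ s (hen j s))
      (((integrable_schwartz_mul_pow volume G (N + 1)).const_mul C).const_mul _)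
      (Eventually.of_forall fun s j _ => by
        have := ((hejd s j).mul_const (G s)).smul_const (expI b s)
        convert this using 1
        rw [smul_smul]
        congr 1
        ring)
    have h2 := h.2
    rwa [integral_smul] at h2
  -- integrate the derivative in `s` of the integrand of `u j` over the line
  have hibp : ∀ j : ℝ, b * u j = (j : ℂ) • u j + (-2 * (Real.pi : ℂ) * Complex.I) • m j := by
    intro j
    have hd : ∀ s : ℝ, HasDerivAt (fun s : ℝ =>
        (Complex.exp (-2 * Real.pi * Complex.I * j * s) * G s) • expI b s)
        ((2 * (Real.pi : ℂ) * Complex.I) •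
          (b * ((Complex.exp (-2 * Real.pi * Complex.I * j * s) * G s) • expI b s)) -
        (2 * (Real.pi : ℂ) * Complex.I * j) •
          ((Complex.exp (-2 * Real.pi * Complex.I * j * s) * G s) • expI b s) -
        (4 * (Real.pi : ℂ) ^ 2) •
          ((Complex.exp (-2 * Real.pi * Complex.I * j * s) * s * G s) • expI b s)) s := by
      intro s
      have := ((hed j s).fun_mul (hGd s)).fun_smul (hasDerivAt_expI b s)
      refine this.congr_deriv ?_
      simp only [mul_smul_comm, smul_smul]
      rw [sub_sub, ← add_smul, sub_eq_add_neg, ← neg_smul]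
      congr 1
      · congr 1
        ring
      · congr 1
        ring
    have hI1 := ((hi1 j).const_mul b).fun_smul (2 * (Real.pi : ℂ) * Complex.I)
    have hI2 := (hi1 j).fun_smul (2 * (Real.pi : ℂ) * Complex.I * j)
    have hI3 := (hi2 j).fun_smul (4 * (Real.pi : ℂ) ^ 2)
    have h0 := integral_eq_zero_of_hasDerivAt_of_integrable hd
      ((hI1.sub hI2).sub hI3) (hi1 j)
    rw [integral_sub (by exact hI1.sub hI2) hI3, integral_sub hI1 hI2, integral_smul, integral_smul,
      integral_smul, integral_const_mul_of_integrable (hi1 j)] at h0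
    change (2 * (Real.pi : ℂ) * Complex.I) • (b * u j) - (2 * (Real.pi : ℂ) * Complex.I * j) • u j -
      (4 * (Real.pi : ℂ) ^ 2) • m j = 0 at h0
    have hne : (2 * (Real.pi : ℂ) * Complex.I) ≠ 0 := by simp [Real.pi_ne_zero]
    have h1 : (2 * (Real.pi : ℂ) * Complex.I) • (b * u j) = (2 * (Real.pi : ℂ) * Complex.I) •
        ((j : ℂ) • u j + (-2 * (Real.pi : ℂ) * Complex.I) • m j) := by
      rw [sub_sub, sub_eq_zero] at h0
      rw [h0, smul_add, smul_smul, smul_smul]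
      congr 2
      linear_combination 4 * (Real.pi : ℂ) ^ 2 * Complex.I_sq
    exact smul_right_injective B hne h1
  -- the two preceding facts say that `w` is constant
  let w : ℝ → B := fun j => NormedSpace.exp ((-(j : ℂ)) • b) *
    (Complex.exp ((j : ℂ) ^ 2 / 2) • u j)
  have hw : ∀ j : ℝ, HasDerivAt w 0 j := by
    intro j
    have e1 : HasDerivAt (fun j : ℝ => NormedSpace.exp ((-(j : ℂ)) • b))
        ((-1 : ℂ) • (b * NormedSpace.exp ((-(j : ℂ)) • b))) j := by
      have h1 : HasDerivAt (fun s : ℝ => -(s : ℂ)) (-1) j := by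
        simpa using (Complex.ofRealCLM.hasDerivAt (x := j)).fun_neg
      exact (hasDerivAt_exp_smul b _).scomp j h1
    have e2 : HasDerivAt (fun j : ℝ => Complex.exp ((j : ℂ) ^ 2 / 2))
        (Complex.exp ((j : ℂ) ^ 2 / 2) * j) j := by
      have := ((((hasDerivAt_id (j : ℂ)).pow 2).div_const 2).cexp).comp_ofReal
      simpa using this
    have := e1.fun_mul (e2.fun_smul (hu j))
    convert this using 1
    have hcomm : b * NormedSpace.exp ((-(j : ℂ)) • b) = NormedSpace.exp ((-(j : ℂ)) • b) * b := by
      let +nondep : NormedAlgebra ℚ B := .restrictScalars ℚ ℂ B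
      exact ((Commute.refl b).smul_right _).exp_right
    rw [hcomm, smul_mul_assoc, mul_assoc, mul_smul_comm _ b, hibp j, ← mul_smul_comm, ← mul_add]
    have : (-1 : ℂ) • Complex.exp ((j : ℂ) ^ 2 / 2) • ((j : ℂ) • u j +
        (-2 * (Real.pi : ℂ) * Complex.I) • m j) +
        (Complex.exp ((j : ℂ) ^ 2 / 2) • (-2 * (Real.pi : ℂ) * Complex.I) • m j +
        (Complex.exp ((j : ℂ) ^ 2 / 2) * j) • u j) = 0 := by
      module
    rw [this, mul_zero]
  have hconst : w j = w 0 := is_const_of_deriv_eq_zero (fun j => (hw j).differentiableAt)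
    (fun j => (hw j).deriv) j 0
  have hw0 : w 0 = opCalc b γ₀ := by
    simp only [w, u, opCalc]
    simp [hG]
  have hwj : opCalc b γ = Complex.exp ((j : ℂ) ^ 2 / 2) • u j := by
    simp only [u, opCalc]
    rw [← integral_smul]
    refine integral_congr_ae (Eventually.of_forall fun s => ?_)
    simp only
    rw [fourier_gaussian_modulated hγ, hGs, smul_smul, sub_eq_add_neg, Complex.exp_add]
    congr 1
    have : -(2 * Real.pi * Complex.I * j * s) = (-2 * Real.pi * Complex.I * j * s : ℂ) := by ring
    rw [this]
    ring
  rw [hwj, ← hw0, ← hconst]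
  simp only [w]
  rw [← mul_assoc, ← exp_add_smul]
  simp

/-- If `k` agrees with `exp (j ·)` near the spectrum then `k(b) = exp (j b)`. This holds for `k` times a
Gaussian `γ₀`, and `γ₀(b)` is invertible. -/
lemma IsTempered.opCalc_eq_exp (hb : IsTempered b C N) {k : 𝓢(ℝ, ℂ)} {j : ℝ} {V : Set ℝ}
    (hV : IsOpen V) (hbV : realSpectrum b ⊆ V) (hk : ∀ x ∈ V, k x = Complex.exp (j * x)) :
    opCalc b k = NormedSpace.exp ((j : ℂ) • b) := by
  obtain ⟨γ₀, hγ₀⟩ := exists_schwartz_gaussian 0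
  obtain ⟨γ, hγ⟩ := exists_schwartz_gaussian j
  have hγ₀' : ∀ x : ℝ, γ₀ x = Complex.exp (-((x : ℂ) ^ 2 / 2)) := fun x => by
    rw [hγ₀]; simp
  have hu : IsUnit (opCalc b γ₀) := hb.isUnit_opCalc fun x _ => by
    rw [hγ₀]; exact Complex.exp_ne_zero _
  refine hu.mul_right_cancel ?_
  rw [← hb.opCalc_gaussian hγ₀' hγ]
  refine hb.opCalc_mul_eq hV hbV fun x hx => ?_
  rw [hk x hx, hγ₀', hγ, ← Complex.exp_add, add_comm]

end Gaussian

/-! ### Superpositions of products of exponentials and their symbols -/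

section MultipleOperatorIntegral

/-- The translates of a Schwartz function decay, at the cost of a power of the translation, by
`1 + |s| ≤ (1 + |y|) (1 + |s - y|)`. -/
lemma exists_decay_translate (g : 𝓢(ℝ, ℂ)) (N : ℕ) : ∃ D : ℝ, 0 ≤ D ∧ ∀ s y : ℝ,
    ‖g (s - y)‖ * (1 + |s|) ^ N ≤ D * (1 + |y|) ^ (N + 2) * (1 + ‖s‖) ^ (-(2 : ℝ)) := by
  obtain ⟨D, hD⟩ : ∃ D : ℝ, ∀ x : ℝ, (1 + |x|) ^ (N + 2) * ‖g x‖ ≤ D := by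
    refine ⟨2 ^ (N + 2) * ((Finset.Iic (N + 2, 0)).sup fun m => SchwartzMap.seminorm ℝ m.1 m.2) g,
      fun x => ?_⟩
    have := SchwartzMap.one_add_le_sup_seminorm_apply (𝕜 := ℝ) (m := (N + 2, 0)) (k := N + 2)
      (n := 0) le_rfl le_rfl g x
    rwa [norm_iteratedFDeriv_zero] at this
  refine ⟨D, (by positivity : (0 : ℝ) ≤ (1 + |(0 : ℝ)|) ^ (N + 2) * ‖g 0‖).trans (hD 0),
    fun s y => ?_⟩
  have hs : 0 < 1 + |s| := by positivity
  rw [Real.norm_eq_abs s, Real.rpow_neg hs.le, Real.rpow_two, ← div_eq_mul_inv,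
    le_div_iff₀ (by positivity), mul_assoc, ← pow_add]
  have h1 : 1 + |s| ≤ (1 + |y|) * (1 + |s - y|) := by
    have : |s| ≤ |y| + |s - y| := by
      calc |s| = |y + (s - y)| := by congr 1; ring
        _ ≤ _ := abs_add_le _ _
    nlinarith [abs_nonneg y, abs_nonneg (s - y)]
  calc ‖g (s - y)‖ * (1 + |s|) ^ (N + 2)
      ≤ ‖g (s - y)‖ * ((1 + |y|) * (1 + |s - y|)) ^ (N + 2) := by gcongr
    _ = ((1 + |s - y|) ^ (N + 2) * ‖g (s - y)‖) * (1 + |y|) ^ (N + 2) := by rw [mul_pow]; ring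
    _ ≤ _ := by gcongr; exact hD _

variable {B : Type*} [NormedRing B] [NormedAlgebra ℂ B]

lemma integral_prod_mul_of_integrable [CompleteSpace B] {X Y : Type*} [MeasurableSpace X]
    [MeasurableSpace Y] {μ : Measure X} {ν : Measure Y} [SFinite μ] [SFinite ν] {f : X → B}
    {g : Y → B} (hf : Integrable f μ) (hg : Integrable g ν) :
    ∫ p, f p.1 * g p.2 ∂(μ.prod ν) = (∫ x, f x ∂μ) * ∫ y, g y ∂ν := by
  rw [integral_prod _ (hf.mul_prod hg)]
  simp only [integral_const_mul_of_integrable hg]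
  rw [integral_mul_const_of_integrable hf]

/-- The product `E(y₀) ρ₁ E(y₁) ρ₂ E(y₂)` with `E(y) = exp (2 π i y b)`. -/
def tripleFlow (b ρ₁ ρ₂ : B) (y₀ y₁ y₂ : ℝ) : B :=
  expI b y₀ * ρ₁ * (expI b y₁ * ρ₂ * expI b y₂)

/-- The character `x ↦ exp (2 π i ⟨y, x⟩)` of `ℝ³`. -/
def character (y₀ y₁ y₂ x₀ x₁ x₂ : ℝ) : ℂ :=
  Complex.exp (2 * Real.pi * Complex.I * ((y₀ * x₀ + y₁ * x₁ + y₂ * x₂ : ℝ) : ℂ))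

lemma norm_character (y₀ y₁ y₂ x₀ x₁ x₂ : ℝ) : ‖character y₀ y₁ y₂ x₀ x₁ x₂‖ = 1 := by
  rw [character, Complex.norm_exp]
  simp

@[fun_prop]
lemma continuous_character : Continuous fun p : (ℝ × ℝ × ℝ) × (ℝ × ℝ × ℝ) =>
    character p.1.1 p.1.2.1 p.1.2.2 p.2.1 p.2.2.1 p.2.2.2 := by
  unfold character
  fun_prop

lemma fourier_eq_integral_exp (χ : 𝓢(ℝ, ℂ)) (s : ℝ) :
    (𝓕 χ) s = ∫ x : ℝ, χ x * Complex.exp (-(2 * Real.pi * Complex.I * (s * x))) := by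
  rw [SchwartzMap.fourier_coe, Real.fourier_eq']
  refine integral_congr_ae (Eventually.of_forall fun x => ?_)
  simp only [smul_eq_mul]
  rw [mul_comm]
  congr 2
  simp
  ring

lemma fourier_translate_triple (χ : 𝓢(ℝ, ℂ)) (s₀ s₁ s₂ y₀ y₁ y₂ : ℝ) :
    (𝓕 χ) (s₀ - y₀) * ((𝓕 χ) (s₁ - y₁) * (𝓕 χ) (s₂ - y₂)) =
      ∫ x : ℝ × ℝ × ℝ, (χ x.1 * (χ x.2.1 * χ x.2.2)) *
        character (-s₀) (-s₁) (-s₂) x.1 x.2.1 x.2.2 * character y₀ y₁ y₂ x.1 x.2.1 x.2.2 := by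
  rw [fourier_eq_integral_exp, fourier_eq_integral_exp, fourier_eq_integral_exp,
    ← integral_prod_mul, ← integral_prod_mul]
  refine integral_congr_ae (Eventually.of_forall fun x => ?_)
  simp only [character]
  have : ∀ a b c d e f : ℂ, a * d * (b * e * (c * f)) = a * (b * c) * (d * (e * f)) := by
    intros; ring
  rw [this, mul_assoc (χ x.1 * (χ x.2.1 * χ x.2.2)), ← Complex.exp_add, ← Complex.exp_add,
    ← Complex.exp_add]
  congr 2
  push_cast
  ring

variable {b : B} {C : ℝ} {N : ℕ}

lemma IsTempered.norm_tripleFlow_le (hb : IsTempered b C N) (ρ₁ ρ₂ : B) (s₀ s₁ s₂ : ℝ) :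
    ‖tripleFlow b ρ₁ ρ₂ s₀ s₁ s₂‖ ≤
      C ^ 3 * ‖ρ₁‖ * ‖ρ₂‖ * ((1 + |s₀|) * ((1 + |s₁|) * (1 + |s₂|))) ^ N := by
  have hC := hb.nonneg
  have h0 := hb s₀
  have h1 := hb s₁
  have h2 := hb s₂
  calc ‖tripleFlow b ρ₁ ρ₂ s₀ s₁ s₂‖
      ≤ ‖expI b s₀‖ * ‖ρ₁‖ * (‖expI b s₁‖ * ‖ρ₂‖ * ‖expI b s₂‖) := by
        refine (norm_mul_le _ _).trans ?_
        gcongr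
        · exact norm_mul_le _ _
        · exact norm_mul₃_le
    _ ≤ (C * (1 + |s₀|) ^ N) * ‖ρ₁‖ * ((C * (1 + |s₁|) ^ N) * ‖ρ₂‖ * (C * (1 + |s₂|) ^ N)) := by
        gcongr
    _ = _ := by rw [mul_pow, mul_pow]; ring

variable [CompleteSpace B]

@[fun_prop]
lemma continuous_tripleFlow (b ρ₁ ρ₂ : B) :
    Continuous fun s : ℝ × ℝ × ℝ => tripleFlow b ρ₁ ρ₂ s.1 s.2.1 s.2.2 := by
  unfold tripleFlow
  fun_prop

/-- `E(y) = χ(b) E(y)`, written as an integral of `E` against a translate of the Fourier transform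
of `χ`. -/
lemma IsTempered.expI_eq_integral (hb : IsTempered b C N) {χ : 𝓢(ℝ, ℂ)} (hχ : opCalc b χ = 1)
    (y : ℝ) : Integrable (fun s => (𝓕 χ) (s - y) • expI b s) ∧
      expI b y = ∫ s, (𝓕 χ) (s - y) • expI b s := by
  have h : (fun s => (𝓕 χ) (s - y) • expI b s) =
      fun s => (fun t => ((𝓕 χ) t • expI b t) * expI b y) (s - y) := by
    funext s
    simp only [smul_mul_assoc, ← expI_add, sub_add_cancel]
  rw [h]
  refine ⟨((hb.integrable χ).mul_const _).comp_sub_right y, ?_⟩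
  refine Eq.trans ?_
    (integral_sub_right_eq_self (fun t => ((𝓕 χ) t • expI b t) * expI b y) y).symm
  rw [integral_mul_const_of_integrable (hb.integrable χ), ← opCalc, hχ, one_mul]

lemma IsTempered.tripleFlow_eq_integral (hb : IsTempered b C N) {χ : 𝓢(ℝ, ℂ)}
    (hχ : opCalc b χ = 1) (ρ₁ ρ₂ : B) (y₀ y₁ y₂ : ℝ) (l : B →L[ℂ] ℂ) :
    l (tripleFlow b ρ₁ ρ₂ y₀ y₁ y₂) = ∫ s : ℝ × ℝ × ℝ,
      (𝓕 χ) (s.1 - y₀) * ((𝓕 χ) (s.2.1 - y₁) * (𝓕 χ) (s.2.2 - y₂)) *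
        l (tripleFlow b ρ₁ ρ₂ s.1 s.2.1 s.2.2) := by
  obtain ⟨i0, e0⟩ := hb.expI_eq_integral hχ y₀
  obtain ⟨i1, e1⟩ := hb.expI_eq_integral hχ y₁
  obtain ⟨i2, e2⟩ := hb.expI_eq_integral hχ y₂
  have j0 := i0.mul_const ρ₁
  have j12 := (i1.mul_const ρ₂).mul_prod i2
  have hI : tripleFlow b ρ₁ ρ₂ y₀ y₁ y₂ = ∫ s : ℝ × ℝ × ℝ,
      ((𝓕 χ) (s.1 - y₀) • expI b s.1 * ρ₁) * (((𝓕 χ) (s.2.1 - y₁) • expI b s.2.1 * ρ₂) *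
        ((𝓕 χ) (s.2.2 - y₂) • expI b s.2.2)) := by
    refine Eq.trans ?_ (integral_prod_mul_of_integrable j0 j12).symm
    rw [integral_mul_const_of_integrable i0, ← e0,
      integral_prod_mul_of_integrable (i1.mul_const ρ₂) i2, integral_mul_const_of_integrable i1,
      ← e1, ← e2, tripleFlow]
  rw [hI]
  refine (l.integral_comp_comm (j0.mul_prod j12)).symm.trans ?_
  refine integral_congr_ae (Eventually.of_forall fun s => ?_)
  simp only [tripleFlow, smul_mul_assoc, mul_smul_comm, smul_smul, map_smul, smul_eq_mul]
  ring

lemma IsTempered.integrable_fourier_mul_tripleFlow (hb : IsTempered b C N) (χ : 𝓢(ℝ, ℂ))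
    (ρ₁ ρ₂ : B) (l : B →L[ℂ] ℂ) {Ω : Type*} [MeasurableSpace Ω] {μ : Measure Ω} [SFinite μ]
    {c : Ω → ℂ} {y₀ y₁ y₂ : Ω → ℝ} (hc : AEStronglyMeasurable c μ) (h₀ : Measurable y₀)
    (h₁ : Measurable y₁) (h₂ : Measurable y₂)
    (hint : Integrable (fun t => ‖c t‖ *
      ((1 + |y₀ t|) * ((1 + |y₁ t|) * (1 + |y₂ t|))) ^ (N + 2)) μ) :
    Integrable (fun p : Ω × (ℝ × ℝ × ℝ) => c p.1 *
      ((𝓕 χ) (p.2.1 - y₀ p.1) * ((𝓕 χ) (p.2.2.1 - y₁ p.1) * (𝓕 χ) (p.2.2.2 - y₂ p.1)) *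
        l (tripleFlow b ρ₁ ρ₂ p.2.1 p.2.2.1 p.2.2.2))) (μ.prod volume) := by
  have hC := hb.nonneg
  have hcont := (𝓕 χ).continuous
  obtain ⟨D, hD0, hD⟩ := exists_decay_translate (𝓕 χ) N
  have hw : Integrable (fun s : ℝ => (1 + ‖s‖) ^ (-(2 : ℝ))) :=
    integrable_one_add_norm (by simp)
  have hmaj := ((hint.mul_prod (hw.mul_prod (hw.mul_prod hw))).const_mul
    (D ^ 3 * (‖l‖ * (C ^ 3 * ‖ρ₁‖ * ‖ρ₂‖))))
  refine hmaj.mono' ?_ (Eventually.of_forall fun p => ?_)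
  · refine hc.comp_fst.mul (AEStronglyMeasurable.mul ?_ ?_)
    · have m0 : Measurable fun p : Ω × (ℝ × ℝ × ℝ) => (𝓕 χ) (p.2.1 - y₀ p.1) :=
        hcont.measurable.comp (by fun_prop)
      have m1 : Measurable fun p : Ω × (ℝ × ℝ × ℝ) => (𝓕 χ) (p.2.2.1 - y₁ p.1) :=
        hcont.measurable.comp (by fun_prop)
      have m2 : Measurable fun p : Ω × (ℝ × ℝ × ℝ) => (𝓕 χ) (p.2.2.2 - y₂ p.1) :=
        hcont.measurable.comp (by fun_prop)
      exact (m0.mul (m1.mul m2)).aestronglyMeasurable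
    · have : Continuous fun s : ℝ × ℝ × ℝ => l (tripleFlow b ρ₁ ρ₂ s.1 s.2.1 s.2.2) :=
        l.continuous.comp (continuous_tripleFlow b ρ₁ ρ₂)
      exact (this.measurable.comp measurable_snd).aestronglyMeasurable
  · obtain ⟨t, s₀, s₁, s₂⟩ := p
    simp only [norm_mul]
    have hT : ‖l (tripleFlow b ρ₁ ρ₂ s₀ s₁ s₂)‖ ≤ ‖l‖ *
        (C ^ 3 * ‖ρ₁‖ * ‖ρ₂‖ * ((1 + |s₀|) * ((1 + |s₁|) * (1 + |s₂|))) ^ N) :=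
      (l.le_opNorm _).trans (by gcongr; exact hb.norm_tripleFlow_le ρ₁ ρ₂ s₀ s₁ s₂)
    have d0 := hD s₀ (y₀ t)
    have d1 := hD s₁ (y₁ t)
    have d2 := hD s₂ (y₂ t)
    calc _ ≤ ‖c t‖ * (‖(𝓕 χ) (s₀ - y₀ t)‖ * (‖(𝓕 χ) (s₁ - y₁ t)‖ * ‖(𝓕 χ) (s₂ - y₂ t)‖) *
          (‖l‖ * (C ^ 3 * ‖ρ₁‖ * ‖ρ₂‖ * ((1 + |s₀|) * ((1 + |s₁|) * (1 + |s₂|))) ^ N))) := by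
          gcongr
      _ = ‖c t‖ * (‖l‖ * (C ^ 3 * ‖ρ₁‖ * ‖ρ₂‖)) *
          ((‖(𝓕 χ) (s₀ - y₀ t)‖ * (1 + |s₀|) ^ N) * ((‖(𝓕 χ) (s₁ - y₁ t)‖ * (1 + |s₁|) ^ N) *
          (‖(𝓕 χ) (s₂ - y₂ t)‖ * (1 + |s₂|) ^ N))) := by
          rw [mul_pow, mul_pow]; ring
      _ ≤ ‖c t‖ * (‖l‖ * (C ^ 3 * ‖ρ₁‖ * ‖ρ₂‖)) *
          ((D * (1 + |y₀ t|) ^ (N + 2) * (1 + ‖s₀‖) ^ (-(2 : ℝ))) *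
          ((D * (1 + |y₁ t|) ^ (N + 2) * (1 + ‖s₁‖) ^ (-(2 : ℝ))) *
          (D * (1 + |y₂ t|) ^ (N + 2) * (1 + ‖s₂‖) ^ (-(2 : ℝ))))) := by gcongr
      _ = _ := by rw [mul_pow, mul_pow]; ring

lemma integrable_cutoff_mul_character (χ : 𝓢(ℝ, ℂ)) (s : ℝ × ℝ × ℝ) {Ω : Type*}
    [MeasurableSpace Ω] {μ : Measure Ω} [SFinite μ] {c : Ω → ℂ} {y₀ y₁ y₂ : Ω → ℝ}
    (hc : AEStronglyMeasurable c μ) (h₀ : Measurable y₀) (h₁ : Measurable y₁) (h₂ : Measurable y₂)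
    (hcint : Integrable c μ) :
    Integrable (fun p : Ω × (ℝ × ℝ × ℝ) => c p.1 *
      ((χ p.2.1 * (χ p.2.2.1 * χ p.2.2.2)) *
        character (-s.1) (-s.2.1) (-s.2.2) p.2.1 p.2.2.1 p.2.2.2 *
        character (y₀ p.1) (y₁ p.1) (y₂ p.1) p.2.1 p.2.2.1 p.2.2.2)) (μ.prod volume) := by
  have hχc := χ.continuous
  have hχi : Integrable (fun x : ℝ × ℝ × ℝ => χ x.1 * (χ x.2.1 * χ x.2.2)) :=
    χ.integrable.mul_prod (χ.integrable.mul_prod χ.integrable)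
  refine (hcint.mul_prod hχi).mono ?_ (Eventually.of_forall fun p => ?_)
  · refine hc.comp_fst.mul ?_
    have m1 : Measurable fun p : Ω × (ℝ × ℝ × ℝ) =>
        character (y₀ p.1) (y₁ p.1) (y₂ p.1) p.2.1 p.2.2.1 p.2.2.2 := by
      unfold character
      fun_prop
    have m2 : Measurable fun p : Ω × (ℝ × ℝ × ℝ) =>
        character (-s.1) (-s.2.1) (-s.2.2) p.2.1 p.2.2.1 p.2.2.2 := by
      unfold character
      fun_prop
    have m3 : Measurable fun p : Ω × (ℝ × ℝ × ℝ) => χ p.2.1 * (χ p.2.2.1 * χ p.2.2.2) := by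
      have := hχc.measurable
      fun_prop
    exact ((m3.mul m2).mul m1).aestronglyMeasurable
  · simp only [norm_mul, norm_character, mul_one]
    exact le_rfl

/-- A superposition of the products `E(y₀) ρ₁ E(y₁) ρ₂ E(y₂)` can be computed from its symbol, the
corresponding superposition of the characters of `ℝ³`, restricted to the support of a cutoff
function `χ` with `χ(b) = 1`: insert `χ(b)` next to each of the three exponentials. -/
lemma IsTempered.integral_tripleFlow (hb : IsTempered b C N) {χ : 𝓢(ℝ, ℂ)} (hχ : opCalc b χ = 1)
    (ρ₁ ρ₂ : B) (l : B →L[ℂ] ℂ) {Ω : Type*} [MeasurableSpace Ω] {μ : Measure Ω} [SFinite μ]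
    {c : Ω → ℂ} {y₀ y₁ y₂ : Ω → ℝ} (hc : AEStronglyMeasurable c μ) (h₀ : Measurable y₀)
    (h₁ : Measurable y₁) (h₂ : Measurable y₂)
    (hint : Integrable (fun t => ‖c t‖ *
      ((1 + |y₀ t|) * ((1 + |y₁ t|) * (1 + |y₂ t|))) ^ (N + 2)) μ) :
    ∫ t, c t * l (tripleFlow b ρ₁ ρ₂ (y₀ t) (y₁ t) (y₂ t)) ∂μ =
      ∫ s : ℝ × ℝ × ℝ, l (tripleFlow b ρ₁ ρ₂ s.1 s.2.1 s.2.2) *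
        ∫ x : ℝ × ℝ × ℝ, (χ x.1 * (χ x.2.1 * χ x.2.2)) *
          character (-s.1) (-s.2.1) (-s.2.2) x.1 x.2.1 x.2.2 *
          ∫ t, c t * character (y₀ t) (y₁ t) (y₂ t) x.1 x.2.1 x.2.2 ∂μ := by
  have hcint : Integrable c μ := by
    refine hint.mono hc (Eventually.of_forall fun t => ?_)
    rw [Real.norm_of_nonneg (by positivity)]
    refine le_mul_of_one_le_right (norm_nonneg _) (one_le_pow₀ ?_)
    have e0 : 1 ≤ 1 + |y₀ t| := by simp
    have e1 : 1 ≤ 1 + |y₁ t| := by simp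
    have e2 : 1 ≤ 1 + |y₂ t| := by simp
    exact one_le_mul_of_one_le_of_one_le e0 (one_le_mul_of_one_le_of_one_le e1 e2)
  have h1 : ∀ t, c t * l (tripleFlow b ρ₁ ρ₂ (y₀ t) (y₁ t) (y₂ t)) = ∫ s : ℝ × ℝ × ℝ,
      c t * ((𝓕 χ) (s.1 - y₀ t) * ((𝓕 χ) (s.2.1 - y₁ t) * (𝓕 χ) (s.2.2 - y₂ t)) *
        l (tripleFlow b ρ₁ ρ₂ s.1 s.2.1 s.2.2)) := fun t => by
    rw [hb.tripleFlow_eq_integral hχ, integral_const_mul]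
  simp only [h1]
  rw [integral_integral_swap
    (hb.integrable_fourier_mul_tripleFlow χ ρ₁ ρ₂ l hc h₀ h₁ h₂ hint)]
  refine integral_congr_ae (Eventually.of_forall fun s => ?_)
  simp only
  have e1 : ∀ t, c t * ((𝓕 χ) (s.1 - y₀ t) * ((𝓕 χ) (s.2.1 - y₁ t) * (𝓕 χ) (s.2.2 - y₂ t)) *
      l (tripleFlow b ρ₁ ρ₂ s.1 s.2.1 s.2.2)) = l (tripleFlow b ρ₁ ρ₂ s.1 s.2.1 s.2.2) *
      ∫ x : ℝ × ℝ × ℝ, c t * ((χ x.1 * (χ x.2.1 * χ x.2.2)) *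
        character (-s.1) (-s.2.1) (-s.2.2) x.1 x.2.1 x.2.2 *
        character (y₀ t) (y₁ t) (y₂ t) x.1 x.2.1 x.2.2) := by
    intro t
    rw [fourier_translate_triple, integral_const_mul]
    ring
  simp only [e1]
  rw [integral_const_mul, integral_integral_swap
    (integrable_cutoff_mul_character χ s hc h₀ h₁ h₂ hcint)]
  congr 1
  refine integral_congr_ae (Eventually.of_forall fun x => ?_)
  simp only
  rw [← integral_const_mul]
  refine integral_congr_ae (Eventually.of_forall fun t => ?_)
  simp only
  ring

/-- Two superpositions of the products `E(y₀) ρ₁ E(y₁) ρ₂ E(y₂)` whose symbols agree almost everywhere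
on the support of a cutoff function `χ` with `χ(b) = 1` are equal. -/
lemma IsTempered.integral_tripleFlow_congr (hb : IsTempered b C N) {χ : 𝓢(ℝ, ℂ)}
    (hχ : opCalc b χ = 1) (ρ₁ ρ₂ : B) (l : B →L[ℂ] ℂ)
    {Ω : Type*} [MeasurableSpace Ω] {μ : Measure Ω} [SFinite μ] {c : Ω → ℂ} {y₀ y₁ y₂ : Ω → ℝ}
    (hc : AEStronglyMeasurable c μ) (h₀ : Measurable y₀) (h₁ : Measurable y₁) (h₂ : Measurable y₂)
    (hint : Integrable (fun t => ‖c t‖ *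
      ((1 + |y₀ t|) * ((1 + |y₁ t|) * (1 + |y₂ t|))) ^ (N + 2)) μ)
    {Ω' : Type*} [MeasurableSpace Ω'] {μ' : Measure Ω'} [SFinite μ'] {c' : Ω' → ℂ}
    {y₀' y₁' y₂' : Ω' → ℝ} (hc' : AEStronglyMeasurable c' μ') (h₀' : Measurable y₀')
    (h₁' : Measurable y₁') (h₂' : Measurable y₂')
    (hint' : Integrable (fun t => ‖c' t‖ *
      ((1 + |y₀' t|) * ((1 + |y₁' t|) * (1 + |y₂' t|))) ^ (N + 2)) μ')
    (hsymb : ∀ᵐ x : ℝ × ℝ × ℝ, χ x.1 ≠ 0 → χ x.2.1 ≠ 0 → χ x.2.2 ≠ 0 →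
      ∫ t, c t * character (y₀ t) (y₁ t) (y₂ t) x.1 x.2.1 x.2.2 ∂μ =
        ∫ t, c' t * character (y₀' t) (y₁' t) (y₂' t) x.1 x.2.1 x.2.2 ∂μ') :
    ∫ t, c t * l (tripleFlow b ρ₁ ρ₂ (y₀ t) (y₁ t) (y₂ t)) ∂μ =
      ∫ t, c' t * l (tripleFlow b ρ₁ ρ₂ (y₀' t) (y₁' t) (y₂' t)) ∂μ' := by
  rw [hb.integral_tripleFlow hχ ρ₁ ρ₂ l hc h₀ h₁ h₂ hint,
    hb.integral_tripleFlow hχ ρ₁ ρ₂ l hc' h₀' h₁' h₂' hint']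
  refine integral_congr_ae (Eventually.of_forall fun s => ?_)
  simp only
  congr 1
  refine integral_congr_ae ?_
  filter_upwards [hsymb] with x hx
  by_cases hx0 : χ x.1 * (χ x.2.1 * χ x.2.2) = 0
  · simp [hx0]
  · rw [← ne_eq, mul_ne_zero_iff, mul_ne_zero_iff] at hx0
    rw [hx hx0.1 hx0.2.1 hx0.2.2]

end MultipleOperatorIntegral

/-! ### Smoothness of divided differences -/

section DividedDifference

/-- Integrals of smooth functions over `[0, 1]` depend smoothly on parameters. -/
lemma contDiff_integral_unitInterval {P : Type*} [NormedAddCommGroup P] [NormedSpace ℝ P]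
    {G : P × ℝ → ℂ} (hG : ContDiff ℝ ∞ G) :
    ContDiff ℝ ∞ fun p => ∫ u in (0 : ℝ)..1, G (p, u) := by
  obtain ⟨χ, hχ, ⟨W, -, hKW, hW⟩, -⟩ := exists_schwartz_cutoff (isCompact_Icc (a := (-1 : ℝ)) (b := 0))
    isOpen_univ (Set.subset_univ _)
  have hloc : LocallyIntegrable (Set.indicator (Set.Ioc (0 : ℝ) 1) fun _ => (1 : ℝ)) volume :=
    ((integrable_indicator_iff measurableSet_Ioc).2 (by simp)).locallyIntegrable
  -- the integral is the value at `0` of the convolution of the indicator of `(0, 1]` with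
  -- `t ↦ χ t G (p, -t)`
  have h := contDiffOn_convolution_right_with_param_comp (𝕜 := ℝ) (μ := volume) (n := ⊤)
    (ContinuousLinearMap.lsmul ℝ ℝ) (s := (Set.univ : Set P)) (v := fun _ => (0 : ℝ))
    (g := fun p t => χ t * G (p, -t)) (k := tsupport χ) contDiffOn_const isOpen_univ hχ
    (fun p x _ hx => by simp [image_eq_zero_of_notMem_tsupport hx]) hloc (by
      refine ContDiff.contDiffOn ?_
      have e1 : ContDiff ℝ ∞ fun q : P × ℝ => χ q.2 := (χ.smooth ⊤).comp contDiff_snd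
      have e2 : ContDiff ℝ ∞ fun q : P × ℝ => G (q.1, -q.2) :=
        hG.comp (contDiff_fst.prodMk contDiff_snd.neg)
      exact e1.mul e2)
  rw [contDiffOn_univ] at h
  convert h using 1
  funext p
  rw [intervalIntegral.integral_of_le zero_le_one, ← integral_indicator measurableSet_Ioc]
  refine integral_congr_ae (Eventually.of_forall fun u => ?_)
  by_cases hu : u ∈ Set.Ioc (0 : ℝ) 1
  · have : χ (-u) = 1 := hW _ (hKW ⟨by linarith [hu.2], by linarith [hu.1]⟩)
    simp [Set.indicator_of_mem hu, this]
  · simp [Set.indicator_of_notMem hu]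

lemma dslope_eq_integral {f : ℝ → ℂ} (hf : ContDiff ℝ ∞ f) (a b : ℝ) :
    dslope f a b = ∫ u in (0 : ℝ)..1, deriv f (a + u * (b - a)) := by
  rcases eq_or_ne b a with rfl | hne
  · simp [dslope_same]
  · have hd : Differentiable ℝ f := hf.differentiable (by simp)
    have hc : Continuous (deriv f) := hf.continuous_deriv (by simp)
    have h := intervalIntegral.integral_unitInterval_deriv_eq_sub (𝕜 := ℝ) (f := f)
      (f' := deriv f) (z₀ := a) (z₁ := b - a)
      (hc.comp (by fun_prop : Continuous fun t : ℝ => a + t • (b - a))).continuousOn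
      (fun t _ => (hd _).hasDerivAt)
    rw [add_sub_cancel] at h
    rw [dslope_of_ne _ hne, slope_def_module, ← h, smul_smul, inv_mul_cancel₀ (sub_ne_zero.2 hne),
      one_smul]
    rfl

/-- The divided difference of a smooth function is jointly smooth. -/
lemma contDiff_dslope {f : ℝ → ℂ} (hf : ContDiff ℝ ∞ f) :
    ContDiff ℝ ∞ fun p : ℝ × ℝ => dslope f p.1 p.2 := by
  simp only [dslope_eq_integral hf]
  have hd : ContDiff ℝ ∞ (deriv f) := (contDiff_infty_iff_deriv.1 hf).2
  refine contDiff_integral_unitInterval (G := fun q : (ℝ × ℝ) × ℝ =>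
    deriv f (q.1.1 + q.2 * (q.1.2 - q.1.1))) ?_
  exact hd.comp (by fun_prop)

lemma contDiff_cyc {n : ℕ} : ContDiff ℝ ∞ (cyc (n := n)) := by
  refine contDiff_pi.2 fun i => ?_
  refine Fin.cases ?_ (fun k => ?_) i
  · simp only [cyc, Fin.cons_zero]
    fun_prop
  · simp only [cyc, Fin.cons_succ, Fin.init]
    fun_prop

lemma contDiff_tau {n : ℕ} (j : ℝ) {f : (Fin (n + 1) → ℝ) → ℂ} (hf : ContDiff ℝ ∞ f) :
    ContDiff ℝ ∞ (tau j f) := by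
  have h0 : ContDiff ℝ ∞ fun x : Fin (n + 1) → ℝ => cyc x 0 := contDiff_pi.1 contDiff_cyc 0
  have h1 : ContDiff ℝ ∞ fun x : Fin (n + 1) → ℝ => ((cyc x 0 : ℝ) : ℂ) :=
    Complex.ofRealCLM.contDiff.comp h0
  exact ((contDiff_const.mul h1).cexp).mul (hf.comp contDiff_cyc)

lemma contDiff_triangle {f : (Fin 1 → ℝ) → ℂ} (hf : ContDiff ℝ ∞ f) :
    ContDiff ℝ ∞ (triangle f) := by
  have h : ContDiff ℝ ∞ fun t : ℝ => f ![t] :=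
    hf.comp (contDiff_pi.2 fun i => by fin_cases i; exact contDiff_id)
  exact (contDiff_dslope h).comp (g := fun p : ℝ × ℝ => dslope (fun t : ℝ => f ![t]) p.1 p.2)
    (f := fun x : Fin 2 → ℝ => (x 0, x 0 + x 1)) (by fun_prop)

lemma contDiff_spectralK (j : ℝ) {f : (Fin 1 → ℝ) → ℂ} (hf : ContDiff ℝ ∞ f) :
    ContDiff ℝ ∞ (spectralK j f) :=
  (hf.add (contDiff_tau j hf)).neg

lemma contDiff_connesMoscovici (j : ℝ) {K : (Fin 1 → ℝ) → ℂ} (hK : ContDiff ℝ ∞ K) :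
    ContDiff ℝ ∞ (connesMoscovici j K) :=
  ((contDiff_triangle hK).add (contDiff_tau j (contDiff_triangle hK))).sub
    (contDiff_tau j (contDiff_tau j (contDiff_triangle hK)))

end DividedDifference

/-! ### The resolvent of a tempered element -/

section RealSpectrum

variable {B : Type*} [NormedRing B] [NormedAlgebra ℂ B] [CompleteSpace B]
  {b : B} {C : ℝ} {N : ℕ}

lemma integrableOn_exp_neg_mul_pow {c : ℝ} (hc : 0 < c) (N : ℕ) :
    IntegrableOn (fun s : ℝ => Real.exp (-(c * s)) * (1 + s) ^ N) (Set.Ioi 0) := by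
  have h := (exp_neg_integrableOn_Ioi 0 (half_pos hc)).const_mul
    ((2 / c) ^ N * N.factorial * Real.exp (c / 2))
  refine h.mono' (by fun_prop) ?_
  refine (ae_restrict_iff' measurableSet_Ioi).2 (Eventually.of_forall fun s hs => ?_)
  have hs0 : 0 ≤ 1 + s := by have := Set.mem_Ioi.1 hs; linarith
  have h1 : ((c / 2) * (1 + s)) ^ N ≤ N.factorial * Real.exp ((c / 2) * (1 + s)) := by
    have := Real.pow_div_factorial_le_exp ((c / 2) * (1 + s)) (by positivity) N
    rwa [div_le_iff₀' (by positivity)] at this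
  have h2 : (1 + s) ^ N = (2 / c) ^ N * ((c / 2) * (1 + s)) ^ N := by
    rw [← mul_pow]
    congr 1
    field_simp
  rw [Real.norm_of_nonneg (by positivity), h2]
  calc _ ≤ Real.exp (-(c * s)) * ((2 / c) ^ N * (N.factorial * Real.exp ((c / 2) * (1 + s)))) := by
        gcongr
    _ = (2 / c) ^ N * N.factorial * (Real.exp (-(c * s)) * Real.exp ((c / 2) * (1 + s))) := by ring
    _ = (2 / c) ^ N * N.factorial * (Real.exp (c / 2) * Real.exp (-(c / 2) * s)) := by
        rw [← Real.exp_add, ← Real.exp_add]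
        congr 2
        ring
    _ = _ := by ring

/-- Up to a factor, the resolvent of a tempered element at a nonreal point `z` is the integral of
`exp (2 π i σ s (b - z))` over a half-line, the sign `σ` being chosen such that it converges. -/
lemma IsTempered.integral_resolvent (hb : IsTempered b C N) {z : ℂ} {σ : ℝ} (hσ : |σ| = 1)
    (hz : σ * z.im < 0) :
    IntegrableOn (fun s : ℝ => Complex.exp (-(2 * Real.pi * Complex.I * (σ * s : ℝ) * z)) •
      expI b (σ * s)) (Set.Ioi 0) ∧
    (2 * (Real.pi : ℂ) * Complex.I * σ) • ((b - algebraMap ℂ B z) *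
      ∫ s in Set.Ioi 0, Complex.exp (-(2 * Real.pi * Complex.I * (σ * s : ℝ) * z)) •
        expI b (σ * s)) = -1 := by
  have hC := hb.nonneg
  set F : ℝ → B := fun s : ℝ => Complex.exp (-(2 * Real.pi * Complex.I * (σ * s : ℝ) * z)) •
      expI b (σ * s) with hF
  have hFc : Continuous F := by fun_prop
  have hn : ∀ s : ℝ, ‖Complex.exp (-(2 * Real.pi * Complex.I * (σ * s : ℝ) * z))‖ =
      Real.exp (-((-(2 * Real.pi * (σ * z.im))) * s)) := by
    intro s
    rw [Complex.norm_exp]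
    congr 1
    simp
    ring
  have hint : IntegrableOn F (Set.Ioi 0) := by
    have hc : 0 < -(2 * Real.pi * (σ * z.im)) := by
      nlinarith [mul_pos Real.pi_pos (neg_pos.2 hz)]
    refine ((integrableOn_exp_neg_mul_pow hc N).const_mul C).mono' hFc.aestronglyMeasurable ?_
    refine (ae_restrict_iff' measurableSet_Ioi).2 (Eventually.of_forall fun s hs => ?_)
    have hs : 0 < s := hs
    have := hb (σ * s)
    rw [abs_mul, hσ, one_mul, abs_of_pos hs] at this
    rw [hF, norm_smul, hn]
    calc _ ≤ Real.exp (-((-(2 * Real.pi * (σ * z.im))) * s)) * (C * (1 + s) ^ N) := by gcongr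
      _ = _ := by ring
  refine ⟨hint, ?_⟩
  have hd : ∀ s : ℝ, HasDerivAt F ((2 * (Real.pi : ℂ) * Complex.I * σ) •
      ((b - algebraMap ℂ B z) * F s)) s := by
    intro s
    have e1 : HasDerivAt (fun s : ℝ => Complex.exp (-(2 * Real.pi * Complex.I * (σ * s : ℝ) * z)))
        (Complex.exp (-(2 * Real.pi * Complex.I * (σ * s : ℝ) * z)) *
          (-(2 * Real.pi * Complex.I * σ * z))) s := by
      have := ((((hasDerivAt_id (s : ℂ)).const_mul (σ : ℂ)).const_mul
        (2 * (Real.pi : ℂ) * Complex.I)).mul_const z).fun_neg.cexp.comp_ofReal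
      simpa using this
    have e2 : HasDerivAt (fun s : ℝ => expI b (σ * s))
        (σ • ((2 * (Real.pi : ℂ) * Complex.I) • (b * expI b (σ * s)))) s := by
      refine HasDerivAt.congr_deriv (f := expI b ∘ fun s => σ * s)
        ((hasDerivAt_expI b (σ * s)).scomp s ((hasDerivAt_id s).const_mul σ)) ?_
      rw [mul_one]
    refine (e1.fun_smul e2).congr_deriv ?_
    simp only [hF, sub_mul, mul_smul_comm, Algebra.algebraMap_eq_smul_one, smul_mul_assoc, one_mul]
    rw [← Complex.coe_smul σ]
    module
  have hint' : IntegrableOn (fun s => (2 * (Real.pi : ℂ) * Complex.I * σ) •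
      ((b - algebraMap ℂ B z) * F s)) (Set.Ioi 0) := (hint.const_mul _).fun_smul _
  have hlim := tendsto_zero_of_hasDerivAt_of_integrableOn_Ioi (fun s _ => hd s) hint' hint
  have h := integral_Ioi_of_hasDerivAt_of_tendsto' (fun s _ => hd s) hint' hlim
  rw [integral_smul, integral_const_mul_of_integrable hint] at h
  rw [h]
  simp [hF]

end RealSpectrum

/-! ### Spectra of self-adjoint elements -/

lemma IsTempered.integrable_tripleFlow {B : Type*} [NormedRing B] [NormedAlgebra ℂ B]
    [CompleteSpace B] {b : B} {C : ℝ} {N : ℕ} (hb : IsTempered b C N) (ρ₁ ρ₂ : B)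
    {Ω : Type*} [TopologicalSpace Ω] [SecondCountableTopology Ω] [MeasurableSpace Ω] [BorelSpace Ω]
    {μ : Measure Ω} {c : Ω → ℂ} {y₀ y₁ y₂ : Ω → ℝ}
    (hc : Continuous c) (h₀ : Continuous y₀) (h₁ : Continuous y₁) (h₂ : Continuous y₂)
    (hint : Integrable (fun t => ‖c t‖ *
      ((1 + |y₀ t|) * ((1 + |y₁ t|) * (1 + |y₂ t|))) ^ N) μ) :
    Integrable (fun t => c t • tripleFlow b ρ₁ ρ₂ (y₀ t) (y₁ t) (y₂ t)) μ := by
  have hT : Continuous fun t => tripleFlow b ρ₁ ρ₂ (y₀ t) (y₁ t) (y₂ t) :=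
    (continuous_tripleFlow b ρ₁ ρ₂).comp (h₀.prodMk (h₁.prodMk h₂))
  refine (hint.const_mul (C ^ 3 * ‖ρ₁‖ * ‖ρ₂‖)).mono' (hc.smul hT).aestronglyMeasurable
    (Eventually.of_forall fun t => ?_)
  rw [norm_smul]
  exact (mul_le_mul_of_nonneg_left (hb.norm_tripleFlow_le ρ₁ ρ₂ (y₀ t) (y₁ t) (y₂ t))
    (norm_nonneg _)).trans_eq (by ring)

section SelfAdjoint

variable {A : Type*} [Ring A] [Algebra ℂ A]

lemma IsSpectralNhd.inter {h : A} {U U' : Set ℝ} (hU : IsSpectralNhd h U)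
    (hU' : IsSpectralNhd h U') : IsSpectralNhd h (U ∩ U') := by
  refine ⟨hU.1.inter hU'.1, hU.2.1.subset Set.inter_subset_left, fun z hz w hw => ?_⟩
  obtain ⟨u, hu, e⟩ := hU.2.2 z hz w hw
  obtain ⟨u', hu', e'⟩ := hU'.2.2 z hz w hw
  have : u = u' := by exact_mod_cast e.trans e'.symm
  exact ⟨u, ⟨hu, this ▸ hu'⟩, e⟩

variable [UniformSpace A]

lemma realSpectrum_toLocal_subset (q : SubmultSeminorm A) (h : A) {x : ℝ}
    (hx : x ∈ realSpectrum (q.toLocal h)) : (x : ℂ) ∈ spectrum ℂ h :=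
  AlgHom.spectrum_apply_subset q.toLocal h hx

/-- A spectral neighbourhood contains the differences of the points of a neighbourhood of the
spectrum of `h` in the Banach algebra `q.Local`. -/
lemma IsSpectralNhd.exists_sub_mem {h : A} {U : Set ℝ} (hU : IsSpectralNhd h U)
    (q : SubmultSeminorm A) :
    ∃ V : Set ℝ, IsOpen V ∧ realSpectrum (q.toLocal h) ⊆ V ∧ ∀ x ∈ V, ∀ y ∈ V, y - x ∈ U := by
  have hK := isCompact_realSpectrum (q.toLocal h)
  have ho : IsOpen ((fun p : ℝ × ℝ => p.2 - p.1) ⁻¹' U) := hU.1.preimage (by fun_prop)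
  obtain ⟨V₁, V₂, h1, h2, hK1, hK2, hsub⟩ := generalized_tube_lemma hK hK ho (by
    rintro ⟨x, y⟩ ⟨hx, hy⟩
    obtain ⟨u, hu, e⟩ := hU.2.2 _ (realSpectrum_toLocal_subset q h hx) _
      (realSpectrum_toLocal_subset q h hy)
    have : u = y - x := by exact_mod_cast e
    simpa [this] using hu)
  exact ⟨V₁ ∩ V₂, h1.inter h2, Set.subset_inter hK1 hK2, fun x hx y hy =>
    hsub (Set.mk_mem_prod hx.1 hy.2)⟩

variable [StarRing A] [IsUniformAddGroup A] [IsTopologicalRing A] [T2Space A] [CompleteSpace A]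

lemma HasTemperedSelfAdjoints.exists_isTempered (hA : IsMultiplicativelyConvex A)
    (hsa : HasTemperedSelfAdjoints A) (q : SubmultSeminorm A) {h : A} (hh : IsSelfAdjoint h) :
    ∃ V ∈ 𝓝 h, ∃ (C : ℝ) (N : ℕ), ∀ h' ∈ V, IsSelfAdjoint h' → IsTempered (q.toLocal h') C N := by
  -- the factor `7 ^ N` comes from `2 π < 7`
  obtain ⟨V, hV, C, N, hb⟩ := hsa.tempered h hh q.toSeminorm q.continuous_toSeminorm
  refine ⟨V, hV, |C| * 7 ^ N, N, fun h' h1 h2 s => ?_⟩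
  have key := hb h' h1 h2 (2 * Real.pi * s)
  have e : (Complex.I * ((2 * Real.pi * s : ℝ) : ℂ)) • h' =
      (2 * (Real.pi : ℂ) * Complex.I * (s : ℂ)) • h' := by
    congr 1
    push_cast
    ring
  rw [e, ← q.norm_toLocal, toLocal_exp hA, map_smul] at key
  refine key.trans ?_
  have h3 : 1 + |2 * Real.pi * s| ≤ 7 * (1 + |s|) := by
    rw [abs_mul, abs_of_pos (by positivity)]
    nlinarith [abs_nonneg s, Real.pi_lt_d2, Real.pi_pos]
  calc C * (1 + |2 * Real.pi * s|) ^ N ≤ |C| * (7 * (1 + |s|)) ^ N := by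
        gcongr
        exact le_abs_self C
    _ = _ := by rw [mul_pow, mul_assoc]

/-- The spectrum of a self-adjoint element of `A` is real: the resolvent at a nonreal point is an
integral of the tempered group over a half-line. -/
lemma HasTemperedSelfAdjoints.im_eq_zero (hA : IsMultiplicativelyConvex A)
    (hsa : HasTemperedSelfAdjoints A) {h : A} (hh : IsSelfAdjoint h) {z : ℂ}
    (hz : z ∈ spectrum ℂ h) : z.im = 0 := by
  by_contra hne
  obtain ⟨σ, hσ, hσz⟩ : ∃ σ : ℝ, |σ| = 1 ∧ σ * z.im < 0 := by
    rcases lt_or_gt_of_ne hne with hlt | hgt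
    · exact ⟨1, by simp, by simpa using hlt⟩
    · exact ⟨-1, by simp, by simpa using hgt⟩
  set F : ℝ → A := fun s => Complex.exp (-(2 * Real.pi * Complex.I * (σ * s : ℝ) * z)) •
    NormedSpace.exp ((2 * (Real.pi : ℂ) * Complex.I * ((σ * s : ℝ) : ℂ)) • h) with hF
  have hFq : ∀ (q : SubmultSeminorm A) (s : ℝ), q.toLocal (F s) =
      Complex.exp (-(2 * Real.pi * Complex.I * (σ * s : ℝ) * z)) • expI (q.toLocal h) (σ * s) := by
    intro q s
    rw [hF, map_smul, toLocal_exp hA, map_smul, expI]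
  have hres : ∀ q : SubmultSeminorm A, _ ∧ _ := fun q =>
    have ⟨V, hV, C, N, hb⟩ := hsa.exists_isTempered hA q hh
    (hb h (mem_of_mem_nhds hV) hh).integral_resolvent (b := q.toLocal h) hσ hσz
  obtain ⟨v, hv⟩ := exists_toLocal_eq_integral hA (μ := volume.restrict (Set.Ioi 0)) (F := F)
    fun q => by simpa only [hFq, IntegrableOn] using (hres q).1
  have h1 : (2 * (Real.pi : ℂ) * Complex.I * σ) • ((h - algebraMap ℂ A z) * v) = -1 := by
    refine eq_of_forall_toLocal_eq hA fun q => ?_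
    rw [map_smul, map_mul, map_sub, AlgHom.commutes, hv q, map_neg, map_one]
    simpa only [hFq] using (hres q).2
  have hcomm : h * v = v * h := by
    refine eq_of_forall_toLocal_eq hA fun q => ?_
    have hi : Integrable (fun s => q.toLocal (F s)) (volume.restrict (Set.Ioi 0)) := by
      simpa only [hFq, IntegrableOn] using (hres q).1
    rw [map_mul, map_mul, hv q, ← integral_const_mul_of_integrable hi,
      ← integral_mul_const_of_integrable hi]
    refine integral_congr_ae (Eventually.of_forall fun s => ?_)
    simp only [hFq, mul_smul_comm, smul_mul_assoc]
    rw [(expI_commute (Commute.refl (q.toLocal h)) (σ * s)).eq]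
  -- `c • v` inverts `z - h`
  set c : ℂ := 2 * (Real.pi : ℂ) * Complex.I * σ
  have h2 : (algebraMap ℂ A z - h) * (c • v) = 1 := by
    rw [mul_smul_comm, ← neg_sub, neg_mul, smul_neg, h1, neg_neg]
  have h3 : (c • v) * (algebraMap ℂ A z - h) = 1 := by
    rw [← h2, smul_mul_assoc, mul_smul_comm, mul_sub, sub_mul, hcomm,
      (Algebra.commutes z v)]
  exact hz ⟨⟨_, _, h2, h3⟩, rfl⟩

lemma HasTemperedSelfAdjoints.exists_ofReal_eq (hA : IsMultiplicativelyConvex A)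
    (hsa : HasTemperedSelfAdjoints A) {h : A} (hh : IsSelfAdjoint h) {z : ℂ}
    (hz : z ∈ spectrum ℂ h) : ((z.re : ℝ) : ℂ) = z :=
  Complex.ext rfl (by simp [hsa.im_eq_zero hA hh hz])

/-- Every sufficiently large interval around the origin is a neighbourhood of the spectrum of the
modular derivation. -/
lemma HasTemperedSelfAdjoints.exists_isSpectralNhd (hA : IsMultiplicativelyConvex A)
    (hsa : HasTemperedSelfAdjoints A) {h : A} (hh : IsSelfAdjoint h) :
    ∃ R₀ : ℝ, ∀ R, R₀ ≤ R → IsSpectralNhd h (Metric.ball 0 R) := by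
  obtain ⟨S, hS⟩ := (hsa.bounded h hh).subset_ball 0
  refine ⟨2 * S, fun R hR => ⟨Metric.isOpen_ball, Metric.isBounded_ball, fun z hz w hw => ?_⟩⟩
  refine ⟨w.re - z.re, ?_, ?_⟩
  · have h1 := mem_ball_zero_iff.1 (hS hz)
    have h2 := mem_ball_zero_iff.1 (hS hw)
    have h3 := Complex.abs_re_le_norm z
    have h4 := Complex.abs_re_le_norm w
    rw [mem_ball_zero_iff, Real.norm_eq_abs]
    have := abs_sub w.re z.re
    linarith
  · rw [Complex.ofReal_sub, hsa.exists_ofReal_eq hA hh hz, hsa.exists_ofReal_eq hA hh hw]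

end SelfAdjoint

/-! ### Smooth functions are spectral functions -/

/-- A smooth function agrees with a Schwartz function on any given cube. -/
lemma exists_schwartz_eq_on_cube {n : ℕ} {f : (Fin n → ℝ) → ℂ} (hf : ContDiff ℝ ∞ f) (R : ℝ) :
    ∃ g : 𝓢(EuclideanSpace ℝ (Fin n), ℂ), ∀ x : EuclideanSpace ℝ (Fin n),
      (∀ l, x l ∈ Metric.ball (0 : ℝ) R) → g x = f fun l => x l := by
  have hf' : ContDiff ℝ ∞ fun x : EuclideanSpace ℝ (Fin n) => f fun l => x l :=
    hf.comp (contDiff_pi.2 fun l => (EuclideanSpace.proj (𝕜 := ℝ) l).contDiff)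
  obtain ⟨g, hg⟩ := exists_schwartz_eq_on hf'
    (isCompact_closedBall (0 : EuclideanSpace ℝ (Fin n)) (Real.sqrt (n * R ^ 2)))
  refine ⟨g, fun x hx => hg x (mem_closedBall_zero_iff.2 ?_)⟩
  rw [EuclideanSpace.norm_eq]
  refine Real.sqrt_le_sqrt ((Finset.sum_le_sum (g := fun _ => R ^ 2) fun l _ => ?_).trans ?_)
  · have := (mem_ball_zero_iff.1 (hx l)).le
    gcongr
  · simp

section SpectralFunction

variable {A : Type*} [Ring A] [Algebra ℂ A] [UniformSpace A] [IsTopologicalRing A]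

/-- The data which present the flow of a product `ρ₁ ⋯ ρₙ` as a product
`E(y₀) r₁ E(y₁) r₂ E(y₂)`, the `yᵢ` depending linearly on the times `ξ`; `pt` is the linear map
which is dual to `ξ ↦ (y₀, y₁, y₂)`. -/
structure TriplePresentation {n : ℕ} (ρ : Fin n → A) where
  /-- The first factor. -/
  fst : A
  /-- The second factor. -/
  snd : A
  /-- The exponents. -/
  exponent : Fin 3 → EuclideanSpace ℝ (Fin n) →L[ℝ] ℝ
  /-- The point of `ℝⁿ` which corresponds to a point of `ℝ³`. -/
  pt : ℝ × ℝ × ℝ → EuclideanSpace ℝ (Fin n)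
  toLocal_partialModularFlow (q : SubmultSeminorm A) (h : A) (ξ : EuclideanSpace ℝ (Fin n)) :
    q.toLocal (partialModularFlow h (fun l => 2 * (Real.pi : ℂ) * Complex.I * (ξ l : ℂ)) ρ) =
      tripleFlow (q.toLocal h) (q.toLocal fst) (q.toLocal snd)
        (exponent 0 ξ) (exponent 1 ξ) (exponent 2 ξ)
  inner_pt (ξ : EuclideanSpace ℝ (Fin n)) (x : ℝ × ℝ × ℝ) :
    inner ℝ ξ (pt x) = exponent 0 ξ * x.1 + exponent 1 ξ * x.2.1 + exponent 2 ξ * x.2.2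
  pt_apply (x : ℝ × ℝ × ℝ) (l : Fin n) : pt x l = x.2.1 - x.1 ∨ pt x l = x.2.2 - x.2.1

variable {n : ℕ} {ρ : Fin n → A}

lemma TriplePresentation.integrable_weight (P : TriplePresentation ρ)
    (g : 𝓢(EuclideanSpace ℝ (Fin n), ℂ)) (M : ℕ) :
    Integrable fun ξ => ‖(𝓕 g) ξ‖ * ((1 + |P.exponent 0 ξ|) *
      ((1 + |P.exponent 1 ξ|) * (1 + |P.exponent 2 ξ|))) ^ M := by
  have hle : ∀ i ξ, 1 + |P.exponent i ξ| ≤ (1 + ‖P.exponent i‖) * (1 + ‖ξ‖) := by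
    intro i ξ
    have := (P.exponent i).le_opNorm ξ
    rw [Real.norm_eq_abs] at this
    nlinarith [norm_nonneg ξ, norm_nonneg (P.exponent i)]
  refine ((integrable_schwartz_mul_pow volume (𝓕 g) (3 * M)).const_mul
    (((1 + ‖P.exponent 0‖) * ((1 + ‖P.exponent 1‖) * (1 + ‖P.exponent 2‖))) ^ M)).mono' ?_
    (Eventually.of_forall fun ξ => ?_)
  · have := (𝓕 g).continuous
    exact (by fun_prop : Continuous _).aestronglyMeasurable
  · rw [Real.norm_of_nonneg (by positivity)]
    calc _ ≤ ‖(𝓕 g) ξ‖ * (((1 + ‖P.exponent 0‖) * (1 + ‖ξ‖)) * (((1 + ‖P.exponent 1‖) * (1 + ‖ξ‖)) *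
          ((1 + ‖P.exponent 2‖) * (1 + ‖ξ‖)))) ^ M := by
          gcongr <;> exact hle _ _
      _ = ‖(𝓕 g) ξ‖ * (((1 + ‖P.exponent 0‖) * ((1 + ‖P.exponent 1‖) * (1 + ‖P.exponent 2‖))) *
          (1 + ‖ξ‖) ^ 3) ^ M := by ring
      _ = _ := by rw [mul_pow, ← pow_mul]; ring

/-- The symbol of the Fourier integral of `g` is `g ∘ pt`, by Fourier inversion. -/
lemma TriplePresentation.integral_fourier_mul_character (P : TriplePresentation ρ)
    (g : 𝓢(EuclideanSpace ℝ (Fin n), ℂ)) (x : ℝ × ℝ × ℝ) :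
    ∫ ξ, (𝓕 g) ξ * character (P.exponent 0 ξ) (P.exponent 1 ξ) (P.exponent 2 ξ) x.1 x.2.1 x.2.2 =
      g (P.pt x) := by
  have h : 𝓕⁻ (𝓕 g) (P.pt x) = g (P.pt x) := by simp
  rw [← h, SchwartzMap.fourierInv_coe, Real.fourierInv_eq']
  refine integral_congr_ae (Eventually.of_forall fun ξ => ?_)
  simp only [smul_eq_mul, character]
  rw [P.inner_pt, mul_comm]
  congr 2
  push_cast
  ring

/-- The functional calculus, seen in `q.Local`, is an integral of triple flows. -/
lemma TriplePresentation.eval (P : TriplePresentation ρ) {h v : A} {f : (Fin n → ℝ) → ℂ}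
    (hv : HasModularCalculus h f ρ v) {U : Set ℝ} (hU : IsSpectralNhd h U)
    {g : 𝓢(EuclideanSpace ℝ (Fin n), ℂ)}
    (hg : ∀ x : EuclideanSpace ℝ (Fin n), (∀ l, x l ∈ U) → g x = f fun l => x l)
    (q : SubmultSeminorm A) (l : q.Local →L[ℂ] ℂ) :
    l (q.toLocal v) = ∫ ξ, (𝓕 g) ξ * l (tripleFlow (q.toLocal h) (q.toLocal P.fst)
      (q.toLocal P.snd) (P.exponent 0 ξ) (P.exponent 1 ξ) (P.exponent 2 ξ)) := by
  have key := (hv U g hU hg ⟨l.toLinearMap ∘ₗ q.toLocal.toLinearMap,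
    l.continuous.comp q.continuous_toLocal⟩).2
  refine key.symm.trans (integral_congr_ae (Eventually.of_forall fun ξ => ?_))
  change l (q.toLocal _) = _
  rw [map_smul, map_smul, P.toLocal_partialModularFlow, smul_eq_mul]

variable [IsUniformAddGroup A] [T2Space A] [CompleteSpace A]

lemma toLocal_modularFlow (hA : IsMultiplicativelyConvex A) (q : SubmultSeminorm A) (h ρ : A)
    (s : ℝ) : q.toLocal (modularFlow h (2 * (Real.pi : ℂ) * Complex.I * (s : ℂ)) ρ) =
      expI (q.toLocal h) (-s) * q.toLocal ρ * expI (q.toLocal h) s := by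
  simp only [modularFlow, map_mul, toLocal_exp hA, map_neg, map_smul, expI]
  congr 3
  rw [← neg_smul]
  congr 1
  push_cast
  ring

/-- The flow of one factor: `E(-ξ) ρ E(ξ)`. -/
def triplePresentationOne (hA : IsMultiplicativelyConvex A) (ρ : A) :
    TriplePresentation ![ρ] where
  fst := ρ
  snd := 1
  exponent := ![-EuclideanSpace.proj 0, EuclideanSpace.proj 0, 0]
  pt x := !₂[x.2.1 - x.1]
  toLocal_partialModularFlow q h ξ := by
    simp [partialModularFlow, toLocal_modularFlow hA, tripleFlow]
  inner_pt ξ x := by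
    simp [PiLp.inner_apply]
    ring
  pt_apply x l := by fin_cases l; simp

/-- The flow of two factors: `E(-ξ₁) ρ₁ E(ξ₁ - ξ₂) ρ₂ E(ξ₂)`. -/
def triplePresentationTwo (hA : IsMultiplicativelyConvex A) (ρ₁ ρ₂ : A) :
    TriplePresentation ![ρ₁, ρ₂] where
  fst := ρ₁
  snd := ρ₂
  exponent := ![-EuclideanSpace.proj 0, EuclideanSpace.proj 0 - EuclideanSpace.proj 1,
    EuclideanSpace.proj 1]
  pt x := !₂[x.2.1 - x.1, x.2.2 - x.2.1]
  toLocal_partialModularFlow q h ξ := by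
    simp only [partialModularFlow, List.ofFn_succ, List.ofFn_zero, List.prod_cons, List.prod_nil,
      mul_one, map_mul, toLocal_modularFlow hA]
    simp [tripleFlow, sub_eq_add_neg, expI_add, mul_assoc]
  inner_pt ξ x := by
    simp [PiLp.inner_apply, Fin.sum_univ_two]
    ring
  pt_apply x l := by fin_cases l <;> simp

variable [StarRing A]

lemma TriplePresentation.integrable_toLocal (P : TriplePresentation ρ)
    (hA : IsMultiplicativelyConvex A) (hsa : HasTemperedSelfAdjoints A) (q : SubmultSeminorm A)
    {h : A} (hh : IsSelfAdjoint h) (g : 𝓢(EuclideanSpace ℝ (Fin n), ℂ)) :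
    Integrable fun ξ => q.toLocal ((𝓕 g) ξ •
        partialModularFlow h (fun l => 2 * (Real.pi : ℂ) * Complex.I * (ξ l : ℂ)) ρ) := by
  obtain ⟨V, hV, C, N, hb⟩ := hsa.exists_isTempered hA q hh
  have hb := hb h (mem_of_mem_nhds hV) hh
  simp only [map_smul, P.toLocal_partialModularFlow]
  exact hb.integrable_tripleFlow _ _ (𝓕 g).continuous (P.exponent 0).continuous
    (P.exponent 1).continuous (P.exponent 2).continuous (P.integrable_weight g N)

/-- The Fourier integral of the functional calculus does not depend on the choice of the Schwartz
function: its value is determined by the symbol `g(λ₁ - λ₀, λ₂ - λ₁)` near the spectrum. -/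
lemma TriplePresentation.integral_congr (P : TriplePresentation ρ)
    (hA : IsMultiplicativelyConvex A) (hsa : HasTemperedSelfAdjoints A) (q : SubmultSeminorm A)
    {h : A} (hh : IsSelfAdjoint h) {U : Set ℝ} (hU : IsSpectralNhd h U)
    {g g' : 𝓢(EuclideanSpace ℝ (Fin n), ℂ)}
    (hg : ∀ x : EuclideanSpace ℝ (Fin n), (∀ l, x l ∈ U) → g x = g' x)
    (l : q.Local →L[ℂ] ℂ) :
    (∫ ξ, (𝓕 g) ξ * l (tripleFlow (q.toLocal h) (q.toLocal P.fst)
      (q.toLocal P.snd) (P.exponent 0 ξ) (P.exponent 1 ξ) (P.exponent 2 ξ))) =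
    ∫ ξ, (𝓕 g') ξ * l (tripleFlow (q.toLocal h) (q.toLocal P.fst)
      (q.toLocal P.snd) (P.exponent 0 ξ) (P.exponent 1 ξ) (P.exponent 2 ξ)) := by
  obtain ⟨W, hW, C, N, hb⟩ := hsa.exists_isTempered hA q hh
  have hb := hb h (mem_of_mem_nhds hW) hh
  obtain ⟨V, hV, hKV, hVU⟩ := hU.exists_sub_mem q
  obtain ⟨χ, -, ⟨W', hW', hKW, hχ⟩, hχ0⟩ :=
    exists_schwartz_cutoff (isCompact_realSpectrum (q.toLocal h)) hV hKV
  have hmem : ∀ x, χ x ≠ 0 → x ∈ V := fun x hx => by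
    by_contra h
    exact hx (hχ0 x h)
  refine hb.integral_tripleFlow_congr (hb.opCalc_eq_one hW' hKW hχ) _ _ l
    (𝓕 g).continuous.aestronglyMeasurable (P.exponent 0).continuous.measurable
    (P.exponent 1).continuous.measurable (P.exponent 2).continuous.measurable
    (P.integrable_weight g _)
    (𝓕 g').continuous.aestronglyMeasurable (P.exponent 0).continuous.measurable
    (P.exponent 1).continuous.measurable (P.exponent 2).continuous.measurable
    (P.integrable_weight g' _) (Eventually.of_forall fun x h0 h1 h2 => ?_)
  rw [P.integral_fourier_mul_character, P.integral_fourier_mul_character]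
  refine hg _ fun i => ?_
  rcases P.pt_apply x i with e | e <;> rw [e]
  · exact hVU _ (hmem _ h0) _ (hmem _ h1)
  · exact hVU _ (hmem _ h1) _ (hmem _ h2)

/-- The functional calculus is well defined for every smooth function. -/
lemma TriplePresentation.existsUnique (P : TriplePresentation ρ)
    (hA : IsMultiplicativelyConvex A) (hsa : HasTemperedSelfAdjoints A) {h : A}
    (hh : IsSelfAdjoint h) {f : (Fin n → ℝ) → ℂ} (hf : ContDiff ℝ ∞ f) :
    ∃! v, HasModularCalculus h f ρ v := by
  obtain ⟨R, hR⟩ := hsa.exists_isSpectralNhd hA hh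
  have hU := hR R le_rfl
  obtain ⟨g, hg⟩ := exists_schwartz_eq_on_cube hf R
  obtain ⟨v, hv⟩ := exists_toLocal_eq_integral hA fun q => P.integrable_toLocal hA hsa q hh g
  refine ⟨v, fun U' g' hU' hg' => ?_, fun w hw => ?_⟩
  · refine isWeakIntegral_of_toLocal_eq hA (fun q => P.integrable_toLocal hA hsa q hh g') fun q => ?_
    rw [hv q]
    refine (SeparatingDual.eq_iff_forall_dual_eq (R := ℂ)).2 fun l => ?_
    rw [← l.integral_comp_comm (P.integrable_toLocal hA hsa q hh g),
      ← l.integral_comp_comm (P.integrable_toLocal hA hsa q hh g')]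
    simp only [map_smul, P.toLocal_partialModularFlow, smul_eq_mul]
    refine P.integral_congr hA hsa q hh (hU.inter hU') (fun x hx => ?_) l
    rw [hg x fun i => (hx i).1, hg' x fun i => (hx i).2]
  · refine eq_of_forall_functional_eq hA fun l => ?_
    obtain ⟨q, l', hl⟩ := exists_factor hA l
    rw [← hl, ← hl, P.eval hw hU hg q l', hv q,
      ← l'.integral_comp_comm (P.integrable_toLocal hA hsa q hh g)]
    simp only [map_smul, P.toLocal_partialModularFlow, smul_eq_mul]

lemma isSpectralFunction_one (hA : IsMultiplicativelyConvex A) (hsa : HasTemperedSelfAdjoints A)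
    {f : (Fin 1 → ℝ) → ℂ} (hf : ContDiff ℝ ∞ f) : IsSpectralFunction A f := by
  intro h hh ρ
  have e : ρ = ![ρ 0] := by
    ext i
    fin_cases i
    rfl
  rw [e]
  exact (triplePresentationOne hA (ρ 0)).existsUnique hA hsa hh hf

lemma isSpectralFunction_two (hA : IsMultiplicativelyConvex A) (hsa : HasTemperedSelfAdjoints A)
    {f : (Fin 2 → ℝ) → ℂ} (hf : ContDiff ℝ ∞ f) : IsSpectralFunction A f := by
  intro h hh ρ
  have e : ρ = ![ρ 0, ρ 1] := by
    ext i
    fin_cases i <;> rfl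
  rw [e]
  exact (triplePresentationTwo hA (ρ 0) (ρ 1)).existsUnique hA hsa hh hf

end SpectralFunction

/-! ### Duhamel's formula -/

section Duhamel

variable {B : Type*} [NormedRing B] [NormedAlgebra ℂ B]

/-- The derivative of `b ↦ exp (2 π i p b)` in the direction `v`. -/
def duhamel (b v : B) (p : ℝ) : B :=
  ∫ u in Set.Ioc (0 : ℝ) 1, (2 * (Real.pi : ℂ) * Complex.I * (p : ℂ)) •
    (expI b ((1 - u) * p) * v * expI b (u * p))

lemma IsTempered.norm_duhamel_le {b : B} {C : ℝ} {N : ℕ} (hb : IsTempered b C N) (v : B) (p : ℝ) :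
    ‖duhamel b v p‖ ≤ 2 * Real.pi * C ^ 2 * ‖v‖ * (1 + |p|) ^ (2 * N + 1) := by
  have hC := hb.nonneg
  have hu : ∀ u ∈ Set.Icc (0 : ℝ) 1, ‖expI b (u * p)‖ ≤ C * (1 + |p|) ^ N := by
    intro u hu
    have h1 : |u * p| ≤ |p| := by
      rw [abs_mul, abs_of_nonneg hu.1]
      exact mul_le_of_le_one_left (abs_nonneg p) hu.2
    exact (hb _).trans (by gcongr)
  have h := norm_setIntegral_le_of_norm_le_const (μ := volume) (s := Set.Ioc (0 : ℝ) 1)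
    (f := fun u : ℝ => (2 * (Real.pi : ℂ) * Complex.I * (p : ℂ)) •
      (expI b ((1 - u) * p) * v * expI b (u * p)))
    (C := 2 * Real.pi * C ^ 2 * ‖v‖ * (1 + |p|) ^ (2 * N + 1)) (by simp) (fun u h => ?_)
  · simpa [duhamel] using h
  · have h1 := hu u ⟨h.1.le, h.2⟩
    have h2 := hu (1 - u) ⟨by linarith [h.2], by linarith [h.1]⟩
    have h3 : ‖2 * (Real.pi : ℂ) * Complex.I * (p : ℂ)‖ ≤ 2 * Real.pi * (1 + |p|) := by
      have hpi : |Real.pi| = Real.pi := abs_of_pos Real.pi_pos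
      simp only [norm_mul, Complex.norm_ofNat, Complex.norm_real, Real.norm_eq_abs, Complex.norm_I,
        mul_one, hpi]
      gcongr
      linarith
    rw [norm_smul]
    calc _ ≤ (2 * Real.pi * (1 + |p|)) * (‖expI b ((1 - u) * p)‖ * ‖v‖ * ‖expI b (u * p)‖) := by
          gcongr
          exact norm_mul₃_le
      _ ≤ (2 * Real.pi * (1 + |p|)) * ((C * (1 + |p|) ^ N) * ‖v‖ * (C * (1 + |p|) ^ N)) := by
          gcongr
      _ = _ := by ring

variable [CompleteSpace B]

/-- Duhamel's formula: `d/du (exp ((1 - u) x) exp (u y)) = exp ((1 - u) x) (y - x) exp (u y)`,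
integrated over `[0, 1]`. -/
lemma exp_sub_exp (x y : B) : NormedSpace.exp y - NormedSpace.exp x =
    ∫ u in (0 : ℝ)..1, NormedSpace.exp (((1 - u : ℝ) : ℂ) • x) * (y - x) *
      NormedSpace.exp ((u : ℂ) • y) := by
  have hc := continuous_normed_exp (B := B)
  have hd : ∀ u : ℝ, HasDerivAt (fun u : ℝ => NormedSpace.exp (((1 - u : ℝ) : ℂ) • x) *
      NormedSpace.exp ((u : ℂ) • y)) (NormedSpace.exp (((1 - u : ℝ) : ℂ) • x) * (y - x) *
      NormedSpace.exp ((u : ℂ) • y)) u := by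
    intro u
    have e1 : HasDerivAt (fun u : ℝ => NormedSpace.exp (((1 - u : ℝ) : ℂ) • x))
        (-(NormedSpace.exp (((1 - u : ℝ) : ℂ) • x) * x)) u := by
      have h0 : HasDerivAt (fun z : ℂ => NormedSpace.exp (z • x))
        (NormedSpace.exp (((1 - u : ℝ) : ℂ) • x) * x) ((1 - u : ℝ) : ℂ) :=
        hasDerivAt_exp_smul_const x _
      have h1 : HasDerivAt (fun u : ℝ => ((1 - u : ℝ) : ℂ)) (-1) u := by
        have := ((hasDerivAt_id u).const_sub 1).ofReal_comp
        simpa using this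
      exact (h0.scomp u h1).congr_deriv (by rw [neg_smul, one_smul])
    have e2 : HasDerivAt (fun u : ℝ => NormedSpace.exp ((u : ℂ) • y))
        (y * NormedSpace.exp ((u : ℂ) • y)) u :=
      ((hasDerivAt_exp_smul_const' y (u : ℂ)).scomp u
        Complex.ofRealCLM.hasDerivAt).congr_deriv (by simp)
    refine (e1.fun_mul e2).congr_deriv ?_
    simp only [mul_sub, sub_mul, neg_mul, mul_assoc]
    abel
  rw [intervalIntegral.integral_eq_sub_of_hasDerivAt (fun u _ => hd u)
    (Continuous.intervalIntegrable (by fun_prop) _ _)]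
  simp

/-- The derivative of the exponential: divide Duhamel's formula for `exp (x + z v) - exp x` by `z` and
let `z` tend to `0`. -/
lemma fderiv_exp_apply (x v : B) : fderiv ℂ NormedSpace.exp x v =
    ∫ u in (0 : ℝ)..1, NormedSpace.exp (((1 - u : ℝ) : ℂ) • x) * v *
      NormedSpace.exp ((u : ℂ) • x) := by
  have hc := continuous_normed_exp (B := B)
  set G : ℂ → B := fun z => ∫ u in (0 : ℝ)..1, NormedSpace.exp (((1 - u : ℝ) : ℂ) • x) * v *
      NormedSpace.exp ((u : ℂ) • (x + z • v)) with hG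
  have hGc : Continuous G :=
    intervalIntegral.continuous_parametric_intervalIntegral_of_continuous' (by fun_prop) _ _
  have h1 : HasDerivAt (fun z : ℂ => NormedSpace.exp (x + z • v)) (G 0) 0 := by
    rw [hasDerivAt_iff_tendsto_slope]
    refine (hGc.continuousWithinAt.tendsto (s := {0}ᶜ) (x := 0)).congr' ?_
    filter_upwards [self_mem_nhdsWithin] with z hz
    rw [slope_def_module, sub_zero, zero_smul, add_zero, exp_sub_exp, add_sub_cancel_left, hG]
    simp only [mul_smul_comm, smul_mul_assoc]
    rw [intervalIntegral.integral_smul, smul_smul, inv_mul_cancel₀ hz, one_smul]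
  have h2 : HasDerivAt (fun z : ℂ => NormedSpace.exp (x + z • v))
      (fderiv ℂ NormedSpace.exp x v) 0 := by
    have hf : HasFDerivAt (NormedSpace.exp : B → B) (fderiv ℂ NormedSpace.exp x)
        (x + (0 : ℂ) • v) := by
      simpa using (NormedSpace.exp_analytic (𝕂 := ℂ) x).differentiableAt.hasFDerivAt
    have hl : HasDerivAt (fun z : ℂ => x + z • v) v 0 := by
      simpa using ((hasDerivAt_id (0 : ℂ)).smul_const v).const_add x
    exact hf.comp_hasDerivAt 0 hl
  rw [h2.unique h1, hG]
  simp

lemma integrableOn_duhamel (b v : B) (p : ℝ) :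
    IntegrableOn (fun u : ℝ => (2 * (Real.pi : ℂ) * Complex.I * (p : ℂ)) •
      (expI b ((1 - u) * p) * v * expI b (u * p))) (Set.Ioc (0 : ℝ) 1) :=
  Continuous.integrableOn_Ioc (by fun_prop)

lemma hasDerivAt_expI_comp {Y : ℝ → B} {y' : B} {t : ℝ} (hY : HasDerivAt Y y' t) (p : ℝ) :
    HasDerivAt (fun t => expI (Y t) p) (duhamel (Y t) y' p) t := by
  set c : ℂ := 2 * (Real.pi : ℂ) * Complex.I * (p : ℂ) with hc
  have hf : HasFDerivAt (NormedSpace.exp : B → B)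
      ((fderiv ℂ NormedSpace.exp (c • Y t)).restrictScalars ℝ) (c • Y t) :=
    (NormedSpace.exp_analytic (𝕂 := ℂ) (c • Y t)).differentiableAt.hasFDerivAt.restrictScalars ℝ
  refine (hf.comp_hasDerivAt t (hY.const_smul c)).congr_deriv ?_
  rw [ContinuousLinearMap.coe_restrictScalars', fderiv_exp_apply,
    intervalIntegral.integral_of_le zero_le_one, duhamel]
  refine integral_congr_ae (Eventually.of_forall fun u => ?_)
  simp only [expI, mul_smul_comm, smul_mul_assoc, smul_smul, hc]
  congr 4 <;> push_cast <;> ring_nf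

lemma map_duhamel (b v : B) (p : ℝ) (T : B →L[ℂ] ℂ) : T (duhamel b v p) =
    ∫ u in Set.Ioc (0 : ℝ) 1, (2 * (Real.pi : ℂ) * Complex.I * (p : ℂ)) *
      T (expI b ((1 - u) * p) * v * expI b (u * p)) := by
  rw [duhamel, ← T.integral_comp_comm (integrableOn_duhamel b v p)]
  simp only [map_smul, smul_eq_mul]

@[fun_prop]
lemma continuous_duhamel (b v : B) : Continuous (duhamel b v) := by
  have h : duhamel b v = fun p : ℝ => ∫ u : ℝ in (0 : ℝ)..1, (2 * (Real.pi : ℂ) * Complex.I * (p : ℂ)) •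
      (expI b ((1 - u) * p) * v * expI b (u * p)) := by
    funext p
    rw [intervalIntegral.integral_of_le zero_le_one, duhamel]
  rw [h]
  exact intervalIntegral.continuous_parametric_intervalIntegral_of_continuous' (by fun_prop) _ _

lemma map_mul_duhamel_mul (l : B →L[ℂ] ℂ) (x b v y : B) (p : ℝ) : l (x * duhamel b v p * y) =
    ∫ u in Set.Ioc (0 : ℝ) 1, (2 * (Real.pi : ℂ) * Complex.I * (p : ℂ)) *
      l (x * (expI b ((1 - u) * p) * v * expI b (u * p)) * y) :=
  map_duhamel b v p
    (l.comp (((ContinuousLinearMap.mul ℂ B).flip y).comp (ContinuousLinearMap.mul ℂ B x)))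

end Duhamel

/-! ### Finite sums of superpositions -/

section FiniteSum

lemma integral_count_prod {m : ℕ} {Ω : Type*} [TopologicalSpace Ω] [SecondCountableTopology Ω]
    [MeasurableSpace Ω] [BorelSpace Ω] {μ : Measure Ω} [SFinite μ] {E : Type*}
    [NormedAddCommGroup E] [NormedSpace ℝ E] [CompleteSpace E] {f : Fin m → Ω → E}
    (hf : ∀ i, Continuous (f i)) (hint : ∀ i, Integrable (f i) μ) :
    Integrable (fun x : Fin m × Ω => f x.1 x.2) (Measure.count.prod μ) ∧
      ∫ x, f x.1 x.2 ∂(Measure.count.prod μ) = ∑ i, ∫ t, f i t ∂μ := by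
  have hc : Continuous fun x : Fin m × Ω => f x.1 x.2 :=
    continuous_prod_of_discrete_left.2 hf
  have hi : Integrable (fun x : Fin m × Ω => f x.1 x.2) (Measure.count.prod μ) :=
    (integrable_prod_iff hc.aestronglyMeasurable).2
      ⟨Eventually.of_forall hint, Integrable.of_finite⟩
  refine ⟨hi, ?_⟩
  rw [integral_prod _ hi, integral_count]

/-- A finite sum of integrals of triple flows is determined by the sum of the symbols: it is a
single superposition over `Fin m × Ω`. -/
lemma IsTempered.sum_integral_tripleFlow_eq {B : Type*} [NormedRing B] [NormedAlgebra ℂ B]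
    [CompleteSpace B] {b : B} {C : ℝ} {N : ℕ} (hb : IsTempered b C N) {χ : 𝓢(ℝ, ℂ)}
    (hχ : opCalc b χ = 1) (ρ₁ ρ₂ : B) (l : B →L[ℂ] ℂ) {m : ℕ}
    {Ω : Type*} [TopologicalSpace Ω] [SecondCountableTopology Ω] [MeasurableSpace Ω] [BorelSpace Ω]
    {μ : Measure Ω} [SFinite μ] {c : Fin m → Ω → ℂ} {y₀ y₁ y₂ : Fin m → Ω → ℝ}
    (hc : ∀ i, Continuous (c i)) (h₀ : ∀ i, Continuous (y₀ i)) (h₁ : ∀ i, Continuous (y₁ i))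
    (h₂ : ∀ i, Continuous (y₂ i))
    (hint : ∀ i M, Integrable (fun t => ‖c i t‖ *
      ((1 + |y₀ i t|) * ((1 + |y₁ i t|) * (1 + |y₂ i t|))) ^ M) μ)
    {Ω' : Type*} [TopologicalSpace Ω'] [SecondCountableTopology Ω'] [MeasurableSpace Ω']
    [BorelSpace Ω'] {μ' : Measure Ω'} [SFinite μ'] {c' : Ω' → ℂ}
    {y₀' y₁' y₂' : Ω' → ℝ} (hc' : Continuous c') (h₀' : Continuous y₀')
    (h₁' : Continuous y₁') (h₂' : Continuous y₂')
    (hint' : Integrable (fun t => ‖c' t‖ *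
      ((1 + |y₀' t|) * ((1 + |y₁' t|) * (1 + |y₂' t|))) ^ (N + 2)) μ')
    (hsymb : ∀ᵐ x : ℝ × ℝ × ℝ, χ x.1 ≠ 0 → χ x.2.1 ≠ 0 → χ x.2.2 ≠ 0 →
      ∑ i, ∫ t, c i t * character (y₀ i t) (y₁ i t) (y₂ i t) x.1 x.2.1 x.2.2 ∂μ =
        ∫ t, c' t * character (y₀' t) (y₁' t) (y₂' t) x.1 x.2.1 x.2.2 ∂μ') :
    ∑ i, ∫ t, c i t * l (tripleFlow b ρ₁ ρ₂ (y₀ i t) (y₁ i t) (y₂ i t)) ∂μ =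
      ∫ t, c' t * l (tripleFlow b ρ₁ ρ₂ (y₀' t) (y₁' t) (y₂' t)) ∂μ' := by
  have hci : ∀ i, Integrable (c i) μ := fun i => by
    refine (integrable_norm_iff (hc i).aestronglyMeasurable).1 ?_
    simpa using hint i 0
  have m0 : Continuous fun x : Fin m × Ω => y₀ x.1 x.2 := continuous_prod_of_discrete_left.2 h₀
  have m1 : Continuous fun x : Fin m × Ω => y₁ x.1 x.2 := continuous_prod_of_discrete_left.2 h₁
  have m2 : Continuous fun x : Fin m × Ω => y₂ x.1 x.2 := continuous_prod_of_discrete_left.2 h₂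
  have mc : Continuous fun x : Fin m × Ω => c x.1 x.2 := continuous_prod_of_discrete_left.2 hc
  have hcT : ∀ i, Continuous fun t => l (tripleFlow b ρ₁ ρ₂ (y₀ i t) (y₁ i t) (y₂ i t)) := fun i =>
    l.continuous.comp ((continuous_tripleFlow b ρ₁ ρ₂).comp
      ((h₀ i).prodMk ((h₁ i).prodMk (h₂ i))))
  rw [← (integral_count_prod
    (f := fun i t => c i t * l (tripleFlow b ρ₁ ρ₂ (y₀ i t) (y₁ i t) (y₂ i t)))
    (fun i => (hc i).mul (hcT i)) fun i => ?_).2]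
  · refine hb.integral_tripleFlow_congr hχ ρ₁ ρ₂ l mc.aestronglyMeasurable m0.measurable
      m1.measurable m2.measurable (integral_count_prod (fun i => ?_) fun i => hint i (N + 2)).1
      hc'.aestronglyMeasurable h₀'.measurable h₁'.measurable h₂'.measurable hint' ?_
    · have := hc i
      have := h₀ i
      have := h₁ i
      have := h₂ i
      fun_prop
    · filter_upwards [hsymb] with x hx c0 c1 c2
      rw [← hx c0 c1 c2]
      have hch : ∀ i, Continuous fun t => character (y₀ i t) (y₁ i t) (y₂ i t) x.1 x.2.1 x.2.2 :=
        fun i => continuous_character.comp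
          (((h₀ i).prodMk ((h₁ i).prodMk (h₂ i))).prodMk continuous_const)
      refine (integral_count_prod (fun i => (hc i).mul (hch i)) fun i => ?_).2
      refine (hci i).mono ((hc i).mul (hch i)).aestronglyMeasurable
        (Eventually.of_forall fun t => ?_)
      rw [Pi.mul_apply, norm_mul, norm_character, mul_one]
  · have := l.integrable_comp
      (hb.integrable_tripleFlow ρ₁ ρ₂ (hc i) (h₀ i) (h₁ i) (h₂ i) (hint i N))
    simpa only [map_smul, smul_eq_mul] using this

end FiniteSum

/-! ### Differentiation under the integral sign -/

section Variation

variable {B : Type*} [NormedRing B] [NormedAlgebra ℂ B]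
  {Ω : Type*} [TopologicalSpace Ω] [SecondCountableTopology Ω] [MeasurableSpace Ω] [BorelSpace Ω]
  {μ : Measure Ω} {c : Ω → ℂ} {p r : Ω → ℝ}

/-- The derivative at `ε = 0` of `φ (D E(p) D E(r))` along `b + ε α`, `D + ε D'`. -/
def variationIntegrand (φ : B →L[ℂ] ℂ) (b α D D' : B) (p r : ℝ) : ℂ :=
  φ (D' * (expI b p * D * expI b r) + D * ((duhamel b α p * D + expI b p * D') * expI b r +
    expI b p * D * duhamel b α r))

lemma IsTempered.norm_variationIntegrand_le {b : B} {C : ℝ} {N : ℕ} (hb : IsTempered b C N)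
    (φ : B →L[ℂ] ℂ) (α D D' : B) (p r : ℝ) :
    ‖variationIntegrand φ b α D D' p r‖ ≤
      ‖φ‖ * (2 * ‖D‖ * ‖D'‖ * C ^ 2 + 4 * Real.pi * ‖D‖ ^ 2 * C ^ 3 * ‖α‖) *
        ((1 + |p|) * (1 + |r|)) ^ (2 * N + 1) := by
  have hC := hb.nonneg
  have hmono : ∀ x : ℝ, (1 + |x|) ^ N ≤ (1 + |x|) ^ (2 * N + 1) := fun x =>
    pow_le_pow_right₀ (by linarith [abs_nonneg x]) (by omega)
  have e1 : ∀ x, ‖expI b x‖ ≤ C * (1 + |x|) ^ (2 * N + 1) := fun x =>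
    (hb x).trans (mul_le_mul_of_nonneg_left (hmono x) hC)
  have e2 := hb.norm_duhamel_le α
  set P := (1 + |p|) ^ (2 * N + 1)
  set Q := (1 + |r|) ^ (2 * N + 1)
  have hP : 0 ≤ P := by positivity
  have hQ : 0 ≤ Q := by positivity
  rw [mul_pow, mul_assoc ‖φ‖]
  refine (φ.le_opNorm _).trans (mul_le_mul_of_nonneg_left ?_ (norm_nonneg _))
  calc _ ≤ ‖D'‖ * (‖expI b p‖ * ‖D‖ * ‖expI b r‖) + ‖D‖ * ((‖duhamel b α p‖ * ‖D‖ +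
        ‖expI b p‖ * ‖D'‖) * ‖expI b r‖ + ‖expI b p‖ * ‖D‖ * ‖duhamel b α r‖) :=
        (norm_add_le _ _).trans (add_le_add
          ((norm_mul_le _ _).trans (mul_le_mul_of_nonneg_left norm_mul₃_le (norm_nonneg _)))
          ((norm_mul_le _ _).trans (mul_le_mul_of_nonneg_left ((norm_add_le _ _).trans (add_le_add
            ((norm_mul_le _ _).trans (mul_le_mul_of_nonneg_right ((norm_add_le _ _).trans
              (add_le_add (norm_mul_le _ _) (norm_mul_le _ _))) (norm_nonneg _)))
            norm_mul₃_le)) (norm_nonneg _))))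
    _ ≤ ‖D'‖ * ((C * P) * ‖D‖ * (C * Q)) + ‖D‖ * (((2 * Real.pi * C ^ 2 * ‖α‖ * P) * ‖D‖ +
        (C * P) * ‖D'‖) * (C * Q) + (C * P) * ‖D‖ * (2 * Real.pi * C ^ 2 * ‖α‖ * Q)) := by
        gcongr <;> first | exact e1 _ | exact e2 _
    _ = _ := by ring

variable [CompleteSpace B]

lemma hasDerivAt_flow (φ : B →L[ℂ] ℂ) (b α D D' : B) (p r : ℝ) (ε : ℝ) :
    HasDerivAt (fun ε : ℝ => φ ((D + (ε : ℂ) • D') * (expI (b + (ε : ℂ) • α) p *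
      (D + (ε : ℂ) • D') * expI (b + (ε : ℂ) • α) r)))
      (variationIntegrand φ (b + (ε : ℂ) • α) α (D + (ε : ℂ) • D') D' p r) ε := by
  have h : ∀ x v : B, HasDerivAt (fun ε : ℝ => x + (ε : ℂ) • v) v ε := fun x v => by
    simpa using (Complex.ofRealCLM.hasDerivAt (x := ε)).smul_const v |>.const_add x
  have hφ := (φ.restrictScalars ℝ).hasFDerivAt (x := (D + (ε : ℂ) • D') *
    (expI (b + (ε : ℂ) • α) p * (D + (ε : ℂ) • D') * expI (b + (ε : ℂ) • α) r))
  exact hφ.comp_hasDerivAt ε ((h D D').fun_mul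
    (((hasDerivAt_expI_comp (h b α) p).fun_mul (h D D')).fun_mul (hasDerivAt_expI_comp (h b α) r)))

/-- Differentiation under the integral sign. The growth of the exponentials is bounded uniformly for
small `ε`, and the density `c` decays rapidly. -/
lemma hasDerivAt_integral_flow (φ : B →L[ℂ] ℂ) (b α D D' : B) {C : ℝ} {N : ℕ}
    (hb : ∀ᶠ ε : ℝ in 𝓝 0, IsTempered (b + (ε : ℂ) • α) C N)
    (hc : Continuous c) (hp : Continuous p) (hr : Continuous r)
    (hw : ∀ m, Integrable (fun t => ‖c t‖ * ((1 + |p t|) * (1 + |r t|)) ^ m) μ) :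
    HasDerivAt (fun ε : ℝ => ∫ t, c t * φ ((D + (ε : ℂ) • D') * (expI (b + (ε : ℂ) • α) (p t) *
      (D + (ε : ℂ) • D') * expI (b + (ε : ℂ) • α) (r t))) ∂μ)
      (∫ t, c t * variationIntegrand φ b α D D' (p t) (r t) ∂μ) 0 := by
  have hb0 : IsTempered b C N := by simpa using hb.self_of_nhds
  have hC := hb0.nonneg
  obtain ⟨ε₀, hε₀, hball⟩ := Metric.eventually_nhds_iff_ball.1 hb
  have hs : Metric.ball (0 : ℝ) (min ε₀ 1) ∈ 𝓝 (0 : ℝ) :=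
    Metric.ball_mem_nhds _ (lt_min hε₀ one_pos)
  have key := hasDerivAt_integral_of_dominated_loc_of_deriv_le (μ := μ) (𝕜 := ℝ) (x₀ := (0 : ℝ))
    (F := fun ε t => c t * φ ((D + (ε : ℂ) • D') * (expI (b + (ε : ℂ) • α) (p t) *
      (D + (ε : ℂ) • D') * expI (b + (ε : ℂ) • α) (r t))))
    (F' := fun ε t => c t * variationIntegrand φ (b + (ε : ℂ) • α) α (D + (ε : ℂ) • D') D'
      (p t) (r t))
    (bound := fun t => (‖φ‖ * (2 * (‖D‖ + ‖D'‖) * ‖D'‖ * C ^ 2 +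
      4 * Real.pi * (‖D‖ + ‖D'‖) ^ 2 * C ^ 3 * ‖α‖)) *
        (‖c t‖ * ((1 + |p t|) * (1 + |r t|)) ^ (2 * N + 1))) hs
    (Eventually.of_forall fun ε => Continuous.aestronglyMeasurable (by fun_prop)) ?_
    (Continuous.aestronglyMeasurable (by unfold variationIntegrand; fun_prop))
    (Eventually.of_forall fun t ε hε => ?_) ((hw _).const_mul _)
    (Eventually.of_forall fun t ε hε => (hasDerivAt_flow φ b α D D' (p t) (r t) ε).const_mul _)
  · simpa using key.2
  · have h1 := (((ContinuousLinearMap.mul ℂ B D).integrable_comp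
      (hb0.integrable_tripleFlow (y₂ := fun _ => (0 : ℝ)) D 1 hc hp hr continuous_const (by simpa using hw N))))
    have h2 := φ.integrable_comp h1
    simpa [tripleFlow] using h2
  · rw [mem_ball_zero_iff, lt_min_iff] at hε
    have h1 := (hball ε (mem_ball_zero_iff.2 hε.1)).norm_variationIntegrand_le φ α
      (D + (ε : ℂ) • D') D' (p t) (r t)
    have h2 : ‖D + (ε : ℂ) • D'‖ ≤ ‖D‖ + ‖D'‖ := by
      refine (norm_add_le _ _).trans ?_
      rw [norm_smul, Complex.norm_real]
      nlinarith [norm_nonneg D', hε.2]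
    rw [norm_mul]
    calc _ ≤ ‖c t‖ * _ := mul_le_mul_of_nonneg_left h1 (norm_nonneg _)
      _ ≤ ‖c t‖ * (‖φ‖ * (2 * (‖D‖ + ‖D'‖) * ‖D'‖ * C ^ 2 +
          4 * Real.pi * (‖D‖ + ‖D'‖) ^ 2 * C ^ 3 * ‖α‖) *
          ((1 + |p t|) * (1 + |r t|)) ^ (2 * N + 1)) := by gcongr
      _ = _ := by ring

end Variation

/-! ### The variation as a sum of triple flows -/

section Rearrangement

variable {B : Type*} [NormedRing B] [NormedAlgebra ℂ B]

lemma tripleFlow_one_zero (b ρ : B) (p r : ℝ) :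
    tripleFlow b ρ 1 p r 0 = expI b p * ρ * expI b r := by
  simp [tripleFlow]

/-- The coefficients of the six integrals which make up the second-order part of the variation,
as functions of the time `(p, r)`. -/
def sixCoeff (p r : ℝ) : Fin 6 → ℂ :=
  ![2 * Real.pi * Complex.I * p, 2 * Real.pi * Complex.I * r,
    -(2 * Real.pi * Complex.I * r), -(2 * Real.pi * Complex.I * p),
    -(2 * Real.pi * Complex.I * p), -(2 * Real.pi * Complex.I * r)]

/-- The first exponents of the six triple flows. -/
def sixFst (p r u : ℝ) : Fin 6 → ℝ := ![u * p, u * r, (1 - u) * r, r, (1 - u) * p, p]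

/-- The second exponents of the six triple flows. -/
def sixSnd (p r u : ℝ) : Fin 6 → ℝ := ![r, p, u * r, (1 - u) * p, u * p, (1 - u) * r]

/-- The third exponents of the six triple flows. -/
def sixTrd (p r u : ℝ) : Fin 6 → ℝ := ![(1 - u) * p, (1 - u) * r, p, u * p, r, u * r]

variable [CompleteSpace B]

/-- The variation of `φ (D E(p) D E(r))`, with `α` moved to the front by means of the trace property
and of an integration by parts. -/
lemma variationIntegrand_eq {φ : B →L[ℂ] ℂ} (htr : ∀ x y, φ (x * y) = φ (y * x)) {b α D D' D₂ : B}
    (hibp : ∀ p r : ℝ, φ (D' * (expI b p * D * expI b r)) =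
      -φ (α * (duhamel b D p * (D * expI b r) + expI b p * D₂ * expI b r +
        expI b p * D * duhamel b D r))) (p r : ℝ) :
    variationIntegrand φ b α D D' p r =
      -φ (α * tripleFlow b D₂ 1 p r 0) - φ (α * tripleFlow b D₂ 1 r p 0) +
        ∑ i, ∫ u in Set.Ioc (0 : ℝ) 1, sixCoeff p r i *
          φ (α * tripleFlow b D D (sixFst p r u i) (sixSnd p r u i) (sixTrd p r u i)) := by
  -- an exponential varies in the direction `α`
  have hα : ∀ p r : ℝ, φ (D * duhamel b α p * (D * expI b r)) =
      ∫ u in Set.Ioc (0 : ℝ) 1, (2 * (Real.pi : ℂ) * Complex.I * (p : ℂ)) *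
        φ (α * tripleFlow b D D (u * p) r ((1 - u) * p)) := by
    intro p r
    rw [map_mul_duhamel_mul]
    refine integral_congr_ae (Eventually.of_forall fun u => ?_)
    simp only
    rw [show D * (expI b ((1 - u) * p) * α * expI b (u * p)) * (D * expI b r) =
      (D * expI b ((1 - u) * p)) * (α * expI b (u * p) * (D * expI b r)) by simp only [mul_assoc],
      htr]
    simp only [tripleFlow, mul_assoc]
  -- the exponentials vary under the derivation
  have hD : ∀ p r : ℝ, φ (α * (duhamel b D p * (D * expI b r))) =
      ∫ u in Set.Ioc (0 : ℝ) 1, (2 * (Real.pi : ℂ) * Complex.I * (p : ℂ)) *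
        φ (α * tripleFlow b D D ((1 - u) * p) (u * p) r) := by
    intro p r
    rw [← mul_assoc, map_mul_duhamel_mul]
    simp only [tripleFlow, mul_assoc]
  have hD' : ∀ p r : ℝ, φ (α * (expI b p * D * duhamel b D r)) =
      ∫ u in Set.Ioc (0 : ℝ) 1, (2 * (Real.pi : ℂ) * Complex.I * (r : ℂ)) *
        φ (α * tripleFlow b D D p ((1 - u) * r) (u * r)) := by
    intro p r
    rw [← mul_assoc, ← mul_one (α * (expI b p * D) * duhamel b D r), map_mul_duhamel_mul]
    simp only [tripleFlow, mul_assoc, mul_one]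
  have e1 : φ (D * (duhamel b α p * D * expI b r)) = φ (D * duhamel b α p * (D * expI b r)) := by
    simp only [mul_assoc]
  have e2 : φ (D * (expI b p * D' * expI b r)) = φ (D' * (expI b r * D * expI b p)) := by
    rw [show D * (expI b p * D' * expI b r) = (D * expI b p) * (D' * expI b r) by
      simp only [mul_assoc], htr]
    simp only [mul_assoc]
  have e3 : φ (D * (expI b p * D * duhamel b α r)) = φ (D * duhamel b α r * (D * expI b p)) := by
    rw [show D * (expI b p * D * duhamel b α r) = (D * expI b p) * (D * duhamel b α r) by
      simp only [mul_assoc], htr]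
  -- the terms with `D'` are `hibp p r` and, after a rotation under the trace, `hibp r p`
  rw [variationIntegrand, add_mul, mul_add D, mul_add D, map_add, map_add, map_add, hibp p r, e1,
    e2, hibp r p, e3]
  simp only [mul_add, map_add, hα, hD, hD', tripleFlow_one_zero]
  simp only [Fin.sum_univ_six, sixCoeff, sixFst, sixSnd, sixTrd]
  simp only [Matrix.cons_val, neg_mul, integral_neg]
  ring

end Rearrangement

/-! ### The symbol of the variation -/

section Symbols

/-- The integral of an exponential over the segment from `b` to `a` is its divided difference. -/
lemma setIntegral_exp_segment (p e : ℝ) {a b : ℝ} (hab : a ≠ b) :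
    ∫ u in Set.Ioc (0 : ℝ) 1, (2 * (Real.pi : ℂ) * Complex.I * (p : ℂ)) *
      Complex.exp (2 * Real.pi * Complex.I * ((p * (u * a + (1 - u) * b) + e : ℝ) : ℂ)) =
    (Complex.exp (2 * Real.pi * Complex.I * ((p * a + e : ℝ) : ℂ)) -
      Complex.exp (2 * Real.pi * Complex.I * ((p * b + e : ℝ) : ℂ))) / ((a - b : ℝ) : ℂ) := by
  have hab' : ((a - b : ℝ) : ℂ) ≠ 0 := by exact_mod_cast sub_ne_zero.2 hab
  rw [eq_div_iff hab', ← integral_mul_const,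
    ← intervalIntegral.integral_of_le zero_le_one]
  have hd : ∀ u : ℝ, HasDerivAt (fun u : ℝ => Complex.exp (2 * Real.pi * Complex.I *
      ((p * (u * a + (1 - u) * b) + e : ℝ) : ℂ))) ((2 * (Real.pi : ℂ) * Complex.I * (p : ℂ)) *
      Complex.exp (2 * Real.pi * Complex.I * ((p * (u * a + (1 - u) * b) + e : ℝ) : ℂ)) *
      ((a - b : ℝ) : ℂ)) u := by
    intro u
    have h1 : HasDerivAt (fun u : ℝ => p * (u * a + (1 - u) * b) + e) (p * (a - b)) u := by
      have := ((((hasDerivAt_id u).mul_const a).add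
        (((hasDerivAt_id u).const_sub 1).mul_const b)).const_mul p).add_const e
      refine this.congr_deriv ?_
      ring
    refine ((h1.ofReal_comp.const_mul (2 * Real.pi * Complex.I)).cexp).congr_deriv ?_
    push_cast
    ring
  rw [intervalIntegral.integral_eq_sub_of_hasDerivAt (fun u _ => hd u)
    (Continuous.intervalIntegrable (by fun_prop) _ _)]
  simp

variable {Ω : Type*} [MeasurableSpace Ω] {μ : Measure Ω} {c : Ω → ℂ} {p r : Ω → ℝ}

/-- The symbol `θ(a, d) = ∫ c exp (2 π i (p a + r d))`. -/
def pairSymbol (μ : Measure Ω) (c : Ω → ℂ) (p r : Ω → ℝ) (a d : ℝ) : ℂ :=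
  ∫ t, c t * Complex.exp (2 * Real.pi * Complex.I * ((p t * a + r t * d : ℝ) : ℂ)) ∂μ

lemma pairSymbol_swap (a d : ℝ) : pairSymbol μ c r p d a = pairSymbol μ c p r a d := by
  simp only [pairSymbol, add_comm]

lemma norm_exp_two_pi_I (x : ℝ) : ‖Complex.exp (2 * Real.pi * Complex.I * (x : ℂ))‖ = 1 := by
  rw [Complex.norm_exp]
  simp

variable [TopologicalSpace Ω] [BorelSpace Ω] [SFinite μ]

/-- Duhamel's formula on the level of symbols: it turns a symbol into its divided difference. -/
lemma integral_segment_symbol (hc : Continuous c) (hp : Continuous p) (hr : Continuous r)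
    (hcp : Integrable (fun t => ‖c t‖ * (1 + |p t|)) μ) {a b : ℝ} (hab : a ≠ b) (d : ℝ) :
    ∫ x, (c x.1 * (2 * (Real.pi : ℂ) * Complex.I * (p x.1 : ℂ))) *
      Complex.exp (2 * Real.pi * Complex.I *
        ((p x.1 * (x.2 * a + (1 - x.2) * b) + r x.1 * d : ℝ) : ℂ))
      ∂(μ.prod (volume.restrict (Set.Ioc (0 : ℝ) 1))) =
    (pairSymbol μ c p r a d - pairSymbol μ c p r b d) / ((a - b : ℝ) : ℂ) := by
  have hci : Integrable c μ := by
    refine hcp.mono hc.aestronglyMeasurable (Eventually.of_forall fun t => ?_)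
    rw [Real.norm_of_nonneg (by positivity)]
    nlinarith [norm_nonneg (c t), abs_nonneg (p t)]
  have hi : Integrable (fun x : Ω × ℝ => (c x.1 * (2 * (Real.pi : ℂ) * Complex.I * (p x.1 : ℂ))) *
      Complex.exp (2 * Real.pi * Complex.I *
        ((p x.1 * (x.2 * a + (1 - x.2) * b) + r x.1 * d : ℝ) : ℂ)))
      (μ.prod (volume.restrict (Set.Ioc (0 : ℝ) 1))) := by
    have h1 : Integrable (fun x : Ω × ℝ => 2 * Real.pi * (‖c x.1‖ * (1 + |p x.1|)))
        (μ.prod (volume.restrict (Set.Ioc (0 : ℝ) 1))) :=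
      (hcp.comp_fst _).const_mul _
    refine h1.mono' (Continuous.aestronglyMeasurable (by fun_prop))
      (Eventually.of_forall fun x => ?_)
    have hpi : |Real.pi| = Real.pi := abs_of_pos Real.pi_pos
    rw [norm_mul, norm_exp_two_pi_I, mul_one]
    simp only [norm_mul, Complex.norm_ofNat, Complex.norm_real, Real.norm_eq_abs, Complex.norm_I,
      mul_one, hpi]
    nlinarith [mul_nonneg Real.pi_pos.le (norm_nonneg (c x.1))]
  have he : ∀ a, Integrable (fun t => c t *
      Complex.exp (2 * Real.pi * Complex.I * ((p t * a + r t * d : ℝ) : ℂ))) μ := fun a => by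
    refine hci.mono (Continuous.aestronglyMeasurable (by fun_prop)) (Eventually.of_forall fun t => ?_)
    rw [norm_mul, norm_exp_two_pi_I, mul_one]
  rw [integral_prod _ hi, pairSymbol, pairSymbol, ← integral_sub (he a) (he b), ← integral_div]
  refine integral_congr_ae (Eventually.of_forall fun t => ?_)
  simp only [mul_assoc (c t)]
  rw [integral_const_mul, setIntegral_exp_segment _ _ hab]
  ring

/-- The symbol of the second-order part of the variation, at a point with distinct coordinates: an
alternating sum of divided differences of the symmetrized symbol `θ(a, d) + θ(d, a)`. -/
lemma sum_six_symbol (hc : Continuous c) (hp : Continuous p) (hr : Continuous r)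
    (hcp : Integrable (fun t => ‖c t‖ * (1 + |p t|)) μ)
    (hcr : Integrable (fun t => ‖c t‖ * (1 + |r t|)) μ) {x₀ x₁ x₂ : ℝ} (h₀₁ : x₁ ≠ x₀)
    (h₁₂ : x₂ ≠ x₁) (h₀₂ : x₀ ≠ x₂) :
    ∑ i, ∫ x, (c x.1 * sixCoeff (p x.1) (r x.1) i) * character (sixFst (p x.1) (r x.1) x.2 i)
      (sixSnd (p x.1) (r x.1) x.2 i) (sixTrd (p x.1) (r x.1) x.2 i) x₀ x₁ x₂
      ∂(μ.prod (volume.restrict (Set.Ioc (0 : ℝ) 1))) =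
    ((pairSymbol μ c p r x₀ x₁ + pairSymbol μ c p r x₁ x₀) -
      (pairSymbol μ c p r x₁ x₂ + pairSymbol μ c p r x₂ x₁)) / ((x₀ - x₂ : ℝ) : ℂ) -
    ((pairSymbol μ c p r x₁ x₂ + pairSymbol μ c p r x₂ x₁) -
      (pairSymbol μ c p r x₀ x₂ + pairSymbol μ c p r x₂ x₀)) / ((x₁ - x₀ : ℝ) : ℂ) -
    ((pairSymbol μ c p r x₀ x₂ + pairSymbol μ c p r x₂ x₀) -
      (pairSymbol μ c p r x₀ x₁ + pairSymbol μ c p r x₁ x₀)) / ((x₂ - x₁ : ℝ) : ℂ) := by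
  have P := fun {a b : ℝ} (hab : a ≠ b) d => integral_segment_symbol hc hp hr hcp hab d
  have Q := fun {a b : ℝ} (hab : a ≠ b) d => integral_segment_symbol hc hr hp hcr hab d
  simp only [pairSymbol_swap] at Q
  have t0 := P h₀₂ x₁
  have t1 := Q h₀₂ x₁
  have t2 := Q h₀₁ x₂
  have t3 := P h₁₂ x₀
  have t4 := P h₀₁ x₂
  have t5 := Q h₁₂ x₀
  simp only [Fin.sum_univ_six, sixCoeff, sixFst, sixSnd, sixTrd, Matrix.cons_val, character,
    mul_neg, neg_mul, integral_neg]
  refine (congrArg₂ (· + ·) (congrArg₂ (· + ·) (congrArg₂ (· + ·) (congrArg₂ (· + ·)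
    (congrArg₂ (· + ·) (Eq.trans ?_ t0) (Eq.trans ?_ t1)) (congrArg Neg.neg (Eq.trans ?_ t2)))
    (congrArg Neg.neg (Eq.trans ?_ t3))) (congrArg Neg.neg (Eq.trans ?_ t4)))
    (congrArg Neg.neg (Eq.trans ?_ t5))).trans (by ring)
  all_goals
    refine integral_congr_ae (Eventually.of_forall fun x => ?_)
    simp only
    congr 4
    ring

end Symbols

/-! ### Integration of the variation -/

section VariationIntegral

variable {Ω : Type*} [TopologicalSpace Ω] {c : Ω → ℂ} {p r : Ω → ℝ}

/-- The six triple flows have polynomial weights in `(p, r)`, uniformly in `u`. -/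
lemma six_weight_le (p r : ℝ) {u : ℝ} (hu : u ∈ Set.Ioc (0 : ℝ) 1) (i : Fin 6) (M : ℕ) :
    ‖sixCoeff p r i‖ * ((1 + |sixFst p r u i|) * ((1 + |sixSnd p r u i|) *
      (1 + |sixTrd p r u i|))) ^ M ≤ 2 * Real.pi * ((1 + |p|) * (1 + |r|)) ^ (3 * M + 1) := by
  have h1 : ∀ x : ℝ, |u * x| ≤ |x| := fun x => by
    rw [abs_mul, abs_of_pos hu.1]
    exact mul_le_of_le_one_left (abs_nonneg x) hu.2
  have h2 : ∀ x : ℝ, |(1 - u) * x| ≤ |x| := fun x => by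
    rw [abs_mul, abs_of_nonneg (sub_nonneg.2 hu.2)]
    exact mul_le_of_le_one_left (abs_nonneg x) (by linarith [hu.1])
  have hp : |p| ≤ (1 + |p|) * (1 + |r|) - 1 := by
    nlinarith [abs_nonneg p, abs_nonneg r, mul_nonneg (abs_nonneg p) (abs_nonneg r)]
  have hr : |r| ≤ (1 + |p|) * (1 + |r|) - 1 := by
    nlinarith [abs_nonneg p, abs_nonneg r, mul_nonneg (abs_nonneg p) (abs_nonneg r)]
  set w := (1 + |p|) * (1 + |r|) with hw
  have hw0 : 0 ≤ w := by positivity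
  have a0 : 1 + |sixFst p r u i| ≤ w := by
    fin_cases i <;> simp only [sixFst, Fin.reduceFinMk, Matrix.cons_val] <;>
      linarith [h1 p, h1 r, h2 p, h2 r]
  have a1 : 1 + |sixSnd p r u i| ≤ w := by
    fin_cases i <;> simp only [sixSnd, Fin.reduceFinMk, Matrix.cons_val] <;>
      linarith [h1 p, h1 r, h2 p, h2 r]
  have a2 : 1 + |sixTrd p r u i| ≤ w := by
    fin_cases i <;> simp only [sixTrd, Fin.reduceFinMk, Matrix.cons_val] <;>
      linarith [h1 p, h1 r, h2 p, h2 r]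
  have hpi : |Real.pi| = Real.pi := abs_of_pos Real.pi_pos
  have ac : ‖sixCoeff p r i‖ ≤ 2 * Real.pi * w := by
    fin_cases i <;> simp [sixCoeff, hpi] <;> gcongr <;> linarith
  calc _ ≤ (2 * Real.pi * w) * (w * (w * w)) ^ M := by gcongr
    _ = _ := by ring_nf

lemma continuous_sixCoeff (hp : Continuous p) (hr : Continuous r) (i : Fin 6) :
    Continuous fun x : Ω × ℝ => sixCoeff (p x.1) (r x.1) i := by
  fin_cases i <;> simp only [sixCoeff, Fin.reduceFinMk, Matrix.cons_val] <;> fun_prop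

lemma continuous_sixFst (hp : Continuous p) (hr : Continuous r) (i : Fin 6) :
    Continuous fun x : Ω × ℝ => sixFst (p x.1) (r x.1) x.2 i := by
  fin_cases i <;> simp only [sixFst, Fin.reduceFinMk, Matrix.cons_val] <;> fun_prop

lemma continuous_sixSnd (hp : Continuous p) (hr : Continuous r) (i : Fin 6) :
    Continuous fun x : Ω × ℝ => sixSnd (p x.1) (r x.1) x.2 i := by
  fin_cases i <;> simp only [sixSnd, Fin.reduceFinMk, Matrix.cons_val] <;> fun_prop

lemma continuous_sixTrd (hp : Continuous p) (hr : Continuous r) (i : Fin 6) :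
    Continuous fun x : Ω × ℝ => sixTrd (p x.1) (r x.1) x.2 i := by
  fin_cases i <;> simp only [sixTrd, Fin.reduceFinMk, Matrix.cons_val] <;> fun_prop

variable [MeasurableSpace Ω] [BorelSpace Ω] {μ : Measure Ω}

lemma integrable_six_weight (hc : Continuous c) (hp : Continuous p) (hr : Continuous r)
    (hw : ∀ m, Integrable (fun t => ‖c t‖ * ((1 + |p t|) * (1 + |r t|)) ^ m) μ)
    (i : Fin 6) (M : ℕ) :
    Integrable (fun x : Ω × ℝ => ‖c x.1 * sixCoeff (p x.1) (r x.1) i‖ *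
      ((1 + |sixFst (p x.1) (r x.1) x.2 i|) * ((1 + |sixSnd (p x.1) (r x.1) x.2 i|) *
        (1 + |sixTrd (p x.1) (r x.1) x.2 i|))) ^ M)
      (μ.prod (volume.restrict (Set.Ioc (0 : ℝ) 1))) := by
  have h1 := ((hw (3 * M + 1)).comp_fst (volume.restrict (Set.Ioc (0 : ℝ) 1))).const_mul
    (2 * Real.pi)
  refine h1.mono' ?_ ?_
  · have e0 := continuous_sixCoeff hp hr i
    have e1 := continuous_sixFst hp hr i
    have e2 := continuous_sixSnd hp hr i
    have e3 := continuous_sixTrd hp hr i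
    exact Continuous.aestronglyMeasurable (by fun_prop)
  · have hmem : ∀ᵐ x : Ω × ℝ ∂(μ.prod (volume.restrict (Set.Ioc (0 : ℝ) 1))),
        x.2 ∈ Set.Ioc (0 : ℝ) 1 :=
      Measure.quasiMeasurePreserving_snd.ae (ae_restrict_mem measurableSet_Ioc)
    filter_upwards [hmem] with x hx
    rw [Real.norm_of_nonneg (by positivity), norm_mul, mul_assoc]
    calc _ ≤ ‖c x.1‖ * _ :=
          mul_le_mul_of_nonneg_left (six_weight_le (p x.1) (r x.1) hx i M) (norm_nonneg _)
      _ = _ := by ring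

variable [SecondCountableTopology Ω] [SFinite μ] {B : Type*} [NormedRing B] [NormedAlgebra ℂ B]
  [CompleteSpace B]

/-- The variation, written as a sum of integrals of triple flows: two of first and six of second
order. -/
lemma integral_variationIntegrand {φ : B →L[ℂ] ℂ} (htr : ∀ x y, φ (x * y) = φ (y * x))
    {b α D D' D₂ : B}
    (hibp : ∀ p r : ℝ, φ (D' * (expI b p * D * expI b r)) =
      -φ (α * (duhamel b D p * (D * expI b r) + expI b p * D₂ * expI b r +
        expI b p * D * duhamel b D r)))
    {C : ℝ} {N : ℕ} (hb : IsTempered b C N) (hc : Continuous c) (hp : Continuous p)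
    (hr : Continuous r)
    (hw : ∀ m, Integrable (fun t => ‖c t‖ * ((1 + |p t|) * (1 + |r t|)) ^ m) μ) :
    ∫ t, c t * variationIntegrand φ b α D D' (p t) (r t) ∂μ =
      ∑ i, ∫ t, -c t * φ (α * tripleFlow b D₂ 1 ((![p, r] : Fin 2 → Ω → ℝ) i t)
        ((![r, p] : Fin 2 → Ω → ℝ) i t) 0) ∂μ +
      ∑ i, ∫ x, c x.1 * sixCoeff (p x.1) (r x.1) i * φ (α * tripleFlow b D D
        (sixFst (p x.1) (r x.1) x.2 i) (sixSnd (p x.1) (r x.1) x.2 i)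
        (sixTrd (p x.1) (r x.1) x.2 i)) ∂(μ.prod (volume.restrict (Set.Ioc (0 : ℝ) 1))) := by
  let l : B →L[ℂ] ℂ := φ.comp (ContinuousLinearMap.mul ℂ B α)
  have i1 : Integrable (fun t => c t * φ (α * tripleFlow b D₂ 1 (p t) (r t) 0)) μ := by
    have := l.integrable_comp (hb.integrable_tripleFlow (y₂ := fun _ => (0 : ℝ)) D₂ 1 hc hp hr
      continuous_const (by simpa using hw N))
    exact this.congr (Eventually.of_forall fun _ => map_smul l _ _)
  have i2 : Integrable (fun t => c t * φ (α * tripleFlow b D₂ 1 (r t) (p t) 0)) μ := by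
    have := l.integrable_comp (hb.integrable_tripleFlow (y₂ := fun _ => (0 : ℝ)) D₂ 1 hc hr hp
      continuous_const (by simpa [mul_comm (1 + |r _|)] using hw N))
    exact this.congr (Eventually.of_forall fun _ => map_smul l _ _)
  have i3 : ∀ i, Integrable (fun x : Ω × ℝ => c x.1 * sixCoeff (p x.1) (r x.1) i * φ (α *
      tripleFlow b D D (sixFst (p x.1) (r x.1) x.2 i) (sixSnd (p x.1) (r x.1) x.2 i)
      (sixTrd (p x.1) (r x.1) x.2 i))) (μ.prod (volume.restrict (Set.Ioc (0 : ℝ) 1))) := by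
    intro i
    have := l.integrable_comp (hb.integrable_tripleFlow D D
      ((hc.comp continuous_fst).mul (continuous_sixCoeff hp hr i)) (continuous_sixFst hp hr i)
      (continuous_sixSnd hp hr i) (continuous_sixTrd hp hr i)
      (integrable_six_weight hc hp hr hw i N))
    exact this.congr (Eventually.of_forall fun _ => map_smul l _ _)
  have e : ∀ t, c t * variationIntegrand φ b α D D' (p t) (r t) =
      (-(c t * φ (α * tripleFlow b D₂ 1 (p t) (r t) 0)) +
        -(c t * φ (α * tripleFlow b D₂ 1 (r t) (p t) 0))) +
      ∑ i, ∫ u in Set.Ioc (0 : ℝ) 1, c t * sixCoeff (p t) (r t) i * φ (α * tripleFlow b D D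
        (sixFst (p t) (r t) u i) (sixSnd (p t) (r t) u i) (sixTrd (p t) (r t) u i)) := by
    intro t
    rw [variationIntegrand_eq htr hibp]
    simp only [mul_assoc (c t), integral_const_mul]
    rw [← Finset.mul_sum]
    ring
  have s1 : Integrable (fun t => -(c t * φ (α * tripleFlow b D₂ 1 (p t) (r t) 0))) μ := i1.neg
  have s2 : Integrable (fun t => -(c t * φ (α * tripleFlow b D₂ 1 (r t) (p t) 0))) μ := i2.neg
  have s3 : ∀ i, Integrable (fun t => ∫ u in Set.Ioc (0 : ℝ) 1, c t * sixCoeff (p t) (r t) i *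
      φ (α * tripleFlow b D D (sixFst (p t) (r t) u i) (sixSnd (p t) (r t) u i)
        (sixTrd (p t) (r t) u i))) μ := fun i => (i3 i).integral_prod_left
  have s₁₂ : Integrable (fun t => -(c t * φ (α * tripleFlow b D₂ 1 (p t) (r t) 0)) +
      -(c t * φ (α * tripleFlow b D₂ 1 (r t) (p t) 0))) μ := s1.add s2
  simp only [e]
  rw [integral_add s₁₂ (integrable_finsetSum _ fun i _ => s3 i),
    integral_finsetSum _ fun i _ => s3 i, integral_add s1 s2]
  congr 1
  · simp [Fin.sum_univ_two]
  · refine Finset.sum_congr rfl fun i _ => ?_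
    rw [integral_prod _ (i3 i)]

end VariationIntegral

/-! ### Divided differences and cyclic permutations -/

section SymbolIdentities

lemma cyc_one (y : ℝ) : cyc ![y] = ![-y] := by
  ext i
  fin_cases i
  simp [cyc]

lemma cyc_two (y z : ℝ) : cyc ![y, z] = ![-(y + z), y] := by
  ext i
  fin_cases i
  · simp [cyc]
  · rfl

/-- `θ(a, b) = exp (j a) f(b - a)`, the symbol of `exp (j h) f(𝐱)`. -/
def twistedSymbol (j : ℝ) (f : (Fin 1 → ℝ) → ℂ) (a b : ℝ) : ℂ :=
  Complex.exp ((j : ℂ) * (a : ℂ)) * f ![b - a]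

/-- The symbol of `exp (j h) K(𝐱)` is, up to sign, the symmetrization of that of
`exp (j h) f(𝐱)`. -/
lemma twistedSymbol_spectralK (j : ℝ) (f : (Fin 1 → ℝ) → ℂ) (a b : ℝ) :
    twistedSymbol j (spectralK j f) a b = -(twistedSymbol j f a b + twistedSymbol j f b a) := by
  simp only [twistedSymbol, spectralK, Pi.neg_apply, Pi.add_apply, tau, cyc_one,
    Matrix.cons_val_zero, neg_sub]
  rw [mul_neg, mul_add, ← mul_assoc, ← Complex.exp_add]
  congr 4
  push_cast
  ring_nf

lemma triangle_of_ne (K : (Fin 1 → ℝ) → ℂ) {y z : ℝ} (hz : z ≠ 0) :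
    triangle K ![y, z] = (K ![y + z] - K ![y]) / (z : ℂ) := by
  have h : y + z ≠ y := by simpa using hz
  simp only [triangle, Matrix.cons_val_zero, Matrix.cons_val_one]
  rw [dslope_of_ne _ h, slope_def_module, add_sub_cancel_left, Complex.real_smul, Complex.ofReal_inv,
    inv_mul_eq_div]

/-- On triples, `cyc` is the rotation of `(λ₀, λ₁, λ₂)`, so that the symbol of
`exp (j h) H(𝐱₁, 𝐱₂)` is the alternating sum of the three rotated divided differences. -/
lemma exp_mul_connesMoscovici (j : ℝ) (K : (Fin 1 → ℝ) → ℂ) {x₀ x₁ x₂ : ℝ} (h₀₁ : x₁ ≠ x₀)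
    (h₁₂ : x₂ ≠ x₁) (h₀₂ : x₀ ≠ x₂) :
    Complex.exp ((j : ℂ) * (x₀ : ℂ)) * connesMoscovici j K ![x₁ - x₀, x₂ - x₁] =
      (twistedSymbol j K x₀ x₂ - twistedSymbol j K x₀ x₁) / ((x₂ - x₁ : ℝ) : ℂ) +
      (twistedSymbol j K x₂ x₁ - twistedSymbol j K x₂ x₀) / ((x₁ - x₀ : ℝ) : ℂ) -
      (twistedSymbol j K x₁ x₀ - twistedSymbol j K x₁ x₂) / ((x₀ - x₂ : ℝ) : ℂ) := by
  have c1 : cyc ![x₁ - x₀, x₂ - x₁] = ![x₀ - x₂, x₁ - x₀] := by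
    rw [cyc_two, show -(x₁ - x₀ + (x₂ - x₁)) = x₀ - x₂ by ring]
  have c2 : cyc ![x₀ - x₂, x₁ - x₀] = ![x₂ - x₁, x₀ - x₂] := by
    rw [cyc_two, show -(x₀ - x₂ + (x₁ - x₀)) = x₂ - x₁ by ring]
  have E1 : Complex.exp ((j : ℂ) * (x₀ : ℂ)) * Complex.exp (-(j : ℂ) * ((x₀ - x₂ : ℝ) : ℂ)) =
      Complex.exp ((j : ℂ) * (x₂ : ℂ)) := by
    rw [← Complex.exp_add]
    congr 1
    push_cast
    ring
  have E2 : Complex.exp ((j : ℂ) * (x₂ : ℂ)) * Complex.exp (-(j : ℂ) * ((x₂ - x₁ : ℝ) : ℂ)) =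
      Complex.exp ((j : ℂ) * (x₁ : ℂ)) := by
    rw [← Complex.exp_add]
    congr 1
    push_cast
    ring
  simp only [connesMoscovici, Pi.sub_apply, Pi.add_apply, tau, c1, c2, Matrix.cons_val_zero]
  rw [mul_sub, mul_add, ← mul_assoc, ← mul_assoc, ← mul_assoc, E1, E2,
    triangle_of_ne K (sub_ne_zero.2 h₁₂), triangle_of_ne K (sub_ne_zero.2 h₀₁),
    triangle_of_ne K (sub_ne_zero.2 h₀₂)]
  simp only [twistedSymbol, sub_add_sub_cancel', mul_div_assoc', mul_sub]

end SymbolIdentities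

/-! ### Fourier integrals for `exp (j h) f(𝐱)` -/

section ExpMul

variable {A : Type*} [Ring A] [Algebra ℂ A] [UniformSpace A] [IsTopologicalRing A]
  {n : ℕ} {ρ : Fin n → A}

namespace TriplePresentation

/-- The first exponent of the triple flow which presents `exp (j h) f(𝐱)(ρ)`: the time of the
group which integrates to `exp (j h)` is added. -/
def shifted (P : TriplePresentation ρ) (x : EuclideanSpace ℝ (Fin n) × ℝ) : ℝ :=
  x.2 + P.exponent 0 x.1

lemma continuous_shifted (P : TriplePresentation ρ) : Continuous P.shifted := by
  unfold shifted
  fun_prop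

lemma integrable_shifted_weight (P : TriplePresentation ρ)
    (g : 𝓢(EuclideanSpace ℝ (Fin n), ℂ)) (k : 𝓢(ℝ, ℂ)) (M : ℕ) :
    Integrable fun x : EuclideanSpace ℝ (Fin n) × ℝ => ‖(𝓕 g) x.1 * (𝓕 k) x.2‖ *
      ((1 + |P.shifted x|) * ((1 + |P.exponent 1 x.1|) * (1 + |P.exponent 2 x.1|))) ^ M := by
  have hg := (𝓕 g).continuous
  have hk := (𝓕 k).continuous
  have hs := P.continuous_shifted
  refine ((P.integrable_weight g M).mul_prod (integrable_schwartz_mul_pow volume (𝓕 k) M)).mono'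
    (Continuous.aestronglyMeasurable (by fun_prop)) (Eventually.of_forall fun x => ?_)
  have h1 : 1 + |P.shifted x| ≤ (1 + |P.exponent 0 x.1|) * (1 + ‖x.2‖) := by
    have := abs_add_le x.2 (P.exponent 0 x.1)
    rw [shifted, Real.norm_eq_abs]
    nlinarith [mul_nonneg (abs_nonneg x.2) (abs_nonneg (P.exponent 0 x.1))]
  rw [Real.norm_of_nonneg (by positivity), norm_mul]
  calc _ ≤ ‖(𝓕 g) x.1‖ * ‖(𝓕 k) x.2‖ * (((1 + |P.exponent 0 x.1|) * (1 + ‖x.2‖)) *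
        ((1 + |P.exponent 1 x.1|) * (1 + |P.exponent 2 x.1|))) ^ M := by gcongr
    _ = ‖(𝓕 g) x.1‖ * ‖(𝓕 k) x.2‖ * (((1 + |P.exponent 0 x.1|) *
        ((1 + |P.exponent 1 x.1|) * (1 + |P.exponent 2 x.1|))) * (1 + ‖x.2‖)) ^ M := by
        congr 2
        ring
    _ = _ := by
        rw [mul_pow _ (1 + ‖x.2‖)]
        ring

/-- The symbol of the Fourier integral for `k(h) g(𝐱)` is `k(λ₀) g(pt λ)`. -/
lemma integral_shifted_character (P : TriplePresentation ρ)
    (g : 𝓢(EuclideanSpace ℝ (Fin n), ℂ)) (k : 𝓢(ℝ, ℂ)) (x : ℝ × ℝ × ℝ) :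
    ∫ y : EuclideanSpace ℝ (Fin n) × ℝ, (𝓕 g) y.1 * (𝓕 k) y.2 *
      character (P.shifted y) (P.exponent 1 y.1) (P.exponent 2 y.1) x.1 x.2.1 x.2.2 =
      k x.1 * g (P.pt x) := by
  rw [← integral_fourier_mul_exp k, ← P.integral_fourier_mul_character, mul_comm,
    ← integral_prod_mul]
  refine integral_congr_ae (Eventually.of_forall fun y => ?_)
  simp only [character, shifted]
  rw [mul_mul_mul_comm, ← Complex.exp_add]
  congr 2
  push_cast
  ring_nf

/-- The product of `k(h)` and of a value of the functional calculus as an integral of triple flows: the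
group which integrates to `k(h)` is absorbed into the first exponential. -/
lemma eval_exp_mul (P : TriplePresentation ρ) {h v : A} {f : (Fin n → ℝ) → ℂ}
    (hv : HasModularCalculus h f ρ v) {U : Set ℝ} (hU : IsSpectralNhd h U)
    {g : 𝓢(EuclideanSpace ℝ (Fin n), ℂ)}
    (hg : ∀ x : EuclideanSpace ℝ (Fin n), (∀ l, x l ∈ U) → g x = f fun l => x l)
    (q : SubmultSeminorm A) {C : ℝ} {N : ℕ} (hb : IsTempered (q.toLocal h) C N) {k : 𝓢(ℝ, ℂ)}
    (l : q.Local →L[ℂ] ℂ) :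
    l (opCalc (q.toLocal h) k * q.toLocal v) = ∫ y : EuclideanSpace ℝ (Fin n) × ℝ,
      (𝓕 g) y.1 * (𝓕 k) y.2 * l (tripleFlow (q.toLocal h) (q.toLocal P.fst) (q.toLocal P.snd)
        (P.shifted y) (P.exponent 1 y.1) (P.exponent 2 y.1)) := by
  have hi : Integrable fun y : EuclideanSpace ℝ (Fin n) × ℝ => (𝓕 g) y.1 * (𝓕 k) y.2 *
      l (tripleFlow (q.toLocal h) (q.toLocal P.fst) (q.toLocal P.snd)
        (P.shifted y) (P.exponent 1 y.1) (P.exponent 2 y.1)) := by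
    have h0 : Continuous fun y : EuclideanSpace ℝ (Fin n) × ℝ => (𝓕 g) y.1 * (𝓕 k) y.2 :=
      ((𝓕 g).continuous.comp continuous_fst).mul ((𝓕 k).continuous.comp continuous_snd)
    have := l.integrable_comp (hb.integrable_tripleFlow (q.toLocal P.fst) (q.toLocal P.snd) h0
      P.continuous_shifted ((P.exponent 1).continuous.comp continuous_fst)
      ((P.exponent 2).continuous.comp continuous_fst) (P.integrable_shifted_weight g k N))
    exact this.congr (Eventually.of_forall fun _ => map_smul l _ _)
  rw [Measure.volume_eq_prod, integral_prod _ hi]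
  refine (P.eval hv hU hg q (l.comp (ContinuousLinearMap.mul ℂ q.Local
    (opCalc (q.toLocal h) k)))).trans (integral_congr_ae (Eventually.of_forall fun ξ => ?_))
  simp only [mul_assoc, integral_const_mul]
  congr 1
  set T := tripleFlow (q.toLocal h) (q.toLocal P.fst) (q.toLocal P.snd)
    (P.exponent 0 ξ) (P.exponent 1 ξ) (P.exponent 2 ξ) with hT
  have h1 := (l.comp ((ContinuousLinearMap.mul ℂ q.Local).flip T)).integral_comp_comm
    (hb.integrable k)
  refine h1.symm.trans (integral_congr_ae (Eventually.of_forall fun s => ?_))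
  simp only [map_smul, smul_eq_mul]
  congr 1
  simp [hT, tripleFlow, shifted, expI_add, mul_assoc]

variable [IsUniformAddGroup A] [T2Space A] [CompleteSpace A] [StarRing A]

/-- The Fourier integral for `exp (j h) f(𝐱)(ρ)`, with Schwartz functions `k` and `g` which agree
with `exp (j ·)` and `f` only near the spectrum in the Banach algebra `q.Local`. -/
lemma eval_exp_mul_modularCalculus (P : TriplePresentation ρ) (hA : IsMultiplicativelyConvex A)
    (hsa : HasTemperedSelfAdjoints A) {f : (Fin n → ℝ) → ℂ} (hf : ContDiff ℝ ∞ f)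
    {h : A} (hh : IsSelfAdjoint h) (q : SubmultSeminorm A) {C : ℝ} {N : ℕ}
    (hb : IsTempered (q.toLocal h) C N) {χ : 𝓢(ℝ, ℂ)} (hχ : opCalc (q.toLocal h) χ = 1) {R : ℝ}
    (hχR : ∀ x, χ x ≠ 0 → |x| < R) {k : 𝓢(ℝ, ℂ)} {j : ℝ}
    (hk : opCalc (q.toLocal h) k = NormedSpace.exp ((j : ℂ) • q.toLocal h))
    {g : 𝓢(EuclideanSpace ℝ (Fin n), ℂ)}
    (hg : ∀ x : EuclideanSpace ℝ (Fin n), (∀ l, x l ∈ Metric.ball (0 : ℝ) (2 * R)) →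
      g x = f fun l => x l)
    (l : q.Local →L[ℂ] ℂ) :
    l (NormedSpace.exp ((j : ℂ) • q.toLocal h) * q.toLocal (modularCalculus h f ρ)) =
    ∫ y : EuclideanSpace ℝ (Fin n) × ℝ, (𝓕 g) y.1 * (𝓕 k) y.2 *
      l (tripleFlow (q.toLocal h) (q.toLocal P.fst) (q.toLocal P.snd)
        (P.shifted y) (P.exponent 1 y.1) (P.exponent 2 y.1)) := by
  obtain ⟨R₁, hR₁⟩ := hsa.exists_isSpectralNhd hA hh
  obtain ⟨g₂, hg₂⟩ := exists_schwartz_eq_on_cube hf (max R₁ (2 * R))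
  have hv : HasModularCalculus h f ρ (modularCalculus h f ρ) := by
    have H : ∃ v, HasModularCalculus h f ρ v := (P.existsUnique hA hsa hh hf).exists
    rw [modularCalculus, dif_pos H]
    exact H.choose_spec
  rw [← hk, P.eval_exp_mul hv (hR₁ _ (le_max_left _ _)) hg₂ q hb l]
  have h0 : ∀ g : 𝓢(EuclideanSpace ℝ (Fin n), ℂ), Continuous fun y : EuclideanSpace ℝ (Fin n) × ℝ =>
      (𝓕 g) y.1 * (𝓕 k) y.2 := fun g =>
    ((𝓕 g).continuous.comp continuous_fst).mul ((𝓕 k).continuous.comp continuous_snd)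
  have m1 : Measurable fun y : EuclideanSpace ℝ (Fin n) × ℝ => P.exponent 1 y.1 :=
    ((P.exponent 1).continuous.comp continuous_fst).measurable
  have m2 : Measurable fun y : EuclideanSpace ℝ (Fin n) × ℝ => P.exponent 2 y.1 :=
    ((P.exponent 2).continuous.comp continuous_fst).measurable
  refine hb.integral_tripleFlow_congr hχ _ _ l (h0 g₂).aestronglyMeasurable
    P.continuous_shifted.measurable m1 m2 (P.integrable_shifted_weight g₂ k _)
    (h0 g).aestronglyMeasurable P.continuous_shifted.measurable m1 m2
    (P.integrable_shifted_weight g k _) (Eventually.of_forall fun x c0 c1 c2 => ?_)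
  rw [P.integral_shifted_character, P.integral_shifted_character]
  have hx0 := abs_lt.1 (hχR _ c0)
  have hx1 := abs_lt.1 (hχR _ c1)
  have hx2 := abs_lt.1 (hχR _ c2)
  have hmem : ∀ i, P.pt x i ∈ Metric.ball (0 : ℝ) (2 * R) := by
    intro i
    rw [mem_ball_zero_iff, Real.norm_eq_abs, abs_lt]
    rcases P.pt_apply x i with e | e <;> rw [e] <;> constructor <;> linarith
  rw [hg _ hmem, hg₂ _ fun i => Metric.ball_subset_ball (le_max_right _ _) (hmem i)]

end TriplePresentation

end ExpMul

/-! ### The derivation and the trace -/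

section Derivation

variable {A : Type*} [Ring A] [Algebra ℂ A] [UniformSpace A]

lemma trace_toLocal (q : SubmultSeminorm A) {φ₀ : A → ℂ} {φ : q.Local →L[ℂ] ℂ}
    (hφ : ∀ a, φ (q.toLocal a) = φ₀ a) (htr : ∀ a b, φ₀ (a * b) = φ₀ (b * a)) (x y : q.Local) :
    φ (x * y) = φ (y * x) := by
  refine q.denseRange_toLocal.induction_on₂ (p := fun x y => φ (x * y) = φ (y * x))
    (isClosed_eq (by fun_prop) (by fun_prop)) (fun a b => ?_) x y
  rw [← map_mul, ← map_mul, hφ, hφ, htr]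

variable [IsTopologicalRing A]

/-- In each of the Banach algebras `q.Local`, the curves `t ↦ αₜ(a)` are differentiable at `0`. -/
lemma IsInfinitesimalDerivation.exists_hasDerivAt {δ : A → A} (hδ : IsInfinitesimalDerivation δ) :
    ∃ α : ℝ → (A ≃A[ℂ] A), (∀ a, α 0 a = a) ∧ ∀ (q : SubmultSeminorm A) (a : A),
      HasDerivAt (fun t => q.toLocal (α t a)) (q.toLocal (δ a)) 0 := by
  obtain ⟨α, hα, hlim⟩ := hδ
  have h0 : ∀ a, α 0 a = a := fun a => (α 0).injective (show α 0 (α 0 a) = α 0 a by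
    rw [← hα, add_zero])
  refine ⟨α, h0, fun q a => ?_⟩
  rw [hasDerivAt_iff_tendsto_slope_zero]
  refine ((q.continuous_toLocal.tendsto _).comp (hlim a)).congr fun t => ?_
  simp only [Function.comp_apply, map_smul, map_sub, zero_add, h0]
  rw [← Complex.ofReal_inv, Complex.coe_smul]

lemma IsInfinitesimalDerivation.toLocal_add_smul {δ : A → A} (hδ : IsInfinitesimalDerivation δ)
    (q : SubmultSeminorm A) (h a : A) (z : ℂ) :
    q.toLocal (δ (h + z • a)) = q.toLocal (δ h) + z • q.toLocal (δ a) := by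
  obtain ⟨α, -, hd⟩ := hδ.exists_hasDerivAt
  refine (hd q (h + z • a)).unique ?_
  simpa only [map_add, map_smul] using (hd q h).fun_add ((hd q a).fun_const_smul z)

variable [IsUniformAddGroup A] [T2Space A] [CompleteSpace A]

/-- Integration by parts: the relation `φ₀ (δ (a E(p) d E(r))) = 0`, expanded by the Leibniz rule and
by Duhamel's formula for the derivatives of the exponentials. -/
lemma IsInfinitesimalDerivation.integration_by_parts (hA : IsMultiplicativelyConvex A) {δ : A → A}
    (hδ : IsInfinitesimalDerivation δ) {φ₀ : A → ℂ} (hinv : ∀ a, φ₀ (δ a) = 0)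
    (q : SubmultSeminorm A) {φ : q.Local →L[ℂ] ℂ} (hφ : ∀ a, φ (q.toLocal a) = φ₀ a)
    (h a d : A) (p r : ℝ) :
    φ (q.toLocal (δ a) * (expI (q.toLocal h) p * q.toLocal d * expI (q.toLocal h) r)) =
      -φ (q.toLocal a * (duhamel (q.toLocal h) (q.toLocal (δ h)) p *
          (q.toLocal d * expI (q.toLocal h) r) +
        expI (q.toLocal h) p * q.toLocal (δ d) * expI (q.toLocal h) r +
        expI (q.toLocal h) p * q.toLocal d * duhamel (q.toLocal h) (q.toLocal (δ h)) r)) := by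
  obtain ⟨α, h0, hd⟩ := hδ.exists_hasDerivAt
  let e : ℝ → A := fun s => NormedSpace.exp ((2 * (Real.pi : ℂ) * Complex.I * (s : ℂ)) • h)
  have he : ∀ s t, q.toLocal (α t (e s)) = expI (q.toLocal (α t h)) s := fun s t => by
    rw [map_exp_of_continuous hA, toLocal_exp hA, map_smul, map_smul, expI]
  have hE : ∀ s, HasDerivAt (fun t => q.toLocal (α t (e s)))
      (duhamel (q.toLocal h) (q.toLocal (δ h)) s) 0 := fun s => by
    simp only [he]
    have := hasDerivAt_expI_comp (hd q h) s
    rwa [h0] at this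
  have h1 := hd q (a * (e p * d * e r))
  have h2 := (hd q a).fun_mul (((hE p).fun_mul (hd q d)).fun_mul (hE r))
  simp only [map_mul] at h1
  have key := h1.unique h2
  have h3 : φ (q.toLocal (δ (a * (e p * d * e r)))) = 0 := by rw [hφ, hinv]
  rw [key, map_add] at h3
  simp only [he] at h3
  simp only [h0] at h3
  rw [eq_neg_of_add_eq_zero_left h3]
  simp only [add_mul, mul_assoc]

end Derivation

/-! ### Comparison of the symbols -/

section Matching

/-- Almost every triple has distinct coordinates, so that the values of divided differences on the
diagonals do not matter for symbols. -/
lemma ae_coord_ne : ∀ᵐ x : ℝ × ℝ × ℝ, x.2.1 ≠ x.1 ∧ x.2.2 ≠ x.2.1 ∧ x.1 ≠ x.2.2 := by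
  have hne : ∀ a : ℝ, ∀ᵐ x : ℝ, x ≠ a := fun a => (Set.countable_singleton a).ae_notMem volume
  have hs : MeasurableSet {x : ℝ × ℝ × ℝ | x.2.1 ≠ x.1 ∧ x.2.2 ≠ x.2.1 ∧ x.1 ≠ x.2.2} :=
    (((isOpen_ne_fun (by fun_prop) (by fun_prop)).inter
      ((isOpen_ne_fun (by fun_prop) (by fun_prop)).inter
        (isOpen_ne_fun (by fun_prop) (by fun_prop))))).measurableSet
  refine (Measure.ae_prod_mem_iff_ae_ae_mem hs).2 (Eventually.of_forall fun x₀ => ?_)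
  refine (Measure.ae_prod_mem_iff_ae_ae_mem (hs.preimage measurable_prodMk_left)).2 ?_
  filter_upwards [hne x₀] with x₁ h1
  filter_upwards [hne x₁, hne x₀] with x₂ h2 h3
  exact ⟨h1, h2, h3.symm⟩

variable {A : Type*} [Ring A] [Algebra ℂ A] [UniformSpace A] [IsTopologicalRing A]
  [IsUniformAddGroup A] [T2Space A] [CompleteSpace A]

lemma integral_shifted_character_one (hA : IsMultiplicativelyConvex A) (ρ : A)
    {f : (Fin 1 → ℝ) → ℂ} {R j : ℝ} {k : 𝓢(ℝ, ℂ)} {g : 𝓢(EuclideanSpace ℝ (Fin 1), ℂ)}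
    (hk : ∀ x ∈ Metric.ball (0 : ℝ) R, k x = Complex.exp (j * x))
    (hg : ∀ x : EuclideanSpace ℝ (Fin 1), (∀ l, x l ∈ Metric.ball (0 : ℝ) (2 * R)) →
      g x = f fun l => x l) {x₀ x₁ : ℝ} (h₀ : x₀ ∈ Metric.ball (0 : ℝ) R)
    (h₁ : x₁ ∈ Metric.ball (0 : ℝ) R) (x₂ : ℝ) :
    ∫ y : EuclideanSpace ℝ (Fin 1) × ℝ, (𝓕 g) y.1 * (𝓕 k) y.2 *
      character (y.2 + -y.1 0) (y.1 0) 0 x₀ x₁ x₂ = twistedSymbol j f x₀ x₁ := by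
  refine ((triplePresentationOne hA ρ).integral_shifted_character g k (x₀, x₁, x₂)).trans ?_
  rw [hk _ h₀, hg, twistedSymbol]
  · congr 2
  · intro l
    rw [mem_ball_zero_iff, Real.norm_eq_abs, abs_lt] at h₀ h₁ ⊢
    fin_cases l
    simp only [triplePresentationOne, Fin.reduceFinMk, PiLp.toLp_apply, Matrix.cons_val]
    constructor <;> linarith

lemma integral_shifted_character_two (hA : IsMultiplicativelyConvex A) (ρ₁ ρ₂ : A)
    {f : (Fin 2 → ℝ) → ℂ} {R j : ℝ} {k : 𝓢(ℝ, ℂ)} {g : 𝓢(EuclideanSpace ℝ (Fin 2), ℂ)}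
    (hk : ∀ x ∈ Metric.ball (0 : ℝ) R, k x = Complex.exp (j * x))
    (hg : ∀ x : EuclideanSpace ℝ (Fin 2), (∀ l, x l ∈ Metric.ball (0 : ℝ) (2 * R)) →
      g x = f fun l => x l) {x₀ x₁ x₂ : ℝ} (h₀ : x₀ ∈ Metric.ball (0 : ℝ) R)
    (h₁ : x₁ ∈ Metric.ball (0 : ℝ) R) (h₂ : x₂ ∈ Metric.ball (0 : ℝ) R) :
    ∫ y : EuclideanSpace ℝ (Fin 2) × ℝ, (𝓕 g) y.1 * (𝓕 k) y.2 *
      character (y.2 + -y.1 0) (y.1 0 - y.1 1) (y.1 1) x₀ x₁ x₂ =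
      Complex.exp ((j : ℂ) * (x₀ : ℂ)) * f ![x₁ - x₀, x₂ - x₁] := by
  refine ((triplePresentationTwo hA ρ₁ ρ₂).integral_shifted_character g k (x₀, x₁, x₂)).trans ?_
  rw [hk _ h₀, hg]
  · congr 2
  · intro l
    rw [mem_ball_zero_iff, Real.norm_eq_abs, abs_lt] at h₀ h₁ h₂ ⊢
    fin_cases l <;>
      simp only [triplePresentationTwo, Fin.reduceFinMk, PiLp.toLp_apply, Matrix.cons_val] <;>
      constructor <;> linarith

end Matching

/-! ### The integral of the variation -/

section Gradient

variable {A : Type*} [Ring A] [Algebra ℂ A] [UniformSpace A] [IsTopologicalRing A]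
  [IsUniformAddGroup A] [T2Space A] [CompleteSpace A] [StarRing A]

/-- The integral of the variation is the Fourier integral for the gradient: both sides are integrals
of triple flows, and their symbols agree. -/
lemma integral_variationIntegrand_eq (hA : IsMultiplicativelyConvex A)
    (hsa : HasTemperedSelfAdjoints A) {φ₀ : A → ℂ}
    (htrace : ∀ a b, φ₀ (a * b) = φ₀ (b * a)) {δ : A → A} (hδ : IsInfinitesimalDerivation δ)
    (hinv : ∀ a, φ₀ (δ a) = 0) (j : ℝ) {f : (Fin 1 → ℝ) → ℂ} (hf : ContDiff ℝ ∞ f)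
    (q : SubmultSeminorm A) {φ : q.Local →L[ℂ] ℂ} (hφ : ∀ a, φ (q.toLocal a) = φ₀ a)
    {h : A} (hh : IsSelfAdjoint h) (a : A) {C : ℝ} {N : ℕ} (hb : IsTempered (q.toLocal h) C N)
    {χ : 𝓢(ℝ, ℂ)} (hχ : opCalc (q.toLocal h) χ = 1) {R : ℝ}
    (hχR : ∀ x, χ x ≠ 0 → x ∈ Metric.ball (0 : ℝ) R)
    {k : 𝓢(ℝ, ℂ)} (hk : ∀ x ∈ Metric.ball (0 : ℝ) R, k x = Complex.exp (j * x))
    (hkb : opCalc (q.toLocal h) k = NormedSpace.exp ((j : ℂ) • q.toLocal h))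
    {g : 𝓢(EuclideanSpace ℝ (Fin 1), ℂ)}
    (hg : ∀ x : EuclideanSpace ℝ (Fin 1), (∀ l, x l ∈ Metric.ball (0 : ℝ) (2 * R)) →
      g x = f fun l => x l) :
    ∫ y : EuclideanSpace ℝ (Fin 1) × ℝ, (𝓕 g) y.1 * (𝓕 k) y.2 *
      variationIntegrand φ (q.toLocal h) (q.toLocal a) (q.toLocal (δ h)) (q.toLocal (δ a))
        (y.2 + -y.1 0) (y.1 0) =
      φ₀ (a * (NormedSpace.exp ((j : ℂ) • h) * (modularCalculus h (spectralK j f) ![δ (δ h)] +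
        modularCalculus h (connesMoscovici j (spectralK j f)) ![δ h, δ h]))) := by
  have hKs := contDiff_spectralK j hf
  have hHs := contDiff_connesMoscovici j hKs
  obtain ⟨gK, hgK⟩ := exists_schwartz_eq_on_cube hKs (2 * R)
  obtain ⟨gH, hgH⟩ := exists_schwartz_eq_on_cube hHs (2 * R)
  have hχR' : ∀ x, χ x ≠ 0 → |x| < R := fun x hx => by simpa using hχR x hx
  set c : EuclideanSpace ℝ (Fin 1) × ℝ → ℂ := fun y => (𝓕 g) y.1 * (𝓕 k) y.2 with hc_def
  set p : EuclideanSpace ℝ (Fin 1) × ℝ → ℝ := fun y => y.2 + -y.1 0 with hp_def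
  set r : EuclideanSpace ℝ (Fin 1) × ℝ → ℝ := fun y => y.1 0 with hr_def
  have hcont : ∀ {n : ℕ} (g : 𝓢(EuclideanSpace ℝ (Fin n), ℂ)),
      Continuous fun y : EuclideanSpace ℝ (Fin n) × ℝ => (𝓕 g) y.1 * (𝓕 k) y.2 := fun g =>
    ((𝓕 g).continuous.comp continuous_fst).mul ((𝓕 k).continuous.comp continuous_snd)
  have hc : Continuous c := hcont g
  have hp : Continuous p := by fun_prop
  have hr : Continuous r := by fun_prop
  have hw : ∀ m, Integrable fun t => ‖c t‖ * ((1 + |p t|) * (1 + |r t|)) ^ m := fun m => by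
    have := (triplePresentationOne hA h).integrable_shifted_weight g k m
    simpa [TriplePresentation.shifted, triplePresentationOne, hc_def, hp_def, hr_def] using this
  have hw₀ : ∀ m, Integrable fun t => ‖c t‖ * (1 + |p t|) ^ m := fun m => by
    refine (hw m).mono' (Continuous.aestronglyMeasurable (by fun_prop))
      (Eventually.of_forall fun t => ?_)
    rw [Real.norm_of_nonneg (by positivity)]
    gcongr
    exact le_mul_of_one_le_right (by positivity) (by linarith [abs_nonneg (r t)])
  have hw₁ : ∀ m, Integrable fun t => ‖c t‖ * (1 + |r t|) ^ m := fun m => by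
    refine (hw m).mono' (Continuous.aestronglyMeasurable (by fun_prop))
      (Eventually.of_forall fun t => ?_)
    rw [Real.norm_of_nonneg (by positivity)]
    gcongr
    exact le_mul_of_one_le_left (by positivity) (by linarith [abs_nonneg (p t)])
  -- near the spectrum the symbol of the density `c` is `θ`
  have hθ : ∀ {x y : ℝ}, χ x ≠ 0 → χ y ≠ 0 →
      pairSymbol volume c p r x y = twistedSymbol j f x y := fun {x y} hx hy => by
    rw [← integral_shifted_character_one hA h hk hg (hχR x hx) (hχR y hy) 0]
    simp only [pairSymbol, character, zero_mul, add_zero]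
    rfl
  set l : q.Local →L[ℂ] ℂ := φ.comp (ContinuousLinearMap.mul ℂ q.Local (q.toLocal a)) with hl
  have hl_apply : ∀ x, l x = φ (q.toLocal a * x) := fun x => rfl
  rw [integral_variationIntegrand (trace_toLocal q hφ htrace)
    (fun p r => hδ.integration_by_parts hA hinv q hφ h a (δ h) p r) hb hc hp hr hw]
  have hval : φ₀ (a * (NormedSpace.exp ((j : ℂ) • h) *
      (modularCalculus h (spectralK j f) ![δ (δ h)] +
        modularCalculus h (connesMoscovici j (spectralK j f)) ![δ h, δ h]))) =
      l (NormedSpace.exp ((j : ℂ) • q.toLocal h) *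
        q.toLocal (modularCalculus h (spectralK j f) ![δ (δ h)])) +
      l (NormedSpace.exp ((j : ℂ) • q.toLocal h) *
        q.toLocal (modularCalculus h (connesMoscovici j (spectralK j f)) ![δ h, δ h])) := by
    rw [← hφ, ← map_add, hl_apply, ← mul_add, map_mul q.toLocal, map_mul q.toLocal,
      map_add q.toLocal, toLocal_exp hA, map_smul]
  rw [hval, (triplePresentationOne hA (δ (δ h))).eval_exp_mul_modularCalculus hA hsa hKs hh q hb hχ
    hχR' hkb hgK l, (triplePresentationTwo hA (δ h) (δ h)).eval_exp_mul_modularCalculus hA hsa hHs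
    hh q hb hχ hχR' hkb hgH l]
  simp only [← hl_apply]
  congr 1
  -- the first-order part: `-(θ(λ₀, λ₁) + θ(λ₁, λ₀))` is the symbol for `K`
  · have hsum := hb.sum_integral_tripleFlow_eq hχ (q.toLocal (δ (δ h))) 1 l
      (c := fun _ : Fin 2 => fun t => -c t) (y₀ := ![p, r]) (y₁ := ![r, p]) (y₂ := fun _ _ => 0)
      (μ := volume) (μ' := volume) (c' := fun y => (𝓕 gK) y.1 * (𝓕 k) y.2)
      (y₀' := p) (y₁' := r) (y₂' := fun _ => 0)
      (fun _ => hc.neg) (fun i => by fin_cases i <;> assumption)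
      (fun i => by fin_cases i <;> assumption) (fun _ => continuous_const)
      (fun i M => by
        fin_cases i
        · simpa using hw M
        · simpa [mul_comm (1 + |r _|)] using hw M)
      (hcont gK) hp hr continuous_const
      (by
        have := (triplePresentationOne hA h).integrable_shifted_weight gK k (N + 2)
        simpa [TriplePresentation.shifted, triplePresentationOne] using this)
      (Eventually.of_forall fun x h0 h1 h2 => by
        have e := integral_shifted_character_one hA h hk hgK (hχR _ h0) (hχR _ h1) x.2.2
        rw [twistedSymbol_spectralK, ← hθ h0 h1, ← hθ h1 h0] at e
        refine Eq.trans ?_ e.symm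
        simp only [Fin.sum_univ_two, neg_mul, integral_neg, Matrix.cons_val_zero,
          Matrix.cons_val_one, neg_add, character, pairSymbol, zero_mul, add_zero]
        congr 2
        refine integral_congr_ae (Eventually.of_forall fun t => ?_)
        simp only [add_comm])
    refine hsum.trans ?_
    simp [TriplePresentation.shifted, triplePresentationOne, hp_def, hr_def]
  -- the second-order part: the alternating sum of divided differences is the symbol for `H`
  · have hsum := hb.sum_integral_tripleFlow_eq hχ (q.toLocal (δ h)) (q.toLocal (δ h)) l
      (c := fun i : Fin 6 => fun x : (EuclideanSpace ℝ (Fin 1) × ℝ) × ℝ =>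
        c x.1 * sixCoeff (p x.1) (r x.1) i)
      (y₀ := fun i x => sixFst (p x.1) (r x.1) x.2 i)
      (y₁ := fun i x => sixSnd (p x.1) (r x.1) x.2 i)
      (y₂ := fun i x => sixTrd (p x.1) (r x.1) x.2 i)
      (μ := volume.prod (volume.restrict (Set.Ioc (0 : ℝ) 1))) (μ' := volume)
      (c' := fun y : EuclideanSpace ℝ (Fin 2) × ℝ => (𝓕 gH) y.1 * (𝓕 k) y.2)
      (y₀' := fun y => y.2 + -y.1 0) (y₁' := fun y => y.1 0 - y.1 1) (y₂' := fun y => y.1 1)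
      (fun i => (hc.comp continuous_fst).mul (continuous_sixCoeff hp hr i))
      (continuous_sixFst hp hr) (continuous_sixSnd hp hr) (continuous_sixTrd hp hr)
      (integrable_six_weight hc hp hr hw) (hcont gH) (by fun_prop) (by fun_prop) (by fun_prop)
      (by
        have := (triplePresentationTwo hA h h).integrable_shifted_weight gH k (N + 2)
        simpa [TriplePresentation.shifted, triplePresentationTwo] using this)
      (by
        filter_upwards [ae_coord_ne] with x hx h0 h1 h2
        rw [integral_shifted_character_two hA h h hk hgH (hχR _ h0) (hχR _ h1) (hχR _ h2),
          exp_mul_connesMoscovici j _ hx.1 hx.2.1 hx.2.2,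
          sum_six_symbol hc hp hr (by simpa using hw₀ 1) (by simpa using hw₁ 1)
            hx.1 hx.2.1 hx.2.2]
        simp only [twistedSymbol_spectralK, hθ h0 h1, hθ h1 h0, hθ h0 h2, hθ h2 h0, hθ h1 h2,
          hθ h2 h1]
        ring)
    refine hsum.trans ?_
    simp [TriplePresentation.shifted, triplePresentationTwo]

end Gradient

/-! ### The gradient -/

section GradientFormula

lemma realSpectrum_subset_closedBall {B : Type*} [NormedRing B] [NormedAlgebra ℂ B]
    [CompleteSpace B] (b : B) : realSpectrum b ⊆ Metric.closedBall 0 (‖b‖ * ‖(1 : B)‖) := by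
  intro x hx
  have := spectrum.norm_le_norm_mul_of_mem hx
  simpa using this

variable {A : Type*} [Ring A] [Algebra ℂ A] [StarRing A] [StarModule ℂ A]

lemma isSelfAdjoint_add_smul {h a : A} (hh : IsSelfAdjoint h) (ha : IsSelfAdjoint a) (ε : ℝ) :
    IsSelfAdjoint (h + (ε : ℂ) • a) :=
  hh.add (IsSelfAdjoint.smul (Complex.conj_ofReal ε) ha)

variable [UniformSpace A]

/-- Gradients are unique if the pairing is nondegenerate, since every element is a combination of
self-adjoint ones. -/
lemma IsGradientAt.eq {φ₀ : A →L[ℂ] ℂ} {F : A → ℂ} {h G G' : A} (hG : IsGradientAt φ₀ F h G)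
    (hG' : IsGradientAt φ₀ F h G')
    (hnd : ∀ b : A, (∀ a : A, φ₀ (a * b) = 0) → b = 0) : G = G' := by
  refine sub_eq_zero.1 (hnd _ fun a => ?_)
  have hs : ∀ a : A, IsSelfAdjoint a → φ₀ (a * (G - G')) = 0 := fun a ha => by
    rw [mul_sub, map_sub, (hG a ha).unique (hG' a ha), sub_self]
  rw [← realPart_add_I_smul_imaginaryPart a, add_mul, smul_mul_assoc, map_add, map_smul,
    hs _ (realPart a).2, hs _ (imaginaryPart a).2]
  simp

variable [IsUniformAddGroup A] [IsTopologicalRing A] [T2Space A] [CompleteSpace A]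
  [ContinuousSMul ℂ A]

/-- The asserted element is a gradient: for all small `ε`, the value `F(h + ε a)` is an absolutely
convergent integral of `φ (δh E(s - ξ) δh E(ξ))`, with `h + ε a` in the place of `h`, whose density
does not depend on `ε`, so that the derivative may be taken under the integral sign. -/
theorem isGradientAt_functionalF (hA : IsMultiplicativelyConvex A)
    (hsa : HasTemperedSelfAdjoints A) (φ₀ : A →L[ℂ] ℂ)
    (htrace : ∀ a b, φ₀ (a * b) = φ₀ (b * a)) {δ : A → A} (hδ : IsInfinitesimalDerivation δ)
    (hinv : ∀ a, φ₀ (δ a) = 0) (j : ℝ) {f : (Fin 1 → ℝ) → ℂ} (hf : ContDiff ℝ ∞ f)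
    {h : A} (hh : IsSelfAdjoint h) :
    IsGradientAt φ₀ (functionalF φ₀ δ j f) h
      (NormedSpace.exp ((j : ℂ) • h) * (modularCalculus h (spectralK j f) ![δ (δ h)] +
        modularCalculus h (connesMoscovici j (spectralK j f)) ![δ h, δ h])) := by
  intro a ha
  obtain ⟨q, φ, hφ⟩ := exists_factor hA φ₀
  obtain ⟨V, hV, C, N, hbV⟩ := hsa.exists_isTempered hA q hh
  have hε : ∀ ε : ℝ, q.toLocal (h + (ε : ℂ) • a) = q.toLocal h + (ε : ℂ) • q.toLocal a := fun ε => by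
    rw [map_add, map_smul]
  have hb : ∀ᶠ ε : ℝ in 𝓝 0, IsTempered (q.toLocal h + (ε : ℂ) • q.toLocal a) C N := by
    have hcont : Continuous fun ε : ℝ => h + (ε : ℂ) • a := by fun_prop
    have := hcont.tendsto 0
    simp only [Complex.ofReal_zero, zero_smul, add_zero] at this
    filter_upwards [this.eventually hV] with ε h1
    rw [← hε]
    exact hbV _ h1 (isSelfAdjoint_add_smul hh ha ε)
  have hb₀ : IsTempered (q.toLocal h) C N := by simpa using hb.self_of_nhds
  -- all the spectra in `q.Local`, for `|ε| ≤ 1`, lie in one and the same interval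
  set R₀ : ℝ := (‖q.toLocal h‖ + ‖q.toLocal a‖) * ‖(1 : q.Local)‖ with hR₀
  set R : ℝ := R₀ + 1 with hR
  have hspec : ∀ ε : ℝ, |ε| ≤ 1 →
      realSpectrum (q.toLocal h + (ε : ℂ) • q.toLocal a) ⊆ Metric.closedBall 0 R₀ := by
    intro ε h1
    refine (realSpectrum_subset_closedBall _).trans (Metric.closedBall_subset_closedBall ?_)
    rw [hR₀]
    gcongr
    refine (norm_add_le _ _).trans ?_
    rw [norm_smul, Complex.norm_real]
    gcongr
    exact mul_le_of_le_one_left (norm_nonneg _) h1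
  have hball : Metric.closedBall (0 : ℝ) R₀ ⊆ Metric.ball 0 R :=
    Metric.closedBall_subset_ball (by linarith)
  obtain ⟨χ, -, ⟨W, hW, hKW, hχ1⟩, hχ0⟩ :=
    exists_schwartz_cutoff (isCompact_closedBall (0 : ℝ) R₀) Metric.isOpen_ball hball
  have hχR : ∀ x, χ x ≠ 0 → x ∈ Metric.ball (0 : ℝ) R := fun x hx => by
    by_contra h
    exact hx (hχ0 x h)
  obtain ⟨k, hk⟩ := exists_schwartz_eq_on (f := fun x : ℝ => Complex.exp (j * x))
    ((contDiff_const.mul Complex.ofRealCLM.contDiff).cexp) (isCompact_closedBall (0 : ℝ) R)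
  have hk : ∀ x ∈ Metric.ball (0 : ℝ) R, k x = Complex.exp (j * x) := fun x hx =>
    hk x (Metric.ball_subset_closedBall hx)
  obtain ⟨g, hg⟩ := exists_schwartz_eq_on_cube hf (2 * R)
  have hcalc : ∀ ε : ℝ, |ε| ≤ 1 → IsTempered (q.toLocal h + (ε : ℂ) • q.toLocal a) C N →
      opCalc (q.toLocal h + (ε : ℂ) • q.toLocal a) χ = 1 ∧
      opCalc (q.toLocal h + (ε : ℂ) • q.toLocal a) k =
        NormedSpace.exp ((j : ℂ) • (q.toLocal h + (ε : ℂ) • q.toLocal a)) := fun ε h1 h2 =>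
    ⟨h2.opCalc_eq_one hW ((hspec ε h1).trans hKW) hχ1,
      h2.opCalc_eq_exp Metric.isOpen_ball ((hspec ε h1).trans hball) hk⟩
  -- neither the Schwartz functions `k` and `g` nor the cutoff `χ` depend on `ε`
  have hF : ∀ᶠ ε : ℝ in 𝓝 0, functionalF φ₀ δ j f (h + (ε : ℂ) • a) =
      ∫ y : EuclideanSpace ℝ (Fin 1) × ℝ, (𝓕 g) y.1 * (𝓕 k) y.2 *
        φ ((q.toLocal (δ h) + (ε : ℂ) • q.toLocal (δ a)) *
          (expI (q.toLocal h + (ε : ℂ) • q.toLocal a) (y.2 + -y.1 0) *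
          (q.toLocal (δ h) + (ε : ℂ) • q.toLocal (δ a)) *
          expI (q.toLocal h + (ε : ℂ) • q.toLocal a) (y.1 0))) := by
    filter_upwards [hb, Metric.closedBall_mem_nhds (0 : ℝ) one_pos] with ε h1 h2
    have h2 : |ε| ≤ 1 := by simpa using h2
    obtain ⟨e1, e2⟩ := hcalc ε h2 h1
    rw [← hε] at h1 e1 e2 ⊢
    rw [← hδ.toLocal_add_smul]
    have key := (triplePresentationOne hA (δ (h + (ε : ℂ) • a))).eval_exp_mul_modularCalculus hA hsa
      hf (isSelfAdjoint_add_smul hh ha ε) q h1 e1 (fun x hx => by simpa using hχR x hx) e2 hg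
      (φ.comp (ContinuousLinearMap.mul ℂ q.Local (q.toLocal (δ (h + (ε : ℂ) • a)))))
    rw [functionalF, htrace, ← hφ, map_mul q.toLocal, map_mul q.toLocal, toLocal_exp hA, map_smul]
    refine key.trans (integral_congr_ae (Eventually.of_forall fun y => ?_))
    simp [TriplePresentation.shifted, triplePresentationOne, tripleFlow]
  have hc : Continuous fun y : EuclideanSpace ℝ (Fin 1) × ℝ => (𝓕 g) y.1 * (𝓕 k) y.2 :=
    ((𝓕 g).continuous.comp continuous_fst).mul ((𝓕 k).continuous.comp continuous_snd)
  have hd := hasDerivAt_integral_flow (μ := volume) (p := fun y => y.2 + -y.1 0)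
    (r := fun y => y.1 0) φ (q.toLocal h) (q.toLocal a) (q.toLocal (δ h)) (q.toLocal (δ a)) hb hc
    (by fun_prop) (by fun_prop) fun m => by
      have := (triplePresentationOne hA h).integrable_shifted_weight g k m
      simpa [TriplePresentation.shifted, triplePresentationOne] using this
  have hc₀ := hcalc 0 (by simp) (by simpa using hb₀)
  simp only [Complex.ofReal_zero, zero_smul, add_zero] at hc₀
  rw [integral_variationIntegrand_eq hA hsa htrace hδ hinv j hf q hφ hh a hb₀ hc₀.1 hχR hk hc₀.2
    hg] at hd
  exact hd.congr_of_eventuallyEq hF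

end GradientFormula

end ModularVariation

end

theorem mainTheorem2 {A : Type*} [Ring A] [Algebra ℂ A] [StarRing A] [StarModule ℂ A]
    [UniformSpace A] [IsUniformAddGroup A] [IsTopologicalRing A] [ContinuousSMul ℂ A]
    (hA : ModularVariation.IsNuclearFrechetAlgebra A)
    (hsa : ModularVariation.HasTemperedSelfAdjoints A)
    (φ₀ : A →L[ℂ] ℂ) (htrace : ∀ a b : A, φ₀ (a * b) = φ₀ (b * a))
    (δ : A → A) (hδ : ModularVariation.IsInfinitesimalDerivation δ)
    (hinv : ∀ a : A, φ₀ (δ a) = 0)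
    (j : ℝ) (f : (Fin 1 → ℝ) → ℂ) (hf : ContDiff ℝ ∞ f) :
    ModularVariation.IsSpectralFunction A f ∧
    ModularVariation.IsSpectralFunction A (ModularVariation.spectralK j f) ∧
    ModularVariation.IsSpectralFunction A
      (ModularVariation.connesMoscovici j (ModularVariation.spectralK j f)) ∧
    ∀ h : A, IsSelfAdjoint h →
      ModularVariation.IsGradientAt φ₀ (ModularVariation.functionalF φ₀ δ j f) h
        (NormedSpace.exp ((j : ℂ) • h) *
          (ModularVariation.modularCalculus h (ModularVariation.spectralK j f) ![δ (δ h)] +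
            ModularVariation.modularCalculus h
              (ModularVariation.connesMoscovici j (ModularVariation.spectralK j f))
              ![δ h, δ h])) ∧
      ((∀ b : A, (∀ a : A, φ₀ (a * b) = 0) → b = 0) →
        ∀ G : A, ModularVariation.IsGradientAt φ₀ (ModularVariation.functionalF φ₀ δ j f) h G →
          G = NormedSpace.exp ((j : ℂ) • h) *
            (ModularVariation.modularCalculus h (ModularVariation.spectralK j f) ![δ (δ h)] +
              ModularVariation.modularCalculus h
                (ModularVariation.connesMoscovici j (ModularVariation.spectralK j f))
                ![δ h, δ h])) := by
  have := hA.t2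
  have := hA.complete
  have hmc := hA.multiplicativelyConvex
  have hK := ModularVariation.contDiff_spectralK j hf
  refine ⟨ModularVariation.isSpectralFunction_one hmc hsa hf,
    ModularVariation.isSpectralFunction_one hmc hsa hK,
    ModularVariation.isSpectralFunction_two hmc hsa
      (ModularVariation.contDiff_connesMoscovici j hK), fun h hh => ?_⟩
  have hgrad := ModularVariation.isGradientAt_functionalF hmc hsa φ₀ htrace hδ hinv j hf hh
  exact ⟨hgrad, fun hnd G hG => hG.eq hgrad hnd⟩
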